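/- **Setting.** Let $\rho_D,\rho_A,\eta_D,\eta_A,\sigma,R_0>0$ be the densities and viscosities of a droplet fluid ($D$) and an ambient fluid ($A$), the surface tension and the droplet radius. Put $\Omega_D=\{x\in\mathbb R^2:|x|<R_0\}$, $\Omega_A=\{|x|>R_0\}$, $\Gamma_0=\{|x|=R_0\}$, with unit normal $n_0=e_r$ and tangent $t_0=e_\theta$. Let $k\ge 2$ be an integer, $0\le\beta\le1$, and $\gamma\in\mathbb C$ with $\operatorname{Re}\gamma\ge0$. Set $f(\theta)=\beta\cos k\theta+\sqrt{1-\beta^2}\,\sin k\theta$ and consider the interface perturbation $r=R_0+\delta\zeta$ with $\zeta(\theta,t)=R_0f(\theta)e^{-\gamma t}$. Let $\mathcal V_1$ and $\kappa_1$ be the first variations at $\delta=0$ (extended complex-linearly to complex $\zeta$) of the outward normal velocity of the interface and of its curvature, the latter taken negative for a circle bounding the droplet. *Linearized problem.* Complex-valued $(u_i,p_i)$, $i\in\{D,A\}$, solve the linearized problem if, for $t>0$, they are bounded and regular up to the boundary ($u_i$ is $C^2$ and $p_i$ is $C^1$ in $(t,x)$), $(u_A,p_A)\to0$ as $|x|\to\infty$,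 and $$\rho_i\partial_tu_i-\eta_i\Delta u_i+\nabla p_i=0,\qquad \nabla\cdot u_i=0\quad\text{in }\Omega_i,$$ $$u_D\cdot n_0=u_A\cdot n_0=\mathcal V_1,\qquad [\![u\cdot t_0]\!]=0,\qquad [\![-\eta(\nabla u+\nabla u^T)n_0+p\,n_0]\!]=\sigma\kappa_1n_0\quad\text{on }\Gamma_0,$$ where $[\![g]\!]=g_A-g_D$. *Modal fields.* For $n_D,n_A\in\mathbb Z_{\ge0}$ and $m_i,C_i,D_i,A,B,E,F\in\mathbb C$ with $\operatorname{Re}(m_i^2)\ge0$ and $\operatorname{Im}m_A<0$ (admissible coefficients), put $\Upsilon_D(r)=AJ_{n_D}(m_Dr)+Er^{n_D}$ and $\Upsilon_A(r)=BH^{(2)}_{n_A}(m_Ar)+Fr^{-n_A}$, with $J_n$ the Bessel function of the first kind and $H^{(2)}_n$ the Hankel function of the second kind. The modal fields are $$u_{i,r}=e^{-\frac{\eta_i}{\rho_i}m_i^2t}\,[D_i\cos n_i\theta-C_i\sin n_i\theta]\,\tfrac{n_i}{r}\Upsilon_i(r),\qquad u_{i,\theta}=-e^{-\frac{\eta_i}{\rho_i}m_i^2t}\,[C_i\cos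 n_i\theta+D_i\sin n_i\theta]\,\Upsilon_i'(r),$$ $$p_D=E\eta_Dm_D^2e^{-\frac{\eta_D}{\rho_D}m_D^2t}r^{n_D}[D_D\cos n_D\theta-C_D\sin n_D\theta],\qquad p_A=-F\eta_Am_A^2e^{-\frac{\eta_A}{\rho_A}m_A^2t}r^{-n_A}[D_A\cos n_A\theta-C_A\sin n_A\theta],$$ where $\Upsilon_i'$ is written out with $J_n'(z)=J_{n-1}(z)-\frac nzJ_n(z)$ and $H^{(2)\prime}_n(z)=H^{(2)}_{n-1}(z)-\frac nzH^{(2)}_n(z)$. *System.* With $J=J_k(m_DR_0)$, $\bar J=J_{k-1}(m_DR_0)$, $H=H^{(2)}_k(m_AR_0)$, $\bar H=H^{(2)}_{k-1}(m_AR_0)$ and $R=R_0$, let $\mathbf A\,(A,B,E,F)^T=\mathbf b$ denote the five equations $$\tfrac kR JA+kR^{k-1}E=-\gamma R,\qquad \tfrac kRHB+kR^{-k-1}F=-\gamma R,$$ $$-\big(m_D\bar J-\tfrac kRJ\big)A+\big(m_A\bar H-\tfrac kRH\big)B-kR^{k-1}E-kR^{-k-1}F=0,$$ $$-\eta_D\Big[\tfrac{2m_Dk}{R}\bar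 J-\tfrac{2k(k+1)}{R^2}J\Big]A+\eta_A\Big[\tfrac{2m_Ak}{R}\bar H-\tfrac{2k(k+1)}{R^2}H\Big]B+\eta_D\big[m_D^2R^k-2k(k-1)R^{k-2}\big]E+\eta_A\big[m_A^2R^{-k}-2k(k+1)R^{-k-2}\big]F=\tfrac{\sigma}{R}(k^2-1),$$ $$-\eta_D\Big[\tfrac{2m_D}{R}\bar J+\big(m_D^2-\tfrac{2k(k+1)}{R^2}\big)J\Big]A+\eta_A\Big[\tfrac{2m_A}{R}\bar H+\big(m_A^2-\tfrac{2k(k+1)}{R^2}\big)H\Big]B+2\eta_Dk(k-1)R^{k-2}E-2\eta_Ak(k+1)R^{-k-2}F=0.$$ **Claim 1.** Modal fields with admissible coefficients solve the linearized problem if and only if $\frac{\eta_D}{\rho_D}m_D^2=\frac{\eta_A}{\rho_A}m_A^2=\gamma$, $n_D=n_A=k$, and there are $s_D,s_A\in\mathbb C$ with $D_i=s_i\beta$, $C_i=-s_i\sqrt{1-\beta^2}$ for $i\in\{D,A\}$, such that $(s_DA,s_AB,s_DE,s_AF)$ solves $\mathbf A x=\mathbf b$. **Claim 2.** Let $m_D,m_A\in\mathbb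 C$ be any numbers with $\frac{\eta_D}{\rho_D}m_D^2=\frac{\eta_A}{\rho_A}m_A^2=\gamma$ and $\operatorname{Im}m_A<0$. Then: 1. The modal fields with $n_i=k$, $D_i=\beta$, $C_i=-\sqrt{1-\beta^2}$ and coefficients $(A,B,E,F)$ solve the linearized problem if and only if $\mathbf A(A,B,E,F)^T=\mathbf b$. 2. Modal fields with admissible coefficients that solve the linearized problem exist if and only if $\det(\mathbf A|\mathbf b)=0$. 3. The four columns of $\mathbf A$ are linearly independent. 4. $\mathbf b$ lies in the column space of $\mathbf A$ if and only if $\det(\mathbf A|\mathbf b)=0$, and in that case $\mathbf Ax=\mathbf b$ has a unique solution. 5. Put $\tilde\gamma=\gamma\rho_DR_0^2/\eta_D$, $\tilde m_i=m_iR_0$, $\tilde\eta=\eta_A/\eta_D$, $\tilde\sigma=\sigma\rho_DR_0/\eta_D^2$, $\mathcal J=J_k(\tilde m_D)$, $\hat{\mathcal J}=\tilde m_DJ_{k-1}(\tilde m_D)$, $\mathcal H=H^{(2)}_k(\tilde m_A)$, $\hat{\mathcal H}=\tilde m_AH^{(2)}_{k-1}(\tilde m_A)$, $z=2k(k-1)$,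 $\xi=2k(k+1)$ and $$\mathbf M=\begin{pmatrix}k\mathcal J&0&k&0&-\tilde\gamma\\0&k\mathcal H&0&k&-\tilde\gamma\\-\hat{\mathcal J}+k\mathcal J&\hat{\mathcal H}-k\mathcal H&-k&-k&0\\-2k\hat{\mathcal J}+\xi\mathcal J&\tilde\eta[2k\hat{\mathcal H}-\xi\mathcal H]&\tilde m_D^2-z&\tilde\eta[\tilde m_A^2-\xi]&\tilde\sigma(k^2-1)\\-2\hat{\mathcal J}-(\tilde m_D^2-\xi)\mathcal J&\tilde\eta[2\hat{\mathcal H}+(\tilde m_A^2-\xi)\mathcal H]&z&-\tilde\eta\xi&0\end{pmatrix}.$$ Then $\det(\mathbf A|\mathbf b)=0$ if and only if $\det\mathbf M=0$. Moreover $\mathbf A(A,B,E,F)^T=\mathbf b$ if and only if $\mathbf M$ annihilates $\big(\frac{\rho_D}{\eta_D}A,\frac{\rho_D}{\eta_D}B,\frac{\rho_D}{\eta_D}R_0^kE,\frac{\rho_D}{\eta_D}R_0^{-k}F,-1\big)^T$. If $\det\mathbf M=0$, the kernel of $\mathbf M$ contains exactly one vector with fifth entry $-1$. -/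

import Mathlib

noncomputable section

namespace Droplet

/-! ## Bessel and Hankel functions of integer order -/

/-- Power series of the Bessel function of the first kind of order `n ≥ 0`. -/
def besselJNat (n : ℕ) (z : ℂ) : ℂ :=
  ∑' j : ℕ, (-1 : ℂ) ^ j / ((j.factorial : ℂ) * ((j + n).factorial : ℂ)) * (z / 2) ^ (2 * j + n)

/-- The Bessel function of the first kind `J_n` of integer order, with `J_{-n} = (-1)^n J_n`. -/
def besselJ : ℤ → ℂ → ℂ
  | Int.ofNat n, z => besselJNat n z
  | Int.negSucc n, z => (-1 : ℂ) ^ (n + 1) * besselJNat (n + 1) z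

/-- The Hankel function of the second kind `H^{(2)}_n` of integer order on the open lower
half-plane `Im z < 0` (the only arguments that occur), by the classical integral
`H^{(2)}_n(z) = - e^{n π i / 2} / (π i) ∫_{-∞}^{∞} e^{- i z cosh t - n t} dt`,
which converges absolutely there and represents the branch with `-π < arg z < 0`. -/
def hankel2 (n : ℤ) (z : ℂ) : ℂ :=
  -(Complex.exp ((n : ℂ) * (Real.pi : ℂ) * Complex.I / 2) / ((Real.pi : ℂ) * Complex.I)) *
    ∫ t : ℝ, Complex.exp (-Complex.I * z * (Real.cosh t : ℂ) - (n : ℂ) * (t : ℂ))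

/-! ## Physical data and geometry -/

/-- Densities, viscosities, surface tension and radius of the undeformed droplet;
`D` is the droplet fluid and `A` the ambient fluid. -/
structure Params where
  ρD : ℝ
  ρA : ℝ
  ηD : ℝ
  ηA : ℝ
  σ : ℝ
  R₀ : ℝ
  ρD_pos : 0 < ρD
  ρA_pos : 0 < ρA
  ηD_pos : 0 < ηD
  ηA_pos : 0 < ηA
  σ_pos : 0 < σ
  R₀_pos : 0 < R₀

/-- The Euclidean plane. -/
abbrev Plane : Type := EuclideanSpace ℝ (Fin 2)

/-- The undeformed droplet, `|x| < R₀`. -/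
def dropletDomain (R₀ : ℝ) : Set Plane := Metric.ball 0 R₀

/-- The undeformed ambient domain, `|x| > R₀`. -/
def ambientDomain (R₀ : ℝ) : Set Plane := (Metric.closedBall 0 R₀)ᶜ

/-- The radial unit vector at angle `θ`: the unit normal of the undeformed interface, external
to the droplet. -/
def normal (θ : ℝ) : Fin 2 → ℝ := ![Real.cos θ, Real.sin θ]

/-- The angular unit vector at angle `θ`: the unit tangent of the undeformed interface. -/
def tangent (θ : ℝ) : Fin 2 → ℝ := ![-Real.sin θ, Real.cos θ]

/-- The point of the undeformed interface at angle `θ`. -/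
def interfacePoint (R₀ θ : ℝ) : Plane := !₂[R₀ * Real.cos θ, R₀ * Real.sin θ]

/-! ## First variations of the interface velocity and curvature

The perturbed interface is the polar graph `r = R₀ + δ ζ(θ, t)`. The normal velocity and curvature
are linearized at `δ = 0`; complex-valued perturbations are treated by complex linearity. -/

/-- Curvature of the polar graph `r = R(θ)`, negative if the centre of the osculating circle lies
on the inner (droplet) side. -/
def curvature (R : ℝ → ℝ) (θ : ℝ) : ℝ :=
  -((R θ ^ 2 + 2 * deriv R θ ^ 2 - R θ * deriv (deriv R) θ) /
    (R θ ^ 2 + deriv R θ ^ 2) ^ (3 / 2 : ℝ))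

/-- Velocity, along the outward unit normal, of the moving polar graph `r = R(θ, t)`. -/
def normalVelocity (R : ℝ → ℝ → ℝ) (θ t : ℝ) : ℝ :=
  R θ t * deriv (fun s => R θ s) t /
    Real.sqrt (R θ t ^ 2 + deriv (fun φ => R φ t) θ ^ 2)

/-- First variation of the curvature of the circle of radius `R₀` for a real perturbation. -/
def curvatureVariationReal (R₀ : ℝ) (ζ : ℝ → ℝ → ℝ) (θ t : ℝ) : ℝ :=
  deriv (fun δ : ℝ => curvature (fun φ => R₀ + δ * ζ φ t) θ) 0

/-- First variation of the normal velocity about the resting circle for a real perturbation. -/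
def velocityVariationReal (R₀ : ℝ) (ζ : ℝ → ℝ → ℝ) (θ t : ℝ) : ℝ :=
  deriv (fun δ : ℝ => normalVelocity (fun φ s => R₀ + δ * ζ φ s) θ t) 0

/-- The curvature perturbation `κ₁` of a complex interface perturbation `ζ`. -/
def curvatureVariation (R₀ : ℝ) (ζ : ℝ → ℝ → ℂ) (θ t : ℝ) : ℂ :=
  (curvatureVariationReal R₀ (fun φ s => (ζ φ s).re) θ t : ℂ) +
    Complex.I * (curvatureVariationReal R₀ (fun φ s => (ζ φ s).im) θ t : ℂ)

/-- The normal-velocity perturbation `V₁` of a complex interface perturbation `ζ`. -/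
def velocityVariation (R₀ : ℝ) (ζ : ℝ → ℝ → ℂ) (θ t : ℝ) : ℂ :=
  (velocityVariationReal R₀ (fun φ s => (ζ φ s).re) θ t : ℂ) +
    Complex.I * (velocityVariationReal R₀ (fun φ s => (ζ φ s).im) θ t : ℂ)

/-- The interface perturbation
`ζ(θ, t) = R₀ (β cos (k θ) + √(1 - β²) sin (k θ)) e^{-γ t}`. -/
def modeShape (R₀ : ℝ) (k : ℕ) (β : ℝ) (γ : ℂ) (θ t : ℝ) : ℂ :=
  (R₀ : ℂ) * ((β * Real.cos (k * θ) + Real.sqrt (1 - β ^ 2) * Real.sin (k * θ) : ℝ) : ℂ) *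
    Complex.exp (-γ * (t : ℂ))

/-! ## The linearized two-phase problem -/

/-- Partial derivative in the direction of the `j`-th coordinate, within `S` (one-sided at
boundary points of a closed set `S`). -/
def partialWithin (S : Set Plane) (f : Plane → ℂ) (j : Fin 2) (x : Plane) : ℂ :=
  fderivWithin ℝ f S x (EuclideanSpace.single j 1)

/-- Velocity and pressure of one fluid, complex-valued, as functions of time and position. -/
structure Flow where
  u : ℝ → Plane → Fin 2 → ℂ
  p : ℝ → Plane → ℂ

/-- The linearized incompressible Navier--Stokes equations
`ρ ∂ₜ u - η Δ u + ∇ p = 0`, `∇ · u = 0` in `Ω` for `t > 0`, in the classical sense, with bounded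
fields that are regular up to the boundary. -/
structure Flow.SolvesBulk (f : Flow) (ρ η : ℝ) (Ω : Set Plane) : Prop where
  velocity_regular : ∀ i, ContDiffOn ℝ 2 (fun q : ℝ × Plane => f.u q.1 q.2 i)
    (Set.Ioi 0 ×ˢ closure Ω)
  pressure_regular : ContDiffOn ℝ 1 (fun q : ℝ × Plane => f.p q.1 q.2) (Set.Ioi 0 ×ˢ closure Ω)
  velocity_bounded : ∃ K : ℝ, ∀ t > 0, ∀ x ∈ Ω, ∀ i, ‖f.u t x i‖ ≤ K
  pressure_bounded : ∃ K : ℝ, ∀ t > 0, ∀ x ∈ Ω, ‖f.p t x‖ ≤ K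
  momentum : ∀ t > 0, ∀ x ∈ Ω, ∀ i,
    (ρ : ℂ) * deriv (fun s => f.u s x i) t
      - (η : ℂ) * Laplacian.laplacian (fun y => f.u t y i) x
      + partialWithin Ω (f.p t) i x = 0
  incompressible : ∀ t > 0, ∀ x ∈ Ω, ∑ i, partialWithin Ω (fun y => f.u t y i) i x = 0

/-- The vector `- η (∇u + (∇u)ᵀ) n + p n` at time `t` and position `x`, with derivatives taken from
within `S`. -/
def Flow.stress (f : Flow) (η : ℝ) (S : Set Plane) (n : Fin 2 → ℝ) (t : ℝ) (x : Plane)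
    (i : Fin 2) : ℂ :=
  -(η : ℂ) * ∑ j, (partialWithin S (fun y => f.u t y i) j x
      + partialWithin S (fun y => f.u t y j) i x) * (n j : ℂ)
    + f.p t x * (n i : ℂ)

/-- The linearization, about the resting circular droplet, of the two-phase free-boundary
Navier--Stokes problem, for the interface perturbation `ζ`. Jumps are ambient minus droplet. -/
structure SolvesLinearized (P : Params) (ζ : ℝ → ℝ → ℂ) (fD fA : Flow) : Prop where
  droplet : fD.SolvesBulk P.ρD P.ηD (dropletDomain P.R₀)
  ambient : fA.SolvesBulk P.ρA P.ηA (ambientDomain P.R₀)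
  velocity_decay : ∀ t > 0, ∀ i,
    Filter.Tendsto (fun x => fA.u t x i) (Filter.cocompact Plane) (nhds 0)
  pressure_decay : ∀ t > 0, Filter.Tendsto (fA.p t) (Filter.cocompact Plane) (nhds 0)
  kinematic_droplet : ∀ t > 0, ∀ θ : ℝ,
    ∑ i, fD.u t (interfacePoint P.R₀ θ) i * (normal θ i : ℂ) = velocityVariation P.R₀ ζ θ t
  kinematic_ambient : ∀ t > 0, ∀ θ : ℝ,
    ∑ i, fA.u t (interfacePoint P.R₀ θ) i * (normal θ i : ℂ) = velocityVariation P.R₀ ζ θ t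
  tangential : ∀ t > 0, ∀ θ : ℝ,
    ∑ i, fA.u t (interfacePoint P.R₀ θ) i * (tangent θ i : ℂ)
      - ∑ i, fD.u t (interfacePoint P.R₀ θ) i * (tangent θ i : ℂ) = 0
  dynamic : ∀ t > 0, ∀ θ : ℝ, ∀ i,
    fA.stress P.ηA (closure (ambientDomain P.R₀)) (normal θ) t (interfacePoint P.R₀ θ) i
      - fD.stress P.ηD (closure (dropletDomain P.R₀)) (normal θ) t (interfacePoint P.R₀ θ) i
      = (P.σ : ℂ) * curvatureVariation P.R₀ ζ θ t * (normal θ i : ℂ)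

/-! ## Modal fields -/

/-- The twelve coefficients of a pair of modal fields. -/
structure ModalCoeffs where
  nD : ℕ
  nA : ℕ
  mD : ℂ
  mA : ℂ
  CD : ℂ
  CA : ℂ
  DD : ℂ
  DA : ℂ
  A : ℂ
  B : ℂ
  E : ℂ
  F : ℂ

/-- The conditions for boundedness in time and for decay of the Hankel function at infinity. -/
def ModalCoeffs.Admissible (c : ModalCoeffs) : Prop :=
  0 ≤ (c.mD ^ 2).re ∧ 0 ≤ (c.mA ^ 2).re ∧ c.mA.im < 0

/-- Polar angle of a point of the plane. -/
def polarAngle (x : Plane) : ℝ := Complex.arg ⟨x 0, x 1⟩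

/-- Cartesian components of the vector field with the polar components `ur`, `uθ`, given as
functions of `r` and `θ`. -/
def ofPolar (ur uθ : ℝ → ℝ → ℂ) (x : Plane) (i : Fin 2) : ℂ :=
  ur ‖x‖ (polarAngle x) * (normal (polarAngle x) i : ℂ)
    + uθ ‖x‖ (polarAngle x) * (tangent (polarAngle x) i : ℂ)

/-- The modal velocity and pressure fields in the droplet. -/
def ModalCoeffs.dropletFlow (c : ModalCoeffs) (P : Params) : Flow where
  u t := ofPolar
    (fun r θ => Complex.exp (-((P.ηD / P.ρD : ℝ) : ℂ) * c.mD ^ 2 * (t : ℂ))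
      * (c.DD * (Real.cos (c.nD * θ) : ℂ) - c.CD * (Real.sin (c.nD * θ) : ℂ))
      * ((c.nD : ℂ) / (r : ℂ) * (c.A * besselJ c.nD (c.mD * r) + c.E * (r : ℂ) ^ c.nD)))
    (fun r θ => Complex.exp (-((P.ηD / P.ρD : ℝ) : ℂ) * c.mD ^ 2 * (t : ℂ))
      * (c.CD * (Real.cos (c.nD * θ) : ℂ) + c.DD * (Real.sin (c.nD * θ) : ℂ))
      * (-c.A * (c.mD * besselJ (c.nD - 1) (c.mD * r)
            - (c.nD : ℂ) / (r : ℂ) * besselJ c.nD (c.mD * r))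
          - c.E * (c.nD : ℂ) * (r : ℂ) ^ ((c.nD : ℤ) - 1)))
  p t x := c.E * (P.ηD : ℂ) * c.mD ^ 2
    * Complex.exp (-((P.ηD / P.ρD : ℝ) : ℂ) * c.mD ^ 2 * (t : ℂ)) * (‖x‖ : ℂ) ^ c.nD
    * (c.DD * (Real.cos (c.nD * polarAngle x) : ℂ) - c.CD * (Real.sin (c.nD * polarAngle x) : ℂ))

/-- The modal velocity and pressure fields in the ambient fluid. -/
def ModalCoeffs.ambientFlow (c : ModalCoeffs) (P : Params) : Flow where
  u t := ofPolar
    (fun r θ => Complex.exp (-((P.ηA / P.ρA : ℝ) : ℂ) * c.mA ^ 2 * (t : ℂ))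
      * (c.DA * (Real.cos (c.nA * θ) : ℂ) - c.CA * (Real.sin (c.nA * θ) : ℂ))
      * ((c.nA : ℂ) / (r : ℂ)
          * (c.B * hankel2 c.nA (c.mA * r) + c.F * (r : ℂ) ^ (-(c.nA : ℤ)))))
    (fun r θ => Complex.exp (-((P.ηA / P.ρA : ℝ) : ℂ) * c.mA ^ 2 * (t : ℂ))
      * (c.CA * (Real.cos (c.nA * θ) : ℂ) + c.DA * (Real.sin (c.nA * θ) : ℂ))
      * (-c.B * (c.mA * hankel2 (c.nA - 1) (c.mA * r)
            - (c.nA : ℂ) / (r : ℂ) * hankel2 c.nA (c.mA * r))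
          + c.F * (c.nA : ℂ) * (r : ℂ) ^ (-(c.nA : ℤ) - 1)))
  p t x := -c.F * (P.ηA : ℂ) * c.mA ^ 2
    * Complex.exp (-((P.ηA / P.ρA : ℝ) : ℂ) * c.mA ^ 2 * (t : ℂ)) * (‖x‖ : ℂ) ^ (-(c.nA : ℤ))
    * (c.DA * (Real.cos (c.nA * polarAngle x) : ℂ) - c.CA * (Real.sin (c.nA * polarAngle x) : ℂ))

/-- The modal fields with coefficients `c` satisfy the linearized problem for the interface
perturbation with mode number `k`, orientation `β` and temporal coefficient `γ`. -/
def ModalCoeffs.IsResponse (c : ModalCoeffs) (P : Params) (k : ℕ) (β : ℝ) (γ : ℂ) : Prop :=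
  SolvesLinearized P (modeShape P.R₀ k β γ) (c.dropletFlow P) (c.ambientFlow P)

/-- The coefficients after normalization of the angular factors to that of the interface
perturbation, with `v = (A, B, E, F)` still free. -/
def normalizedCoeffs (k : ℕ) (β : ℝ) (mD mA : ℂ) (v : Fin 4 → ℂ) : ModalCoeffs where
  nD := k
  nA := k
  mD := mD
  mA := mA
  CD := -(Real.sqrt (1 - β ^ 2) : ℂ)
  CA := -(Real.sqrt (1 - β ^ 2) : ℂ)
  DD := (β : ℂ)
  DA := (β : ℂ)
  A := v 0
  B := v 1
  E := v 2
  F := v 3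

/-! ## The algebraic system -/

/-- The `5 × 4` matrix of the interface conditions for the unknowns `(A, B, E, F)`; its dependence
on the temporal coefficient is through the wave numbers `mD`, `mA`. -/
def dispersionMatrix (P : Params) (k : ℕ) (mD mA : ℂ) : Matrix (Fin 5) (Fin 4) ℂ :=
  let R : ℂ := P.R₀
  let ηD : ℂ := P.ηD
  let ηA : ℂ := P.ηA
  let K : ℂ := k
  let J : ℂ := besselJ k (mD * R)
  let J' : ℂ := besselJ (k - 1) (mD * R)
  let H : ℂ := hankel2 k (mA * R)
  let H' : ℂ := hankel2 (k - 1) (mA * R)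
  !![K * R⁻¹ * J, 0, K * R ^ ((k : ℤ) - 1), 0;
    0, K * R⁻¹ * H, 0, K * R ^ (-(k : ℤ) - 1);
    -(mD * J' - K * R⁻¹ * J), mA * H' - K * R⁻¹ * H,
      -(K * R ^ ((k : ℤ) - 1)), -(K * R ^ (-(k : ℤ) - 1));
    -ηD * (2 * mD * K * R⁻¹ * J' - 2 * (K + 1) * K * R ^ (-2 : ℤ) * J),
      ηA * (2 * mA * K * R⁻¹ * H' - 2 * (K + 1) * K * R ^ (-2 : ℤ) * H),
      ηD * (mD ^ 2 * R ^ k - 2 * (K - 1) * K * R ^ ((k : ℤ) - 2)),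
      ηA * (mA ^ 2 * R ^ (-(k : ℤ)) - 2 * (K + 1) * K * R ^ (-(k : ℤ) - 2));
    -ηD * (2 * mD * R⁻¹ * J' + (mD ^ 2 - 2 * (K + 1) * K * R ^ (-2 : ℤ)) * J),
      ηA * (2 * mA * R⁻¹ * H' + (mA ^ 2 - 2 * (K + 1) * K * R ^ (-2 : ℤ)) * H),
      2 * ηD * (K - 1) * K * R ^ ((k : ℤ) - 2),
      -(2 * ηA * (K + 1) * K * R ^ (-(k : ℤ) - 2))]

/-- The right-hand side of the system. -/
def dispersionRhs (P : Params) (k : ℕ) (γ : ℂ) : Fin 5 → ℂ :=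
  ![-γ * (P.R₀ : ℂ), -γ * (P.R₀ : ℂ), 0, (P.σ : ℂ) * (P.R₀ : ℂ)⁻¹ * ((k : ℂ) ^ 2 - 1), 0]

/-- The augmented `5 × 5` matrix `(A | b)`. -/
def augmentedMatrix (P : Params) (k : ℕ) (γ mD mA : ℂ) : Matrix (Fin 5) (Fin 5) ℂ :=
  Matrix.of fun i j =>
    Fin.snoc (α := fun _ => ℂ) (dispersionMatrix P k mD mA i) (dispersionRhs P k γ i) j

/-- The dimensionless augmented matrix, as a function of the mode number, the dimensionless
temporal coefficient, the two dimensionless wave numbers, the viscosity ratio and the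
dimensionless surface tension. -/
def scaledAugmentedMatrix (k : ℕ) (γ mD mA η σ : ℂ) : Matrix (Fin 5) (Fin 5) ℂ :=
  let K : ℂ := k
  let J : ℂ := besselJ k mD
  let J' : ℂ := mD * besselJ (k - 1) mD
  let H : ℂ := hankel2 k mA
  let H' : ℂ := mA * hankel2 (k - 1) mA
  let z : ℂ := 2 * (K - 1) * K
  let ξ : ℂ := 2 * (K + 1) * K
  !![K * J, 0, K, 0, -γ;
    0, K * H, 0, K, -γ;
    -J' + K * J, H' - K * H, -K, -K, 0;
    -2 * K * J' + ξ * J, η * (2 * K * H' - ξ * H), mD ^ 2 - z, η * (mA ^ 2 - ξ),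
      σ * (K ^ 2 - 1);
    -2 * J' - (mD ^ 2 - ξ) * J, η * (2 * H' + (mA ^ 2 - ξ) * H), z, -η * ξ, 0]

/-- The dimensionless augmented matrix for given physical data; the units are built from the
density, viscosity and radius of the droplet. -/
def dimensionlessMatrix (P : Params) (k : ℕ) (γ mD mA : ℂ) : Matrix (Fin 5) (Fin 5) ℂ :=
  scaledAugmentedMatrix k (γ * ((P.ρD * P.R₀ ^ 2 / P.ηD : ℝ) : ℂ)) (mD * (P.R₀ : ℂ))
    (mA * (P.R₀ : ℂ)) ((P.ηA / P.ηD : ℝ) : ℂ) ((P.σ * P.ρD * P.R₀ / P.ηD ^ 2 : ℝ) : ℂ)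

/-- The dimensionless coefficients `(A, B, E, F)`, followed by the entry `-1`. -/
def dimensionlessVector (P : Params) (k : ℕ) (v : Fin 4 → ℂ) : Fin 5 → ℂ :=
  let s : ℂ := ((P.ρD / P.ηD : ℝ) : ℂ)
  ![s * v 0, s * v 1, s * (P.R₀ : ℂ) ^ k * v 2, s * (P.R₀ : ℂ) ^ (-(k : ℤ)) * v 3, -1]

end Droplet

end

/-! ### Bessel functions of integer order -/

noncomputable section
namespace Droplet
open Filter Topology

/-! Each modal velocity is the rotated gradient of a stream function ψ, the sum of cylinder waves
Z_{±n}(mr)e^{±inθ} and of the harmonic functions z^l and z̄^l, with l = n in the droplet and l = -n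
outside. The waves e_n obey ∂e_n = (m/2)e_{n-1} and ∂̄e_n = -(m/2)e_{n+1} (`IsWaveFamily`), so
differentiation is a shift of the index and Δ = 4∂∂̄ multiplies a wave by -m². If ργ = ηm², the time
derivative therefore balances the viscous term on the wave part, and on the harmonic part it
balances the gradient of the pressure, which is ηm² times a harmonic conjugate
(`Describes.solvesBulk`). Rotating by powers of e^{iθ} gives the interface velocity and stress the
form e^{-γt} · (angular profile) · (radial factor). The interface conditions are then five scalar
equations, the rows of the system (`normalizedCoeffs_isResponse_iff`).

Conversely, let modal fields solve the problem. If γ ≠ 0, the two kinematic conditions alone fix the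
decay rate, the mode number and the ratio of the angular coefficients (`exp_rate_unique`,
`angular_match`). The case γ = 0 is impossible (`IsResponse.rate_ne_zero`): the capillary pressure
would be steady and nonzero, the ambient stress has a nonzero rate because Im m_A < 0, and a steady
droplet field with no flow through the interface exerts no normal stress.

The analytic core is that the 5 × 4 matrix has independent columns (`dispersionMatrix_injective`).
Split the radial profile as Y = P + Q with power part P and cylinder part Q, and put Φ = ργ(rP'Ȳ + Q
· conj(rY')). As ργ = ηm², the derivative of Im Φ is Im γ · ρ(n²|Y|² + |rY'|²)/r, and Im γ ≠ 0
because Re γ ≥ 0 and Im m_A < 0. Thus Im γ · Im Φ increases with r. It tends to 0 at the centre and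
at infinity, so at the interface it is nonnegative from inside and nonpositive from outside. For a
kernel vector the normal velocities vanish, and continuity of tangential velocity and tangential
stress makes Im Φ continuous across the interface. Hence Im Φ is 0 on both sides, Y = 0, and P and Q
vanish separately. Neither Bessel nor Hankel functions vanish identically on the intervals in
question, so all four coefficients are 0.

Given injectivity, a nonzero kernel vector of (A|b) has a nonzero last entry, so the determinant
vanishes exactly when the system is solvable, and then the solution is unique. The dimensionless
matrix arises from (A|b) by invertible diagonal scalings of rows and columns. -/

/-- The entire function `∑ (-1)^j z^j / (j! (j+n)!)`, so that `J_n(z) = (z/2)^n besselG n (z²/4)`. -/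
def besselG (n : ℕ) (z : ℂ) : ℂ :=
  ∑' j : ℕ, (-1 : ℂ) ^ j / ((j.factorial : ℂ) * ((j + n).factorial : ℂ)) * z ^ j

theorem norm_besselG_coeff_le (n j : ℕ) :
    ‖(-1 : ℂ) ^ j / ((j.factorial : ℂ) * ((j + n).factorial : ℂ))‖ ≤ 1 / (j.factorial : ℝ) := by
  rw [norm_div, norm_mul, norm_pow, norm_neg, norm_one, one_pow, Complex.norm_natCast,
    Complex.norm_natCast]
  have h1 : (0 : ℝ) < j.factorial := by exact_mod_cast j.factorial_pos
  have h2 : (1 : ℝ) ≤ (j + n).factorial := by exact_mod_cast (j + n).factorial_pos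
  gcongr
  nlinarith

theorem summable_besselG (n : ℕ) (z : ℂ) :
    Summable fun j : ℕ =>
      (-1 : ℂ) ^ j / ((j.factorial : ℂ) * ((j + n).factorial : ℂ)) * z ^ j := by
  refine Summable.of_norm_bounded (Real.summable_pow_div_factorial ‖z‖) fun j => ?_
  rw [norm_mul, norm_pow]
  calc _ ≤ 1 / (j.factorial : ℝ) * ‖z‖ ^ j := by gcongr; exact norm_besselG_coeff_le n j
    _ = _ := by ring

/-- Termwise differentiation: a factor j cancels into the factorial, and the index shift raises the
order by one and changes the sign. -/
theorem hasDerivAt_besselG (n : ℕ) (z : ℂ) :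
    HasDerivAt (besselG n) (-besselG (n + 1) z) z := by
  set c : ℕ → ℂ := fun j => (-1 : ℂ) ^ j / ((j.factorial : ℂ) * ((j + n).factorial : ℂ)) with hc
  -- Any radius above ‖z‖ would do: the ball contains z and 0, and M gives one summable majorant for
  -- all its points.
  set M : ℝ := ‖z‖ + 1
  have hu : Summable fun j : ℕ => (j : ℝ) * M ^ (j - 1) / (j.factorial : ℝ) := by
    rw [← summable_nat_add_iff 1]
    refine (Real.summable_pow_div_factorial M).congr fun j => ?_
    have : (j.factorial : ℝ) ≠ 0 := by exact_mod_cast j.factorial_ne_zero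
    rw [Nat.factorial_succ, add_tsub_cancel_right]; push_cast; field_simp
  have key := hasDerivAt_tsum_of_isPreconnected (t := Metric.ball (0 : ℂ) M)
    (g := fun j w => c j * w ^ j) (g' := fun j w => c j * (j * w ^ (j - 1))) hu
    Metric.isOpen_ball (convex_ball _ _).isPreconnected
    (fun j y _ => (hasDerivAt_pow j y).const_mul (c j))
    (fun j y hy => by
      have hy' : ‖y‖ ≤ M := by simpa using (Metric.mem_ball.1 hy).le
      rw [norm_mul, norm_mul, norm_pow, Complex.norm_natCast]
      calc _ ≤ 1 / (j.factorial : ℝ) * (j * M ^ (j - 1)) := by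
            gcongr; exact norm_besselG_coeff_le n j
        _ = _ := by ring)
    (y₀ := z) (by simp [M]) (summable_besselG n z) (y := z) (by simp [M])
  convert! key using 1
  -- The term j = 0 vanishes through its factor j, so the truncated exponent j - 1 is harmless
  -- there.
  rw [Summable.tsum_eq_zero_add]
  · simp only [CharP.cast_eq_zero, zero_mul, mul_zero, zero_add, besselG, ← tsum_neg]
    refine tsum_congr fun j => ?_
    have h1 : (j.factorial : ℂ) ≠ 0 := by exact_mod_cast j.factorial_ne_zero
    have h2 : ((j + 1 + n).factorial : ℂ) ≠ 0 := by exact_mod_cast (j + 1 + n).factorial_ne_zero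
    have h3 : ((j : ℂ) + 1) ≠ 0 := by exact_mod_cast j.succ_ne_zero
    simp only [hc]
    rw [show j + (n + 1) = j + 1 + n by ring, Nat.factorial_succ]
    rw [add_tsub_cancel_right]
    push_cast
    field_simp
    ring
  · refine Summable.of_norm_bounded hu fun j => ?_
    rw [norm_mul, norm_mul, norm_pow, Complex.norm_natCast]
    calc _ ≤ 1 / (j.factorial : ℝ) * (j * M ^ (j - 1)) := by
            gcongr
            · exact norm_besselG_coeff_le n j
            · simp [M]
        _ = _ := by ring

/-- Coefficient comparison. This is the three-term recurrence of the Bessel functions stripped of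
powers of the argument, so that it also holds at the origin. -/
theorem besselG_recurrence (n : ℕ) (z : ℂ) :
    besselG n z + z * besselG (n + 2) z = (n + 1) * besselG (n + 1) z := by
  have h1 := (summable_besselG n z)
  have h2 := (summable_besselG (n + 1) z)
  have h3 := (summable_besselG (n + 2) z).mul_left z
  unfold besselG
  rw [h1.tsum_eq_zero_add, ← tsum_mul_left, ← tsum_mul_left, add_assoc,
    ← ((summable_nat_add_iff 1).2 h1).tsum_add h3, (h2.mul_left _).tsum_eq_zero_add]
  congr 1
  · have : (n.factorial : ℂ) ≠ 0 := by exact_mod_cast n.factorial_ne_zero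
    simp [Nat.factorial_succ]
    field_simp
  · refine tsum_congr fun j => ?_
    have h1 : (j.factorial : ℂ) ≠ 0 := by exact_mod_cast j.factorial_ne_zero
    have h2 : ((j + n).factorial : ℂ) ≠ 0 := by exact_mod_cast (j + n).factorial_ne_zero
    have h3 : ((j : ℂ) + 1) ≠ 0 := by exact_mod_cast j.succ_ne_zero
    have h4 : ((j : ℂ) + n + 1) ≠ 0 := by exact_mod_cast (j + n).succ_ne_zero
    have h5 : ((j : ℂ) + n + 1 + 1) ≠ 0 := by exact_mod_cast (j + n + 1).succ_ne_zero
    rw [show j + 1 + n = (j + n) + 1 by ring, show j + (n + 2) = (j + n) + 1 + 1 by ring,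
      show j + 1 + (n + 1) = (j + n) + 1 + 1 by ring, Nat.factorial_succ (j + n + 1),
      Nat.factorial_succ (j + n), Nat.factorial_succ j]
    push_cast
    field_simp
    ring

theorem besselG_zero_ne_zero (n : ℕ) : besselG n 0 ≠ 0 := by
  have : (n.factorial : ℂ) ≠ 0 := by exact_mod_cast n.factorial_ne_zero
  rw [besselG, tsum_eq_single 0 (fun j hj => by simp [hj])]
  simpa using this

theorem continuous_besselG (n : ℕ) : Continuous (besselG n) :=
  continuous_iff_continuousAt.2 fun z => (hasDerivAt_besselG n z).continuousAt

theorem besselJ_natCast (n : ℕ) (z : ℂ) :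
    besselJ n z = (z / 2) ^ n * besselG n ((z / 2) ^ 2) := by
  change besselJNat n z = _
  unfold besselJNat besselG
  rw [← tsum_mul_left]
  refine tsum_congr fun j => ?_
  rw [pow_add, pow_mul]; ring

theorem besselJ_neg_natCast (n : ℕ) (z : ℂ) : besselJ (-n) z = (-1) ^ n * besselJ n z := by
  cases n with
  | zero => simp
  | succ n => rfl

theorem besselJ_neg (n : ℤ) (z : ℂ) : besselJ (-n) z = (-1) ^ n * besselJ n z := by
  obtain ⟨n, rfl | rfl⟩ := n.eq_nat_or_neg
  · simpa using besselJ_neg_natCast n z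
  · rw [neg_neg, besselJ_neg_natCast, zpow_neg, zpow_natCast, ← mul_assoc,
      inv_mul_cancel₀ (by simp), one_mul]

/-- The equation for m_D fixes it only up to sign; this parity shows that the sign is immaterial. -/
theorem besselJ_neg_arg (n : ℤ) (z : ℂ) : besselJ n (-z) = (-1) ^ n * besselJ n z := by
  obtain ⟨n, rfl | rfl⟩ := n.eq_nat_or_neg
  · rw [besselJ_natCast, besselJ_natCast, neg_div, neg_sq, neg_pow, zpow_natCast]; ring
  · rw [besselJ_neg_natCast, besselJ_neg_natCast, besselJ_natCast, besselJ_natCast, neg_div,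
      neg_sq, neg_pow (z / 2), zpow_neg, zpow_natCast, ← inv_pow]
    norm_num
    ring

theorem besselJ_zero_arg {n : ℤ} (hn : n ≠ 0) : besselJ n 0 = 0 := by
  obtain ⟨n, rfl | rfl⟩ := n.eq_nat_or_neg
  · rw [besselJ_natCast]; simp_all
  · rw [besselJ_neg_natCast, besselJ_natCast]; simp_all

theorem besselJ_recurrence_nat (n : ℕ) (z : ℂ) :
    z * (besselJ n z + besselJ (n + 2 : ℕ) z) = 2 * (n + 1) * besselJ (n + 1 : ℕ) z := by
  rw [besselJ_natCast, besselJ_natCast, besselJ_natCast]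
  have := besselG_recurrence n ((z / 2) ^ 2)
  linear_combination 2 * (z / 2) ^ (n + 1) * this

theorem besselJ_recurrence (n : ℤ) (z : ℂ) :
    z * (besselJ (n - 1) z + besselJ (n + 1) z) = 2 * n * besselJ n z := by
  have pos : ∀ n : ℕ, z * (besselJ ((n + 1 : ℕ) - 1 : ℤ) z + besselJ ((n + 1 : ℕ) + 1 : ℤ) z) =
      2 * (n + 1 : ℕ) * besselJ (n + 1 : ℕ) z := fun n => by
    have := besselJ_recurrence_nat n z
    convert! this using 3 <;> push_cast <;> ring_nf
  rcases lt_trichotomy n 0 with h | rfl | h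
  · obtain ⟨j, rfl⟩ : ∃ j : ℕ, n = -((j + 1 : ℕ) : ℤ) := ⟨(-n - 1).toNat, by omega⟩
    rw [show (-((j + 1 : ℕ) : ℤ) - 1) = -(((j + 1 : ℕ) : ℤ) + 1) by ring,
      show (-((j + 1 : ℕ) : ℤ) + 1) = -(((j + 1 : ℕ) : ℤ) - 1) by ring, besselJ_neg, besselJ_neg,
      besselJ_neg, zpow_sub₀ (by norm_num), zpow_add₀ (by norm_num)]
    have := pos j
    simp only [zpow_one, Int.cast_neg, Int.cast_natCast]
    linear_combination (-(-1) ^ ((j + 1 : ℕ) : ℤ)) * this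
  · have : besselJ (0 - 1) z = - besselJ (0 + 1) z := by
      simpa using besselJ_neg 1 z
    rw [this]; simp
  · obtain ⟨j, rfl⟩ : ∃ j : ℕ, n = ((j + 1 : ℕ) : ℤ) := ⟨(n - 1).toNat, by omega⟩
    exact pos j

/-- The half-difference form has no division by z, so it is valid at 0 and for every integer order.
Negative orders follow by reflection. -/
theorem hasDerivAt_besselJ (n : ℤ) (z : ℂ) :
    HasDerivAt (besselJ n) ((besselJ (n - 1) z - besselJ (n + 1) z) / 2) z := by
  have pos : ∀ n : ℕ, HasDerivAt (besselJ n) ((besselJ (n - 1) z - besselJ (n + 1) z) / 2) z := by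
    intro n
    have hsq : HasDerivAt (fun z : ℂ => (z / 2) ^ 2) (z / 2) z := by
      convert! ((hasDerivAt_id z).div_const 2).pow 2 using 1
      simp; ring
    have h := (((hasDerivAt_id z).div_const 2).pow n).mul
      ((hasDerivAt_besselG n _).comp z hsq)
    have hfun : besselJ n = (fun z => (z / 2) ^ n) * (besselG n ∘ fun z => (z / 2) ^ 2) := by
      ext z; simp [besselJ_natCast]
    rw [hfun]
    convert! h using 1
    cases n with
    | zero =>
      have h1 : besselJ ((0 : ℕ) - 1 : ℤ) z = - besselJ ((0 : ℕ) + 1 : ℤ) z := by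
        simpa using besselJ_neg 1 z
      have h2 := besselJ_natCast 1 z
      rw [h1]
      simp at h2 ⊢
      rw [h2]; ring
    | succ n =>
      have h1 := besselJ_natCast n z
      have h2 := besselJ_natCast (n + 2) z
      rw [show (((n + 1 : ℕ) : ℤ) - 1) = (n : ℤ) by push_cast; ring,
        show (((n + 1 : ℕ) : ℤ) + 1) = ((n + 2 : ℕ) : ℤ) by push_cast; ring, h1, h2]
      have := besselG_recurrence n ((z / 2) ^ 2)
      simp
      linear_combination (1 / 2 : ℂ) * (z / 2) ^ n * this
  obtain ⟨n, rfl | rfl⟩ := n.eq_nat_or_neg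
  · exact pos n
  · have hfun : besselJ (-n) = fun z => (-1) ^ n * besselJ n z := by
      ext z; exact besselJ_neg_natCast n z
    rw [hfun]
    convert! (pos n).const_mul ((-1) ^ n) using 1
    rw [show (-(n : ℤ) - 1) = -((n : ℤ) + 1) by ring, show (-(n : ℤ) + 1) = -((n : ℤ) - 1) by ring,
      besselJ_neg, besselJ_neg, zpow_sub₀ (by norm_num), zpow_add₀ (by norm_num)]
    simp
    ring

end Droplet
end

/-! ### Hankel functions on the lower half-plane -/

noncomputable section
namespace Droplet
open Filter Topology MeasureTheory

/-- The integrand of the Hankel function without its prefactor. -/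
def hankelKernel (n : ℤ) (z : ℂ) (t : ℝ) : ℂ :=
  Complex.exp (-Complex.I * z * (Real.cosh t : ℂ) - (n : ℂ) * (t : ℂ))

theorem norm_hankelKernel (n : ℤ) (z : ℂ) (t : ℝ) :
    ‖hankelKernel n z t‖ = Real.exp (z.im * Real.cosh t - n * t) := by
  rw [hankelKernel, Complex.norm_exp]
  congr 1
  simp [← Complex.ofReal_intCast]

/-- From cosh t = 1 + 2 sinh²(t/2) and |sinh s| ≥ |s|. It provides Gaussian majorants for the Hankel
integrands. -/
theorem one_add_sq_div_two_le_cosh (t : ℝ) : 1 + t ^ 2 / 2 ≤ Real.cosh t := by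
  have h := Real.cosh_sq (t / 2)
  have h2 := Real.cosh_two_mul (t / 2)
  have h3 : (t / 2) ^ 2 ≤ Real.sinh (t / 2) ^ 2 := by
    rw [sq_le_sq]
    rcases le_total 0 (t / 2) with h0 | h0
    · rw [abs_of_nonneg h0, abs_of_nonneg (Real.sinh_nonneg_iff.2 h0)]
      exact Real.self_le_sinh_iff.2 h0
    · rw [abs_of_nonpos h0, abs_of_nonpos (Real.sinh_nonpos_iff.2 h0)]
      exact neg_le_neg (Real.sinh_le_self_iff.2 h0)
  rw [show 2 * (t / 2) = t by ring] at h2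
  nlinarith

theorem continuous_hankelKernel (n : ℤ) (z : ℂ) : Continuous (hankelKernel n z) := by
  unfold hankelKernel
  have : Continuous fun t : ℝ => (Real.cosh t : ℂ) :=
    Complex.continuous_ofReal.comp Real.continuous_cosh
  fun_prop

theorem integrable_exp_neg_cosh (b c : ℝ) (hb : 0 < b) :
    Integrable fun t : ℝ => Real.exp (-b * Real.cosh t - c * t) := by
  have h := (integrable_cexp_quadratic (b := ((b / 2 : ℝ) : ℂ)) (by simpa using by positivity)
    (-(c : ℂ)) 0).norm
  refine h.mono' ?_ (Eventually.of_forall fun t => ?_)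
  · have := Real.continuous_cosh
    exact Continuous.aestronglyMeasurable (by fun_prop)
  · rw [Real.norm_of_nonneg (Real.exp_nonneg _), Complex.norm_exp]
    refine Real.exp_le_exp.2 ?_
    have := one_add_sq_div_two_le_cosh t
    have e : (-((b / 2 : ℝ) : ℂ) * (t : ℂ) ^ 2 + -(c : ℂ) * t + 0).re = -(b / 2) * t ^ 2 - c * t := by
      rw [show -((b / 2 : ℝ) : ℂ) * (t : ℂ) ^ 2 + -(c : ℂ) * t + 0 =
        ((-(b / 2) * t ^ 2 - c * t : ℝ) : ℂ) by push_cast; ring, Complex.ofReal_re]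
    rw [e]
    nlinarith

theorem integrable_hankelKernel (n : ℤ) {z : ℂ} (hz : z.im < 0) :
    Integrable (hankelKernel n z) := by
  refine (integrable_exp_neg_cosh (-z.im) n (by linarith)).mono'
    (continuous_hankelKernel n z).aestronglyMeasurable (Eventually.of_forall fun t => ?_)
  rw [norm_hankelKernel, neg_neg]

/-- A factor e^{±t} shifts the order by one, so differentiation under the integral leads to the
neighbouring orders. -/
theorem cosh_mul_hankelKernel (n : ℤ) (z : ℂ) (t : ℝ) :
    (Real.cosh t : ℂ) * hankelKernel n z t =
      (hankelKernel (n - 1) z t + hankelKernel (n + 1) z t) / 2 := by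
  simp only [hankelKernel, Complex.ofReal_cosh, Complex.cosh]
  rw [add_div, add_div, add_mul]
  congr 1
  all_goals
    rw [div_mul_eq_mul_div, ← Complex.exp_add]
    push_cast
    congr 2
    ring

theorem sinh_mul_hankelKernel (n : ℤ) (z : ℂ) (t : ℝ) :
    (Real.sinh t : ℂ) * hankelKernel n z t =
      (hankelKernel (n - 1) z t - hankelKernel (n + 1) z t) / 2 := by
  simp only [hankelKernel, Complex.ofReal_cosh, Complex.ofReal_sinh, Complex.sinh]
  rw [sub_div, sub_div, sub_mul]
  congr 1
  all_goals
    rw [div_mul_eq_mul_div, ← Complex.exp_add]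
    push_cast
    congr 2
    ring

theorem hasDerivAt_integral_hankelKernel (n : ℤ) {z : ℂ} (hz : z.im < 0) :
    HasDerivAt (fun z => ∫ t, hankelKernel n z t)
      (∫ t, -Complex.I * ((Real.cosh t : ℂ) * hankelKernel n z t)) z := by
  -- Half the distance from z to the real axis: on the ball of this radius Im w < -b, and one
  -- majorant serves all w.
  set b : ℝ := -z.im / 2 with hb
  have hb0 : 0 < b := by rw [hb]; linarith
  have him : ∀ w ∈ Metric.ball z b, w.im < -b := fun w hw => by
    have h1 : |(w - z).im| < b :=
      (Complex.abs_im_le_norm _).trans_lt (by simpa [dist_eq_norm] using hw)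
    have := (abs_lt.1 h1).2
    simp at this; linarith
  refine (hasDerivAt_integral_of_dominated_loc_of_deriv_le (Metric.ball_mem_nhds z hb0)
    (F' := fun w t => -Complex.I * ((Real.cosh t : ℂ) * hankelKernel n w t))
    (bound := fun t => (Real.exp (-b * Real.cosh t - ((n - 1 : ℤ) : ℝ) * t)
      + Real.exp (-b * Real.cosh t - ((n + 1 : ℤ) : ℝ) * t)) / 2)
    (Eventually.of_forall fun w => (continuous_hankelKernel n w).aestronglyMeasurable)
    (integrable_hankelKernel n hz) ?_ ?_ ?_ ?_).2
  · have h1 : Continuous fun t : ℝ => (Real.cosh t : ℂ) :=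
      Complex.continuous_ofReal.comp Real.continuous_cosh
    have := continuous_hankelKernel n z
    exact Continuous.aestronglyMeasurable (by fun_prop)
  · refine Eventually.of_forall fun t w hw => ?_
    rw [cosh_mul_hankelKernel, norm_mul, norm_neg, Complex.norm_I, one_mul, norm_div,
      Complex.norm_ofNat]
    have h0 := Real.one_le_cosh t
    have h1 := him w hw
    refine div_le_div_of_nonneg_right ((norm_add_le _ _).trans ?_) (by norm_num)
    rw [norm_hankelKernel, norm_hankelKernel]
    gcongr
  · exact ((integrable_exp_neg_cosh b _ hb0).add (integrable_exp_neg_cosh b _ hb0)).div_const 2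
  · refine Eventually.of_forall fun t w _ => ?_
    have h : HasDerivAt (fun w : ℂ => -Complex.I * w * (Real.cosh t : ℂ) - (n : ℂ) * (t : ℂ))
        (-Complex.I * (Real.cosh t : ℂ)) w := by
      simpa using (((hasDerivAt_id w).const_mul (-Complex.I)).mul_const
        (Real.cosh t : ℂ)).sub_const ((n : ℂ) * (t : ℂ))
    convert! h.cexp using 1
    simp only [hankelKernel]; ring

/-- The prefactor of the Hankel integral. -/
def hankelFactor (n : ℤ) : ℂ :=
  -(Complex.exp ((n : ℂ) * (Real.pi : ℂ) * Complex.I / 2) / ((Real.pi : ℂ) * Complex.I))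

theorem hankel2_eq (n : ℤ) (z : ℂ) : hankel2 n z = hankelFactor n * ∫ t, hankelKernel n z t := rfl

theorem hankelFactor_eq (n : ℤ) : hankelFactor n = Complex.I ^ n * hankelFactor 0 := by
  have : Complex.exp ((n : ℂ) * (Real.pi : ℂ) * Complex.I / 2) = Complex.I ^ n := by
    conv_rhs => rw [← Complex.exp_pi_div_two_mul_I, ← Complex.exp_int_mul]
    congr 1; ring
  simp only [hankelFactor, this, Int.cast_zero, zero_mul, zero_div, Complex.exp_zero]
  ring

theorem hankelFactor_ne_zero (n : ℤ) : hankelFactor n ≠ 0 := by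
  simp [hankelFactor, Real.pi_ne_zero]

theorem hasDerivAt_hankel2 (n : ℤ) {z : ℂ} (hz : z.im < 0) :
    HasDerivAt (hankel2 n) ((hankel2 (n - 1) z - hankel2 (n + 1) z) / 2) z := by
  have h := (hasDerivAt_integral_hankelKernel n hz).const_mul (hankelFactor n)
  convert! h using 1
  simp_rw [cosh_mul_hankelKernel]
  rw [integral_const_mul, integral_div, integral_add (integrable_hankelKernel _ hz)
    (integrable_hankelKernel _ hz), hankel2_eq, hankel2_eq, hankelFactor_eq (n - 1),
    hankelFactor_eq (n + 1), hankelFactor_eq n, zpow_sub₀ Complex.I_ne_zero,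
    zpow_add₀ Complex.I_ne_zero]
  simp
  ring

/-- The integral over the line of the t-derivative of the kernel is 0; that derivative brings down
-iz sinh t - n, and sinh t splits into the two neighbouring orders. -/
theorem hankel2_recurrence (n : ℤ) {z : ℂ} (hz : z.im < 0) :
    z * (hankel2 (n - 1) z + hankel2 (n + 1) z) = 2 * n * hankel2 n z := by
  have hi := fun n => integrable_hankelKernel n hz
  have hd : ∀ t : ℝ, HasDerivAt (hankelKernel n z)
      (-Complex.I * z * ((hankelKernel (n - 1) z t - hankelKernel (n + 1) z t) / 2)
        - n * hankelKernel n z t) t := fun t => by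
    have h : HasDerivAt (fun t : ℝ => -Complex.I * z * (Real.cosh t : ℂ) - (n : ℂ) * (t : ℂ))
        (-Complex.I * z * (Real.sinh t : ℂ) - n * 1) t :=
      ((Real.hasDerivAt_cosh t).ofReal_comp.const_mul _).sub
        ((hasDerivAt_id t).ofReal_comp.const_mul (n : ℂ))
    convert! h.cexp using 1
    rw [← sinh_mul_hankelKernel]
    simp only [hankelKernel]; ring
  have h0 := integral_eq_zero_of_hasDerivAt_of_integrable hd
    (((((hi _).sub (hi _)).div_const 2).const_mul _).sub ((hi n).const_mul _)) (hi n)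
  have hi' : Integrable fun t =>
      -Complex.I * z * ((hankelKernel (n - 1) z t - hankelKernel (n + 1) z t) / 2) :=
    (((hi _).sub (hi _)).div_const 2).const_mul _
  rw [integral_sub hi' ((hi n).const_mul _),
    integral_const_mul, integral_const_mul, integral_div, integral_sub (hi _) (hi _)] at h0
  rw [hankel2_eq, hankel2_eq, hankel2_eq, hankelFactor_eq (n - 1),
    hankelFactor_eq (n + 1), hankelFactor_eq n, zpow_sub₀ Complex.I_ne_zero,
    zpow_add₀ Complex.I_ne_zero]
  simp
  linear_combination 2 * Complex.I ^ n * hankelFactor 0 * h0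

/-- The substitution t ↦ -t leaves the integral unchanged; the sign comes from the prefactor, since
i^{-n} = (-1)^n i^n. -/
theorem hankel2_neg (n : ℤ) (z : ℂ) : hankel2 (-n) z = (-1) ^ n * hankel2 n z := by
  have h : ∫ t, hankelKernel (-n) z t = ∫ t, hankelKernel n z t := by
    rw [← integral_neg_eq_self]
    congr 1; ext t
    simp [hankelKernel]
  rw [hankel2_eq, hankel2_eq, h, hankelFactor_eq, hankelFactor_eq n]
  have : Complex.I ^ (-n) = (-1) ^ n * Complex.I ^ n := by
    rw [← mul_zpow, zpow_neg, ← inv_zpow, Complex.inv_I]; simp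
  rw [this]; ring

/-- Exponential decay of the Hankel function along rays in the lower half-plane. -/
theorem exists_norm_hankel2_le (n : ℤ) {m : ℂ} (hm : m.im < 0) {r₀ : ℝ} (hr₀ : 0 < r₀) :
    ∃ C : ℝ, 0 ≤ C ∧ ∀ r : ℝ, r₀ ≤ r → ‖hankel2 n (m * r)‖ ≤ C * Real.exp (m.im * r) := by
  -- For r ≥ r₀ one has (r - r₀)(cosh t - 1) ≥ 0, hence Im m · r cosh t ≤ Im m · r + Im m · r₀(cosh
  -- t - 1): the decay in r splits off, and what remains is integrable independently of r.
  have hint := integrable_exp_neg_cosh (-(m.im * r₀)) n (by nlinarith)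
  refine ⟨‖hankelFactor n‖ * Real.exp (-(m.im * r₀)) *
    ∫ t, Real.exp (-(-(m.im * r₀)) * Real.cosh t - n * t), by positivity, fun r hr => ?_⟩
  rw [hankel2_eq, norm_mul, mul_assoc, mul_assoc]
  refine mul_le_mul_of_nonneg_left ?_ (norm_nonneg _)
  rw [mul_comm (∫ t, _), ← mul_assoc, ← integral_const_mul]
  refine norm_integral_le_of_norm_le (hint.const_mul _) (Eventually.of_forall fun t => ?_)
  rw [norm_hankelKernel, ← Real.exp_add, ← Real.exp_add]
  refine Real.exp_le_exp.2 ?_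
  have h1 : (m * (r : ℂ)).im = m.im * r := by simp
  have h2 := Real.one_le_cosh t
  rw [h1]
  nlinarith [mul_nonneg (mul_nonneg (neg_nonneg.2 hm.le) (sub_nonneg.2 hr)) (sub_nonneg.2 h2)]

/-- On the negative imaginary axis the integrand is real and positive. -/
theorem hankel2_neg_I_mul_ne_zero (n : ℤ) {y : ℝ} (hy : 0 < y) :
    hankel2 n (-Complex.I * y) ≠ 0 := by
  rw [hankel2_eq]
  refine mul_ne_zero (hankelFactor_ne_zero n) ?_
  have h : ∀ t, hankelKernel n (-Complex.I * y) t = (Real.exp (-y * Real.cosh t - n * t) : ℝ) := by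
    intro t
    rw [hankelKernel, Complex.ofReal_exp]
    congr 1
    push_cast
    linear_combination (y * Complex.cosh t) * Complex.I_mul_I
  simp_rw [h]
  rw [integral_complex_ofReal, Complex.ofReal_ne_zero]
  exact (integral_exp_pos (integrable_exp_neg_cosh y n hy)).ne'

/-- The Hankel function does not vanish identically on any tail of a ray. -/
theorem exists_hankel2_ne_zero (n : ℤ) {m : ℂ} (hm : m.im < 0) {r₀ : ℝ} (hr₀ : 0 < r₀) :
    ∃ r : ℝ, r₀ < r ∧ hankel2 n (m * r) ≠ 0 := by
  by_contra! hzero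
  have hopen : IsOpen {z : ℂ | z.im < 0} := isOpen_lt Complex.continuous_im continuous_const
  -- Identity theorem: zeros on the tail of the ray accumulate at the interior point m(r₀ + 1), so
  -- the function would vanish on the whole half-plane, in particular at -i.
  have han : AnalyticOnNhd ℂ (hankel2 n) {z : ℂ | z.im < 0} :=
    DifferentiableOn.analyticOnNhd
      (fun z hz => (hasDerivAt_hankel2 n hz).differentiableAt.differentiableWithinAt) hopen
  have hconn : IsPreconnected {z : ℂ | z.im < 0} := (convex_halfSpace_im_lt 0).isPreconnected
  have hmem : m * ((r₀ + 1 : ℝ) : ℂ) ∈ {z : ℂ | z.im < 0} := by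
    change (m * ((r₀ + 1 : ℝ) : ℂ)).im < 0
    rw [Complex.im_mul_ofReal]; nlinarith
  have hm0 : m ≠ 0 := by rintro rfl; simp at hm
  have htend : Tendsto (fun r : ℝ => m * (r : ℂ)) (𝓝[≠] (r₀ + 1))
      (𝓝[≠] (m * ((r₀ + 1 : ℝ) : ℂ))) := by
    refine tendsto_nhdsWithin_iff.2 ⟨?_, ?_⟩
    · exact (Continuous.tendsto (by fun_prop) _).mono_left nhdsWithin_le_nhds
    · filter_upwards [self_mem_nhdsWithin] with r hr
      simpa [hm0] using fun h => hr (by exact_mod_cast h)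
  have hev : ∀ᶠ r : ℝ in 𝓝[≠] (r₀ + 1), hankel2 n (m * r) = 0 := by
    refine mem_nhdsWithin_of_mem_nhds ?_
    filter_upwards [lt_mem_nhds (show r₀ < r₀ + 1 by linarith)] with r hr using hzero r hr
  have hfreq : ∃ᶠ z in 𝓝[≠] (m * ((r₀ + 1 : ℝ) : ℂ)), hankel2 n z = 0 :=
    htend.frequently hev.frequently
  have := han.eqOn_zero_of_preconnected_of_frequently_eq_zero hconn hmem hfreq
    (show (-Complex.I * ((1 : ℝ) : ℂ)) ∈ {z : ℂ | z.im < 0} by simp)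
  exact hankel2_neg_I_mul_ne_zero n one_pos this

end Droplet
end

noncomputable section
namespace Droplet
open Filter Topology

/-! ## Wirtinger calculus on the plane -/

/-- The complex coordinate `x₀ + i x₁` as a real-linear map. -/
def dz : Plane →L[ℝ] ℂ :=
  Complex.ofRealCLM.comp (EuclideanSpace.proj (0 : Fin 2)) +
    Complex.I • Complex.ofRealCLM.comp (EuclideanSpace.proj (1 : Fin 2))

/-- The conjugate coordinate `x₀ - i x₁` as a real-linear map. -/
def dzbar : Plane →L[ℝ] ℂ :=
  Complex.ofRealCLM.comp (EuclideanSpace.proj (0 : Fin 2)) -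
    Complex.I • Complex.ofRealCLM.comp (EuclideanSpace.proj (1 : Fin 2))

theorem dz_apply (x : Plane) : dz x = (x 0 : ℂ) + Complex.I * (x 1 : ℂ) := by simp [dz]

theorem dzbar_apply (x : Plane) : dzbar x = (x 0 : ℂ) - Complex.I * (x 1 : ℂ) := by simp [dzbar]

theorem norm_dz (x : Plane) : ‖dz x‖ = ‖x‖ := by
  rw [dz_apply, mul_comm, EuclideanSpace.norm_eq, Complex.norm_add_mul_I]
  simp [Fin.sum_univ_two]

theorem dz_mul_dzbar (x : Plane) : dz x * dzbar x = (‖x‖ : ℂ) ^ 2 := by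
  rw [dz_apply, dzbar_apply, ← Complex.ofReal_pow, EuclideanSpace.real_norm_sq_eq]
  simp only [Fin.sum_univ_two]
  push_cast
  linear_combination (-(x 1 : ℂ) ^ 2) * Complex.I_sq

theorem dz_ne_zero {x : Plane} (hx : x ≠ 0) : dz x ≠ 0 := by
  rw [← norm_ne_zero_iff, norm_dz]; exact norm_ne_zero_iff.2 hx

theorem dzbar_ne_zero {x : Plane} (hx : x ≠ 0) : dzbar x ≠ 0 := by
  have h := dz_mul_dzbar x
  intro h0
  rw [h0, mul_zero] at h
  exact hx (by simpa using h.symm)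

theorem norm_dzbar (x : Plane) : ‖dzbar x‖ = ‖x‖ := by
  by_cases hx : x = 0
  · simp [hx]
  · have h := congrArg norm (dz_mul_dzbar x)
    rw [norm_mul, norm_dz, norm_pow, Complex.norm_real, norm_norm, sq] at h
    exact mul_left_cancel₀ (norm_ne_zero_iff.2 hx) h

theorem dz_single_zero : dz (EuclideanSpace.single 0 1) = 1 := by simp [dz_apply]
theorem dz_single_one : dz (EuclideanSpace.single 1 1) = Complex.I := by simp [dz_apply]
theorem dzbar_single_zero : dzbar (EuclideanSpace.single 0 1) = 1 := by simp [dzbar_apply]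
theorem dzbar_single_one : dzbar (EuclideanSpace.single 1 1) = -Complex.I := by simp [dzbar_apply]

/-- `f` is real-differentiable at `x` with Wirtinger derivatives `a = ∂f/∂z`, `b = ∂f/∂z̄`. -/
def HasWirtinger (f : Plane → ℂ) (a b : ℂ) (x : Plane) : Prop :=
  HasFDerivAt f (a • dz + b • dzbar) x

namespace HasWirtinger

variable {f g : Plane → ℂ} {a b a' b' : ℂ} {x : Plane}

theorem add (hf : HasWirtinger f a b x) (hg : HasWirtinger g a' b' x) :
    HasWirtinger (fun y => f y + g y) (a + a') (b + b') x := by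
  unfold HasWirtinger at *
  convert! HasFDerivAt.add hf hg using 1
  module

theorem const_mul (c : ℂ) (hf : HasWirtinger f a b x) :
    HasWirtinger (fun y => c * f y) (c * a) (c * b) x := by
  unfold HasWirtinger at *
  convert! HasFDerivAt.const_mul hf c using 1
  module

theorem mul (hf : HasWirtinger f a b x) (hg : HasWirtinger g a' b' x) :
    HasWirtinger (fun y => f y * g y) (f x * a' + g x * a) (f x * b' + g x * b) x := by
  unfold HasWirtinger at *
  convert! HasFDerivAt.mul hf hg using 1
  module

theorem comp {φ : ℂ → ℂ} {φ' : ℂ} (hφ : HasDerivAt φ φ' (f x)) (hf : HasWirtinger f a b x) :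
    HasWirtinger (fun y => φ (f y)) (φ' * a) (φ' * b) x := by
  unfold HasWirtinger at *
  convert! hφ.comp_hasFDerivAt x hf using 1
  module

theorem congr_val (hf : HasWirtinger f a b x) (ha : a = a') (hb : b = b') :
    HasWirtinger f a' b' x := ha ▸ hb ▸ hf

theorem differentiableAt (hf : HasWirtinger f a b x) : DifferentiableAt ℝ f x :=
  HasFDerivAt.differentiableAt hf

theorem partialWithin_zero {S : Set Plane} (hf : HasWirtinger f a b x)
    (hS : UniqueDiffWithinAt ℝ S x) : partialWithin S f 0 x = a + b := by
  rw [partialWithin, (HasFDerivAt.hasFDerivWithinAt hf).fderivWithin hS]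
  simp [dz_single_zero, dzbar_single_zero]

theorem partialWithin_one {S : Set Plane} (hf : HasWirtinger f a b x)
    (hS : UniqueDiffWithinAt ℝ S x) : partialWithin S f 1 x = Complex.I * (a - b) := by
  rw [partialWithin, (HasFDerivAt.hasFDerivWithinAt hf).fderivWithin hS]
  simp [dz_single_one, dzbar_single_one]
  ring

/-- Δ = 4∂∂̄, written as 2(∂̄∂f + ∂∂̄f) so that equality of the mixed derivatives need not be known.
-/
theorem laplacian {A B : Plane → ℂ} {aa ab ba bb : ℂ} {U : Set Plane} (hU : IsOpen U) (hx : x ∈ U)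
    (hf : ∀ y ∈ U, HasWirtinger f (A y) (B y) y) (hA : HasWirtinger A aa ab x)
    (hB : HasWirtinger B ba bb x) : Laplacian.laplacian f x = 2 * (ab + ba) := by
  have h1 : fderiv ℝ f =ᶠ[𝓝 x] fun y => A y • dz + B y • dzbar := by
    filter_upwards [hU.mem_nhds hx] with y hy using (hf y hy).fderiv
  have h2 : HasFDerivAt (fun y => A y • dz + B y • dzbar)
      ((aa • dz + ab • dzbar).smulRight dz + (ba • dz + bb • dzbar).smulRight dzbar) x :=
    (HasFDerivAt.smul_const hA dz).add (HasFDerivAt.smul_const hB dzbar)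
  rw [InnerProductSpace.laplacian_eq_iteratedFDeriv_orthonormalBasis f
    (EuclideanSpace.basisFun (Fin 2) ℝ)]
  simp only [Fin.sum_univ_two, iteratedFDeriv_two_apply, h1.fderiv_eq, h2.fderiv]
  simp [dz_single_zero, dz_single_one, dzbar_single_zero, dzbar_single_one]
  linear_combination (aa - ab - ba + bb) * Complex.I_sq

end HasWirtinger

theorem hasWirtinger_dz (x : Plane) : HasWirtinger (fun y => dz y) 1 0 x := by
  unfold HasWirtinger
  convert! dz.hasFDerivAt (x := x) using 1
  ext y; simp

theorem hasWirtinger_dzbar (x : Plane) : HasWirtinger (fun y => dzbar y) 0 1 x := by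
  unfold HasWirtinger
  convert! dzbar.hasFDerivAt (x := x) using 1
  ext y; simp

theorem hasWirtinger_dz_zpow (l : ℤ) {x : Plane} (h : x ≠ 0 ∨ 0 ≤ l) :
    HasWirtinger (fun y => dz y ^ l) (l * dz x ^ (l - 1)) 0 x := by
  have h' : dz x ≠ 0 ∨ 0 ≤ l := h.imp_left dz_ne_zero
  refine ((hasWirtinger_dz x).comp (hasDerivAt_zpow l _ h')).congr_val ?_ ?_ <;> ring

theorem hasWirtinger_dzbar_zpow (l : ℤ) {x : Plane} (h : x ≠ 0 ∨ 0 ≤ l) :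
    HasWirtinger (fun y => dzbar y ^ l) 0 (l * dzbar x ^ (l - 1)) x := by
  have h' : dzbar x ≠ 0 ∨ 0 ≤ l := h.imp_left dzbar_ne_zero
  refine ((hasWirtinger_dzbar x).comp (hasDerivAt_zpow l _ h')).congr_val ?_ ?_ <;> ring

theorem hasWirtinger_norm {x : Plane} (hx : x ≠ 0) :
    HasWirtinger (fun y => (‖y‖ : ℂ)) (dzbar x / (2 * ‖x‖)) (dz x / (2 * ‖x‖)) x := by
  have hr : ‖x‖ ≠ 0 := norm_ne_zero_iff.2 hx
  have h1 : HasFDerivAt (fun y : Plane => √(‖y‖ ^ 2)) _ x :=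
    ((hasStrictFDerivAt_norm_sq x).hasFDerivAt).sqrt (by positivity)
  have h2 := Complex.ofRealCLM.hasFDerivAt.comp x h1
  unfold HasWirtinger
  convert! h2 using 1
  · ext y; simp
  · have hrc : (‖x‖ : ℂ) ≠ 0 := by exact_mod_cast hr
    ext y
    simp [dz_apply, dzbar_apply, PiLp.inner_apply, Fin.sum_univ_two]
    field_simp
    linear_combination (-2 * (x 1 : ℂ) * (y 1 : ℂ)) * Complex.I_sq

theorem contDiffOn_dz_zpow (N : ℕ) (l : ℤ) {U : Set Plane} (h : 0 ∉ U ∨ 0 ≤ l) :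
    ContDiffOn ℝ N (fun y => dz y ^ l) U := by
  have hd : ContDiffOn ℝ N (fun y => dz y) U := dz.contDiff.contDiffOn
  obtain ⟨n, rfl | rfl⟩ := l.eq_nat_or_neg
  · simpa using hd.pow n
  · rcases h with h | h
    · simp only [zpow_neg, zpow_natCast]
      exact (hd.pow n).inv fun x hx => pow_ne_zero _ (dz_ne_zero fun h0 => h (h0 ▸ hx))
    · obtain rfl : n = 0 := by omega
      simpa using contDiffOn_const

theorem contDiffOn_dzbar_zpow (N : ℕ) (l : ℤ) {U : Set Plane} (h : 0 ∉ U ∨ 0 ≤ l) :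
    ContDiffOn ℝ N (fun y => dzbar y ^ l) U := by
  have hd : ContDiffOn ℝ N (fun y => dzbar y) U := dzbar.contDiff.contDiffOn
  obtain ⟨n, rfl | rfl⟩ := l.eq_nat_or_neg
  · simpa using hd.pow n
  · rcases h with h | h
    · simp only [zpow_neg, zpow_natCast]
      exact (hd.pow n).inv fun x hx => pow_ne_zero _ (dzbar_ne_zero fun h0 => h (h0 ▸ hx))
    · obtain rfl : n = 0 := by omega
      simpa using contDiffOn_const

/-! ## Cylinder functions -/

/-- A family of functions on the positive half-line that satisfies the relations between cylinder
functions `r ↦ Z_n(m r)` of consecutive integer orders. -/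
structure IsCylinderFamily (m : ℂ) (Z : ℤ → ℝ → ℂ) : Prop where
  hasDerivAt : ∀ n r, 0 < r → HasDerivAt (Z n) (m / 2 * (Z (n - 1) r - Z (n + 1) r)) r
  recurrence : ∀ n r, 0 < r → m * r * (Z (n - 1) r + Z (n + 1) r) = 2 * n * Z n r
  reflection : ∀ n r, Z (-n) r = (-1) ^ n * Z n r

theorem isCylinderFamily_besselJ (m : ℂ) :
    IsCylinderFamily m fun n r => besselJ n (m * r) where
  hasDerivAt n r _ := by
    have h : HasDerivAt (fun r : ℝ => m * (r : ℂ)) (m * 1) r :=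
      ((hasDerivAt_id r).ofReal_comp).const_mul m
    convert! (hasDerivAt_besselJ n (m * r)).comp r h using 1
    ring
  recurrence n r _ := besselJ_recurrence n (m * r)
  reflection n r := besselJ_neg n _

theorem isCylinderFamily_hankel2 {m : ℂ} (hm : m.im < 0) :
    IsCylinderFamily m fun n r => hankel2 n (m * r) where
  hasDerivAt n r hr := by
    have h : HasDerivAt (fun r : ℝ => m * (r : ℂ)) (m * 1) r :=
      ((hasDerivAt_id r).ofReal_comp).const_mul m
    have him : (m * (r : ℂ)).im < 0 := by rw [Complex.im_mul_ofReal]; nlinarith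
    convert! (hasDerivAt_hankel2 n him).comp r h using 1
    ring
  recurrence n r hr := hankel2_recurrence n (by rw [Complex.im_mul_ofReal]; nlinarith)
  reflection n r := hankel2_neg n _

/-- The functions `e_n` that are cyclically related by the Wirtinger derivatives, as are the
cylinder waves `Z_n(m r) e^{i n θ}`. -/
def IsWaveFamily (m : ℂ) (e : ℤ → Plane → ℂ) (U : Set Plane) : Prop :=
  ∀ n, ∀ x ∈ U, HasWirtinger (e n) (m / 2 * e (n - 1) x) (-(m / 2 * e (n + 1) x)) x

/-- The cylinder wave `Z_n(r) e^{i n θ}`. -/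
def cylinderWave (Z : ℤ → ℝ → ℂ) (n : ℤ) (x : Plane) : ℂ := Z n ‖x‖ * (dz x / ‖x‖) ^ n

/-- In polar form 2∂ = e^{-iθ}(∂_r - (i/r)∂_θ), and derivative formula and recurrence give Z_n' +
(n/r)Z_n = mZ_{n-1}. Likewise Z_n' - (n/r)Z_n = -mZ_{n+1} for ∂̄. -/
theorem IsCylinderFamily.isWaveFamily {m : ℂ} {Z : ℤ → ℝ → ℂ} (hZ : IsCylinderFamily m Z) :
    IsWaveFamily m (cylinderWave Z) {0}ᶜ := by
  intro n x hx
  have hx0 : x ≠ 0 := hx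
  have hr : 0 < ‖x‖ := norm_pos_iff.2 hx0
  have hrc : (‖x‖ : ℂ) ≠ 0 := by exact_mod_cast hr.ne'
  have hz := dz_ne_zero hx0
  have hN := hasWirtinger_norm hx0
  have h1 : HasWirtinger (fun y => Z n ‖y‖)
      (m / 2 * (Z (n - 1) ‖x‖ - Z (n + 1) ‖x‖) * (dzbar x / (2 * ‖x‖)))
      (m / 2 * (Z (n - 1) ‖x‖ - Z (n + 1) ‖x‖) * (dz x / (2 * ‖x‖))) x := by
    have hN' : HasFDerivAt (fun y : Plane => ‖y‖) (Complex.reCLM.comp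
        ((dzbar x / (2 * ‖x‖)) • dz + (dz x / (2 * ‖x‖)) • dzbar)) x :=
      Complex.reCLM.hasFDerivAt.comp x hN
    unfold HasWirtinger at *
    convert! (hZ.hasDerivAt n _ hr).hasFDerivAt.comp x hN' using 1
    ext y
    -- The chain rule for the real-variable function Z_n passes through a real part; the
    -- differential of the norm, ⟨x, y⟩/‖x‖, is already real.
    have hreal : (dzbar x / (2 * ‖x‖) * dz y + dz x / (2 * ‖x‖) * dzbar y) =
        (((dzbar x / (2 * ‖x‖) * dz y + dz x / (2 * ‖x‖) * dzbar y).re : ℝ) : ℂ) := by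
      rw [show dzbar x / (2 * ‖x‖) * dz y + dz x / (2 * ‖x‖) * dzbar y =
        (((x 0 * y 0 + x 1 * y 1) / ‖x‖ : ℝ) : ℂ) by
          simp only [dz_apply, dzbar_apply]
          push_cast
          field_simp
          linear_combination (-2 * (x 1 : ℂ) * (y 1 : ℂ)) * Complex.I_sq, Complex.ofReal_re]
    simp only [ContinuousLinearMap.comp_apply, add_apply,
      smul_apply, smul_eq_mul, Complex.reCLM_apply,
      ContinuousLinearMap.toSpanSingleton_apply, Complex.real_smul]
    rw [← hreal]; ring
  have h2 := (HasWirtinger.comp (hasDerivAt_inv hrc) hN)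
  have h3 := (hasWirtinger_dz x).mul h2
  have h4 := h3.comp (hasDerivAt_zpow n _ (Or.inl (mul_ne_zero hz (inv_ne_zero hrc))))
  have h5 := h1.mul h4
  have hrec := hZ.recurrence n ‖x‖ hr
  have hzz : dzbar x = (‖x‖ : ℂ) ^ 2 / dz x := by
    rw [eq_div_iff hz, mul_comm, dz_mul_dzbar]
  have hfun : cylinderWave Z n = fun y => Z n ‖y‖ * (dz y * (‖y‖ : ℂ)⁻¹) ^ n := by
    ext y; rw [cylinderWave, div_eq_mul_inv]
  rw [hfun]
  set q : ℂ := dz x * (‖x‖ : ℂ)⁻¹ with hq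
  have hq0 : q ≠ 0 := mul_ne_zero hz (inv_ne_zero hrc)
  have hzq : dz x = q * ‖x‖ := by rw [hq]; field_simp
  clear_value q
  refine h5.congr_val ?_ ?_
  · simp only [cylinderWave]
    rw [div_eq_mul_inv (dz x) (‖x‖ : ℂ), ← hq, hzz, hzq, zpow_sub₀ hq0, zpow_one]
    field_simp
    linear_combination -hrec
  · simp only [cylinderWave]
    rw [div_eq_mul_inv (dz x) (‖x‖ : ℂ), ← hq, hzq, zpow_sub₀ hq0, zpow_add₀ hq0, zpow_one]
    field_simp
    linear_combination q ^ 2 * hrec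

end Droplet
end

/-! ### Bessel waves across the origin, and smoothness of waves -/

noncomputable section
namespace Droplet
open Filter Topology

/-- The Bessel wave `J_n(m r) e^{i n θ}`, written so that it is manifestly smooth at the origin. -/
def besselWave (m : ℂ) : ℤ → Plane → ℂ
  | Int.ofNat n, x => (m / 2) ^ n * (dz x ^ n * besselG n ((m / 2) ^ 2 * (dz x * dzbar x)))
  | Int.negSucc n, x => (-(m / 2)) ^ (n + 1) *
      (dzbar x ^ (n + 1) * besselG (n + 1) ((m / 2) ^ 2 * (dz x * dzbar x)))

theorem besselWave_natCast (m : ℂ) (n : ℕ) (x : Plane) :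
    besselWave m n x = (m / 2) ^ n * (dz x ^ n * besselG n ((m / 2) ^ 2 * (dz x * dzbar x))) := rfl

theorem besselWave_neg_natCast (m : ℂ) (n : ℕ) (x : Plane) :
    besselWave m (-n) x =
      (-(m / 2)) ^ n * (dzbar x ^ n * besselG n ((m / 2) ^ 2 * (dz x * dzbar x))) := by
  cases n with
  | zero => simpa using besselWave_natCast m 0 x
  | succ n => rfl

theorem besselWave_eq (m : ℂ) (n : ℤ) {x : Plane} (hx : x ≠ 0) :
    besselWave m n x = cylinderWave (fun n r => besselJ n (m * r)) n x := by
  have hr : (‖x‖ : ℂ) ≠ 0 := by exact_mod_cast (norm_pos_iff.2 hx).ne'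
  obtain ⟨q, hq⟩ : ∃ q, dz x / ‖x‖ = q := ⟨_, rfl⟩
  have hq0 : q ≠ 0 := hq ▸ div_ne_zero (dz_ne_zero hx) hr
  have hz : dz x = q * ‖x‖ := by rw [← hq]; field_simp
  have hzz : dzbar x = q⁻¹ * ‖x‖ := by
    have := dz_mul_dzbar x
    rw [hz] at this
    field_simp
    exact mul_right_cancel₀ hr (by linear_combination this)
  obtain ⟨n, rfl | rfl⟩ := n.eq_nat_or_neg
  · rw [besselWave_natCast, cylinderWave, besselJ_natCast, dz_mul_dzbar, zpow_natCast, hq, hz,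
      show (m * (‖x‖ : ℂ) / 2) = m / 2 * ‖x‖ by ring, mul_pow (m / 2), mul_pow (m / 2), mul_pow]
    ring
  · rw [besselWave_neg_natCast, cylinderWave, besselJ_neg_natCast, besselJ_natCast, dz_mul_dzbar,
      zpow_neg, zpow_natCast, hq, hzz, neg_pow, ← inv_pow,
      show (m * (‖x‖ : ℂ) / 2) = m / 2 * ‖x‖ by ring, mul_pow (m / 2), mul_pow (m / 2), mul_pow]
    ring

/-- No polar coordinates are used, so the origin is included. For n > 0 the derivative ∂̄ hits only
`besselG` and raises its order at once, whereas ∂ also hits z^n and needs `besselG_recurrence`. For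
n < 0 the roles are exchanged. -/
theorem isWaveFamily_besselWave (m : ℂ) : IsWaveFamily m (besselWave m) Set.univ := by
  intro n x _
  have hs := ((hasWirtinger_dz x).mul (hasWirtinger_dzbar x)).const_mul ((m / 2) ^ 2)
  have hG : ∀ n, HasWirtinger (fun y => besselG n ((m / 2) ^ 2 * (dz y * dzbar y))) _ _ x :=
    fun n => hs.comp (hasDerivAt_besselG n _)
  have hz : ∀ n : ℕ, HasWirtinger (fun y => dz y ^ n) _ _ x :=
    fun n => (hasWirtinger_dz x).comp (hasDerivAt_pow n (dz x))
  have hzb : ∀ n : ℕ, HasWirtinger (fun y => dzbar y ^ n) _ _ x :=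
    fun n => (hasWirtinger_dzbar x).comp (hasDerivAt_pow n (dzbar x))
  set s := (m / 2) ^ 2 * (dz x * dzbar x) with hs_def
  rcases lt_trichotomy n 0 with h | rfl | h
  · obtain ⟨j, rfl⟩ : ∃ j : ℕ, n = -((j + 1 : ℕ) : ℤ) := ⟨(-n - 1).toNat, by omega⟩
    have h5 := ((hzb (j + 1)).mul (hG (j + 1))).const_mul ((-(m / 2)) ^ (j + 1))
    have hfun : besselWave m (-((j + 1 : ℕ) : ℤ)) = fun x => (-(m / 2)) ^ (j + 1) *
      (dzbar x ^ (j + 1) * besselG (j + 1) ((m / 2) ^ 2 * (dz x * dzbar x))) := by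
      ext y; exact besselWave_neg_natCast m _ y
    have hrec := besselG_recurrence j s
    rw [hfun]
    refine h5.congr_val ?_ ?_
    · rw [show -((j + 1 : ℕ) : ℤ) - 1 = -((j + 2 : ℕ) : ℤ) by push_cast; ring,
        besselWave_neg_natCast, ← hs_def]
      ring
    · rw [show -((j + 1 : ℕ) : ℤ) + 1 = -(j : ℤ) by push_cast; ring,
        besselWave_neg_natCast, ← hs_def]
      simp only [add_tsub_cancel_right]
      push_cast
      rw [pow_succ (-(m / 2))]
      rw [hs_def] at hrec ⊢
      linear_combination (m / 2) * (-(m / 2)) ^ j * dzbar x ^ j * hrec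
  · have h5 := ((hz 0).mul (hG 0)).const_mul ((m / 2) ^ 0)
    have hfun : besselWave m 0 = fun x => (m / 2) ^ 0 *
      (dz x ^ 0 * besselG 0 ((m / 2) ^ 2 * (dz x * dzbar x))) := rfl
    rw [hfun]
    refine h5.congr_val ?_ ?_
    · have := besselWave_neg_natCast m 1 x
      rw [show (0 : ℤ) - 1 = -((1 : ℕ) : ℤ) by norm_num, this, ← hs_def]
      simp; ring
    · have := besselWave_natCast m 1 x
      rw [show (0 : ℤ) + 1 = ((1 : ℕ) : ℤ) by norm_num, this, ← hs_def]
      simp; ring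
  · obtain ⟨j, rfl⟩ : ∃ j : ℕ, n = ((j + 1 : ℕ) : ℤ) := ⟨(n - 1).toNat, by omega⟩
    have h5 := ((hz (j + 1)).mul (hG (j + 1))).const_mul ((m / 2) ^ (j + 1))
    have hfun : besselWave m ((j + 1 : ℕ) : ℤ) = fun x => (m / 2) ^ (j + 1) *
      (dz x ^ (j + 1) * besselG (j + 1) ((m / 2) ^ 2 * (dz x * dzbar x))) := rfl
    have hrec := besselG_recurrence j s
    rw [hfun]
    refine h5.congr_val ?_ ?_
    · rw [show ((j + 1 : ℕ) : ℤ) - 1 = (j : ℤ) by push_cast; ring,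
        besselWave_natCast, ← hs_def]
      simp only [add_tsub_cancel_right]
      push_cast
      rw [pow_succ (m / 2)]
      rw [hs_def] at hrec ⊢
      linear_combination (-(m / 2)) * (m / 2) ^ j * dz x ^ j * hrec
    · rw [show ((j + 1 : ℕ) : ℤ) + 1 = ((j + 2 : ℕ) : ℤ) by push_cast; ring,
        besselWave_natCast, ← hs_def]
      ring

/-- Derivatives of waves are combinations of waves, so regularity bootstraps by induction over all
orders n at once. -/
theorem IsWaveFamily.contDiffOn {m : ℂ} {e : ℤ → Plane → ℂ} {U : Set Plane}
    (he : IsWaveFamily m e U) (hU : IsOpen U) (N : ℕ) (n : ℤ) : ContDiffOn ℝ N (e n) U := by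
  induction N generalizing n with
  | zero =>
    rw [Nat.cast_zero, contDiffOn_zero]
    exact fun x hx => (he n x hx).differentiableAt.continuousAt.continuousWithinAt
  | succ N ih =>
    push_cast
    rw [contDiffOn_succ_iff_fderiv_of_isOpen hU]
    refine ⟨fun x hx => (he n x hx).differentiableAt.differentiableWithinAt, by simp, ?_⟩
    refine ContDiffOn.congr (f := fun x => (m / 2 * e (n - 1) x) • dz +
      (-(m / 2 * e (n + 1) x)) • dzbar) ?_ (fun x hx => HasFDerivAt.fderiv (he n x hx))
    exact ((contDiffOn_const.mul (ih _)).smul contDiffOn_const).add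
      ((contDiffOn_const.mul (ih _)).neg.smul contDiffOn_const)

end Droplet
end

noncomputable section
namespace Droplet
open Filter Topology

/-! ## Flows with a modal stream function -/

/-- Data of the stream function
`ψ = a₁ e_k + a₂ e_{-k} + b₁ z^l + b₂ z̄^l`, where `e_n` are cylinder waves with wave number `m`. -/
structure StreamData where
  m : ℂ
  e : ℤ → Plane → ℂ
  k : ℤ
  l : ℤ
  a₁ : ℂ
  a₂ : ℂ
  b₁ : ℂ
  b₂ : ℂ

namespace StreamData

variable (D : StreamData)

/-- The derivative `∂ψ/∂z`. -/
def psiZ (x : Plane) : ℂ :=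
  D.m / 2 * (D.a₁ * D.e (D.k - 1) x + D.a₂ * D.e (-D.k - 1) x) + D.l * D.b₁ * dz x ^ (D.l - 1)

/-- The derivative `∂ψ/∂z̄`. -/
def psiZbar (x : Plane) : ℂ :=
  -(D.m / 2) * (D.a₁ * D.e (D.k + 1) x + D.a₂ * D.e (-D.k + 1) x) +
    D.l * D.b₂ * dzbar x ^ (D.l - 1)

/-- The derivative `∂²ψ/∂z²`. -/
def psiZZ (x : Plane) : ℂ :=
  (D.m / 2) ^ 2 * (D.a₁ * D.e (D.k - 2) x + D.a₂ * D.e (-D.k - 2) x) +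
    D.l * (D.l - 1) * D.b₁ * dz x ^ (D.l - 2)

/-- The derivative `∂²ψ/∂z̄²`. -/
def psiZbarZbar (x : Plane) : ℂ :=
  (D.m / 2) ^ 2 * (D.a₁ * D.e (D.k + 2) x + D.a₂ * D.e (-D.k + 2) x) +
    D.l * (D.l - 1) * D.b₂ * dzbar x ^ (D.l - 2)

/-- The derivative `∂²ψ/∂z∂z̄`. -/
def psiZZbar (x : Plane) : ℂ :=
  -(D.m / 2) ^ 2 * (D.a₁ * D.e D.k x + D.a₂ * D.e (-D.k) x)

/-- The velocity `(∂ψ/∂x₁, -∂ψ/∂x₀)`. -/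
def velocity : Fin 2 → Plane → ℂ :=
  ![fun x => Complex.I * (D.psiZ x + -1 * D.psiZbar x), fun x => -1 * (D.psiZ x + D.psiZbar x)]

/-- A harmonic conjugate of the harmonic part of `ψ`. -/
def pressure (x : Plane) : ℂ :=
  Complex.I * (D.b₁ * dz x ^ D.l + -D.b₂ * dzbar x ^ D.l)

variable {D} {U : Set Plane} {x : Plane}

/-- The alternative on x and l serves both fluids: outside, powers are negative but the origin is
excluded; in the droplet l = k ≥ 2 and the origin must be included. -/
theorem hasWirtinger_psiZ (he : IsWaveFamily D.m D.e U) (hx : x ∈ U) (hl : x ≠ 0 ∨ 2 ≤ D.l) :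
    HasWirtinger D.psiZ (D.psiZZ x) (D.psiZZbar x) x := by
  have h1 := ((((he (D.k - 1) x hx).const_mul D.a₁).add
    ((he (-D.k - 1) x hx).const_mul D.a₂)).const_mul (D.m / 2)).add
    ((hasWirtinger_dz_zpow (D.l - 1) (hl.imp_right fun h => by omega)).const_mul (D.l * D.b₁))
  refine HasWirtinger.congr_val (f := D.psiZ) h1 ?_ ?_
  · rw [psiZZ, show D.k - 1 - 1 = D.k - 2 by ring, show -D.k - 1 - 1 = -D.k - 2 by ring,
      show D.l - 1 - 1 = D.l - 2 by ring]
    push_cast; ring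
  · rw [psiZZbar, show D.k - 1 + 1 = D.k by ring, show -D.k - 1 + 1 = -D.k by ring]
    ring

theorem hasWirtinger_psiZbar (he : IsWaveFamily D.m D.e U) (hx : x ∈ U) (hl : x ≠ 0 ∨ 2 ≤ D.l) :
    HasWirtinger D.psiZbar (D.psiZZbar x) (D.psiZbarZbar x) x := by
  have h1 := ((((he (D.k + 1) x hx).const_mul D.a₁).add
    ((he (-D.k + 1) x hx).const_mul D.a₂)).const_mul (-(D.m / 2))).add
    ((hasWirtinger_dzbar_zpow (D.l - 1) (hl.imp_right fun h => by omega)).const_mul (D.l * D.b₂))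
  refine HasWirtinger.congr_val (f := D.psiZbar) h1 ?_ ?_
  · rw [psiZZbar, show D.k + 1 - 1 = D.k by ring, show -D.k + 1 - 1 = -D.k by ring]
    ring
  · rw [psiZbarZbar, show D.k + 1 + 1 = D.k + 2 by ring, show -D.k + 1 + 1 = -D.k + 2 by ring,
      show D.l - 1 - 1 = D.l - 2 by ring]
    push_cast; ring

theorem hasWirtinger_velocity_zero (he : IsWaveFamily D.m D.e U) (hx : x ∈ U)
    (hl : x ≠ 0 ∨ 2 ≤ D.l) :
    HasWirtinger (D.velocity 0) (Complex.I * (D.psiZZ x + -1 * D.psiZZbar x))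
      (Complex.I * (D.psiZZbar x + -1 * D.psiZbarZbar x)) x :=
  ((hasWirtinger_psiZ he hx hl).add
    ((hasWirtinger_psiZbar he hx hl).const_mul (-1))).const_mul Complex.I

theorem hasWirtinger_velocity_one (he : IsWaveFamily D.m D.e U) (hx : x ∈ U)
    (hl : x ≠ 0 ∨ 2 ≤ D.l) :
    HasWirtinger (D.velocity 1) (-1 * (D.psiZZ x + D.psiZZbar x))
      (-1 * (D.psiZZbar x + D.psiZbarZbar x)) x :=
  ((hasWirtinger_psiZ he hx hl).add (hasWirtinger_psiZbar he hx hl)).const_mul (-1)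

theorem hasWirtinger_pressure (hl : x ≠ 0 ∨ 2 ≤ D.l) :
    HasWirtinger D.pressure (Complex.I * (D.b₁ * (D.l * dz x ^ (D.l - 1))))
      (Complex.I * (-D.b₂ * (D.l * dzbar x ^ (D.l - 1)))) x := by
  have hl' : x ≠ 0 ∨ 0 ≤ D.l := hl.imp_right fun h => by omega
  refine ((((hasWirtinger_dz_zpow D.l hl').const_mul D.b₁).add
    ((hasWirtinger_dzbar_zpow D.l hl').const_mul (-D.b₂))).const_mul Complex.I).congr_val ?_ ?_ <;>
  simp

/-- `f` is twice continuously differentiable at `x` with Laplacian `g` there. -/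
def HasLaplacian (f : Plane → ℂ) (g : ℂ) (x : Plane) : Prop :=
  ContDiffAt ℝ 2 f x ∧ Laplacian.laplacian f x = g

theorem HasLaplacian.add {f f' : Plane → ℂ} {g g' : ℂ} (h : HasLaplacian f g x)
    (h' : HasLaplacian f' g' x) : HasLaplacian (fun y => f y + f' y) (g + g') x :=
  ⟨h.1.add h'.1, by rw [← h.2, ← h'.2]; exact h.1.laplacian_add h'.1⟩

theorem HasLaplacian.const_mul {f : Plane → ℂ} {g : ℂ} (c : ℂ) (h : HasLaplacian f g x) :
    HasLaplacian (fun y => c * f y) (c * g) x := by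
  refine ⟨contDiffAt_const.mul h.1, ?_⟩
  rw [← h.2]
  exact h.1.laplacian_CLM_comp_left (l := ContinuousLinearMap.mul ℝ ℂ c)

/-- Applying ∂ and ∂̄ shifts the index down and up again, with factor -(m/2)²: each wave is an
eigenfunction of the Laplacian. -/
theorem hasLaplacian_wave {m : ℂ} {e : ℤ → Plane → ℂ} (he : IsWaveFamily m e U) (hU : IsOpen U)
    (hx : x ∈ U) (n : ℤ) : HasLaplacian (e n) (-m ^ 2 * e n x) x := by
  refine ⟨(he.contDiffOn hU 2 n).contDiffAt (hU.mem_nhds hx), ?_⟩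
  have h2 := (he (n + 1) x hx).const_mul (-(m / 2))
  simp only [neg_mul] at h2
  rw [HasWirtinger.laplacian hU hx (fun y hy => he n y hy)
    ((he (n - 1) x hx).const_mul (m / 2)) h2]
  rw [show n - 1 + 1 = n by ring, show n + 1 - 1 = n by ring]
  ring

theorem hasWirtinger_zero (x : Plane) : HasWirtinger (fun _ => 0) 0 0 x := by
  unfold HasWirtinger
  convert! hasFDerivAt_const (𝕜 := ℝ) (0 : ℂ) x using 1
  ext y; simp

theorem hasLaplacian_dz_zpow (hU : IsOpen U) (hx : x ∈ U) {l : ℤ} (hl : 0 ∉ U ∨ 1 ≤ l) :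
    HasLaplacian (fun y => dz y ^ l) 0 x := by
  have hl' : ∀ y ∈ U, y ≠ 0 ∨ 1 ≤ l := fun y hy => hl.imp_left fun h h0 => h (h0 ▸ hy)
  refine ⟨(contDiffOn_dz_zpow 2 l (hl.imp_right (by omega))).contDiffAt (hU.mem_nhds hx), ?_⟩
  rw [HasWirtinger.laplacian (B := fun _ => 0) hU hx
    (fun y hy => hasWirtinger_dz_zpow l ((hl' y hy).imp_right (by omega)))
    ((hasWirtinger_dz_zpow (l - 1) ((hl' x hx).imp_right (by omega))).const_mul (l : ℂ))
    (aa := _) (ba := 0) (bb := 0) (hasWirtinger_zero x)]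
  simp

theorem hasLaplacian_dzbar_zpow (hU : IsOpen U) (hx : x ∈ U) {l : ℤ} (hl : 0 ∉ U ∨ 1 ≤ l) :
    HasLaplacian (fun y => dzbar y ^ l) 0 x := by
  have hl' : ∀ y ∈ U, y ≠ 0 ∨ 1 ≤ l := fun y hy => hl.imp_left fun h h0 => h (h0 ▸ hy)
  refine ⟨(contDiffOn_dzbar_zpow 2 l (hl.imp_right (by omega))).contDiffAt (hU.mem_nhds hx), ?_⟩
  rw [HasWirtinger.laplacian (A := fun _ => 0) hU hx
    (fun y hy => hasWirtinger_dzbar_zpow l ((hl' y hy).imp_right (by omega)))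
    (aa := 0) (ab := 0) (hasWirtinger_zero x)
    ((hasWirtinger_dzbar_zpow (l - 1) ((hl' x hx).imp_right (by omega))).const_mul (l : ℂ))]
  simp

theorem hasLaplacian_psiZ (he : IsWaveFamily D.m D.e U) (hU : IsOpen U) (hx : x ∈ U)
    (hl : 0 ∉ U ∨ 2 ≤ D.l) :
    HasLaplacian D.psiZ (-D.m ^ 2 * (D.psiZ x - D.l * D.b₁ * dz x ^ (D.l - 1))) x := by
  have h := ((((hasLaplacian_wave he hU hx (D.k - 1)).const_mul D.a₁).add
    ((hasLaplacian_wave he hU hx (-D.k - 1)).const_mul D.a₂)).const_mul (D.m / 2)).add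
    ((hasLaplacian_dz_zpow hU hx (l := D.l - 1) (hl.imp_right (by omega))).const_mul (D.l * D.b₁))
  convert! h using 1
  simp only [psiZ]; ring

theorem hasLaplacian_psiZbar (he : IsWaveFamily D.m D.e U) (hU : IsOpen U) (hx : x ∈ U)
    (hl : 0 ∉ U ∨ 2 ≤ D.l) :
    HasLaplacian D.psiZbar (-D.m ^ 2 * (D.psiZbar x - D.l * D.b₂ * dzbar x ^ (D.l - 1))) x := by
  have h := ((((hasLaplacian_wave he hU hx (D.k + 1)).const_mul D.a₁).add
    ((hasLaplacian_wave he hU hx (-D.k + 1)).const_mul D.a₂)).const_mul (-(D.m / 2))).add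
    ((hasLaplacian_dzbar_zpow hU hx (l := D.l - 1) (hl.imp_right (by omega))).const_mul
      (D.l * D.b₂))
  convert! h using 1
  simp only [psiZbar]; ring

theorem contDiffOn_psiZ (he : IsWaveFamily D.m D.e U) (hU : IsOpen U) (hl : 0 ∉ U ∨ 2 ≤ D.l) :
    ContDiffOn ℝ 2 D.psiZ U :=
  fun _ hx => (hasLaplacian_psiZ he hU hx hl).1.contDiffWithinAt

theorem contDiffOn_psiZbar (he : IsWaveFamily D.m D.e U) (hU : IsOpen U) (hl : 0 ∉ U ∨ 2 ≤ D.l) :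
    ContDiffOn ℝ 2 D.psiZbar U :=
  fun _ hx => (hasLaplacian_psiZbar he hU hx hl).1.contDiffWithinAt

theorem contDiffOn_velocity (he : IsWaveFamily D.m D.e U) (hU : IsOpen U) (hl : 0 ∉ U ∨ 2 ≤ D.l)
    (i : Fin 2) : ContDiffOn ℝ 2 (D.velocity i) U := by
  have h1 := contDiffOn_psiZ he hU hl
  have h2 := contDiffOn_psiZbar he hU hl
  fin_cases i
  · exact contDiffOn_const.mul (h1.add (contDiffOn_const.mul h2))
  · exact contDiffOn_const.mul (h1.add h2)

theorem contDiffOn_pressure (hl : 0 ∉ U ∨ 2 ≤ D.l) : ContDiffOn ℝ 1 D.pressure U := by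
  have h1 := contDiffOn_dz_zpow 1 D.l (U := U) (hl.imp_right (by omega))
  have h2 := contDiffOn_dzbar_zpow 1 D.l (U := U) (hl.imp_right (by omega))
  exact contDiffOn_const.mul ((contDiffOn_const.mul h1).add (contDiffOn_const.mul h2))

/-- On `U` the flow is the modal flow with stream function `D`, decay rate `γ` and viscosity `η`. -/
structure Describes (D : StreamData) (f : Flow) (γ η : ℂ) (U : Set Plane) : Prop where
  velocity_eq : ∀ t, ∀ x ∈ U, ∀ i, f.u t x i = Complex.exp (-γ * (t : ℂ)) * D.velocity i x
  pressure_eq : ∀ t, ∀ x ∈ U,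
    f.p t x = Complex.exp (-γ * (t : ℂ)) * (η * D.m ^ 2 * D.pressure x)

theorem contDiffOn_exp_mul {N : WithTop ℕ∞} (γ : ℂ) {g : Plane → ℂ} {S : Set Plane}
    (hg : ContDiffOn ℝ N g S) :
    ContDiffOn ℝ N (fun q : ℝ × Plane => Complex.exp (-γ * (q.1 : ℂ)) * g q.2)
      (Set.Ioi 0 ×ˢ S) := by
  refine ContDiffOn.mul ?_ (hg.comp contDiff_snd.contDiffOn fun q hq => hq.2)
  have h : ContDiff ℝ N (fun q : ℝ × Plane => (q.1 : ℂ)) :=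
    Complex.ofRealCLM.contDiff.comp contDiff_fst
  exact (contDiff_const.mul h).cexp.contDiffOn

theorem norm_exp_neg_mul_le_one {γ : ℂ} (hγ : 0 ≤ γ.re) {t : ℝ} (ht : 0 < t) :
    ‖Complex.exp (-γ * (t : ℂ))‖ ≤ 1 := by
  rw [Complex.norm_exp, Complex.re_mul_ofReal, Complex.neg_re, Real.exp_le_one_iff]
  nlinarith

theorem Describes.hasWirtinger_velocity_zero {f : Flow} {γ η : ℂ} (hf : D.Describes f γ η U)
    (he : IsWaveFamily D.m D.e U) (hU : IsOpen U) (hx : x ∈ U) (hl : x ≠ 0 ∨ 2 ≤ D.l) (t : ℝ) :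
    HasWirtinger (fun y => f.u t y 0)
      (Complex.exp (-γ * (t : ℂ)) * (Complex.I * (D.psiZZ x + -1 * D.psiZZbar x)))
      (Complex.exp (-γ * (t : ℂ)) * (Complex.I * (D.psiZZbar x + -1 * D.psiZbarZbar x))) x := by
  have h := (StreamData.hasWirtinger_velocity_zero he hx hl).const_mul
    (Complex.exp (-γ * (t : ℂ)))
  refine HasFDerivAt.congr_of_eventuallyEq h ?_
  filter_upwards [hU.mem_nhds hx] with y hy using hf.velocity_eq t y hy 0

theorem Describes.hasWirtinger_velocity_one {f : Flow} {γ η : ℂ} (hf : D.Describes f γ η U)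
    (he : IsWaveFamily D.m D.e U) (hU : IsOpen U) (hx : x ∈ U) (hl : x ≠ 0 ∨ 2 ≤ D.l) (t : ℝ) :
    HasWirtinger (fun y => f.u t y 1)
      (Complex.exp (-γ * (t : ℂ)) * (-1 * (D.psiZZ x + D.psiZZbar x)))
      (Complex.exp (-γ * (t : ℂ)) * (-1 * (D.psiZZbar x + D.psiZbarZbar x))) x := by
  have h := (StreamData.hasWirtinger_velocity_one he hx hl).const_mul
    (Complex.exp (-γ * (t : ℂ)))
  refine HasFDerivAt.congr_of_eventuallyEq h ?_
  filter_upwards [hU.mem_nhds hx] with y hy using hf.velocity_eq t y hy 1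

theorem Describes.hasWirtinger_pressure {f : Flow} {γ η : ℂ} (hf : D.Describes f γ η U)
    (hU : IsOpen U) (hx : x ∈ U) (hl : x ≠ 0 ∨ 2 ≤ D.l) (t : ℝ) :
    HasWirtinger (f.p t)
      (Complex.exp (-γ * (t : ℂ)) * (η * D.m ^ 2 *
        (Complex.I * (D.b₁ * (D.l * dz x ^ (D.l - 1))))))
      (Complex.exp (-γ * (t : ℂ)) * (η * D.m ^ 2 *
        (Complex.I * (-D.b₂ * (D.l * dzbar x ^ (D.l - 1)))))) x := by
  have h := ((StreamData.hasWirtinger_pressure hl).const_mul (η * D.m ^ 2)).const_mul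
    (Complex.exp (-γ * (t : ℂ)))
  refine HasFDerivAt.congr_of_eventuallyEq h ?_
  filter_upwards [hU.mem_nhds hx] with y hy using hf.pressure_eq t y hy

/-- Modal flows solve the linearized bulk equations. -/
theorem Describes.solvesBulk {f : Flow} {γ : ℂ} {ρ η : ℝ} {Ω : Set Plane}
    (hf : D.Describes f γ η U) (he : IsWaveFamily D.m D.e U) (hU : IsOpen U) (hΩ : IsOpen Ω)
    (hΩU : closure Ω ⊆ U) (hl : 0 ∉ U ∨ 2 ≤ D.l) (hγ : 0 ≤ γ.re)
    (hdisp : (ρ : ℂ) * γ = η * D.m ^ 2) {K : ℝ} (hK : ∀ x ∈ Ω, ∀ i, ‖D.velocity i x‖ ≤ K)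
    {K' : ℝ} (hK' : ∀ x ∈ Ω, ‖D.pressure x‖ ≤ K') : f.SolvesBulk ρ η Ω := by
  have hΩU' : Ω ⊆ U := subset_closure.trans hΩU
  have hl' : ∀ y ∈ U, y ≠ 0 ∨ 2 ≤ D.l := fun y hy => hl.imp_left fun h h0 => h (h0 ▸ hy)
  have hud : ∀ x ∈ Ω, UniqueDiffWithinAt ℝ Ω x := fun x hx => hΩ.uniqueDiffWithinAt hx
  refine ⟨fun i => ?_, ?_, ⟨K, ?_⟩, ⟨‖(η : ℂ) * D.m ^ 2‖ * K', ?_⟩, ?_, ?_⟩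
  · refine (contDiffOn_exp_mul γ ((contDiffOn_velocity he hU hl i).mono hΩU)).congr ?_
    exact fun q hq => hf.velocity_eq q.1 q.2 (hΩU hq.2) i
  · refine (contDiffOn_exp_mul γ ((contDiffOn_const (c := (η : ℂ) * D.m ^ 2)).mul
      ((contDiffOn_pressure hl).mono hΩU))).congr ?_
    exact fun q hq => hf.pressure_eq q.1 q.2 (hΩU hq.2)
  · intro t ht x hx i
    rw [hf.velocity_eq t x (hΩU' hx) i, norm_mul, ← one_mul K]
    exact mul_le_mul (norm_exp_neg_mul_le_one hγ ht) (hK x hx i) (norm_nonneg _) zero_le_one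
  · intro t ht x hx
    rw [hf.pressure_eq t x (hΩU' hx), norm_mul, norm_mul, ← one_mul (_ * K')]
    exact mul_le_mul (norm_exp_neg_mul_le_one hγ ht)
      (mul_le_mul_of_nonneg_left (hK' x hx) (norm_nonneg _)) (by positivity) zero_le_one
  · intro t _ x hx i
    have hxU := hΩU' hx
    have hd : deriv (fun s => f.u s x i) t =
        -γ * Complex.exp (-γ * (t : ℂ)) * D.velocity i x := by
      have h1 : HasDerivAt (fun s : ℝ => -γ * (s : ℂ)) (-γ * 1) t :=
        ((hasDerivAt_id t).ofReal_comp).const_mul _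
      have h2 := h1.cexp.mul_const (D.velocity i x)
      rw [funext fun s => hf.velocity_eq s x hxU i, h2.deriv]
      ring
    have hp := hf.hasWirtinger_pressure hU hxU (hl' x hxU) t
    have hlap : ∀ i g, HasLaplacian (D.velocity i) g x → Laplacian.laplacian (fun y => f.u t y i) x =
        Complex.exp (-γ * (t : ℂ)) * Laplacian.laplacian (D.velocity i) x := fun i g h => by
      have h3 : (fun y => f.u t y i) =ᶠ[𝓝 x]
          fun y => Complex.exp (-γ * (t : ℂ)) * D.velocity i y := by
        filter_upwards [hU.mem_nhds hxU] with y hy using hf.velocity_eq t y hy i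
      rw [(InnerProductSpace.laplacian_congr_nhds h3).eq_of_nhds,
        (h.const_mul (Complex.exp (-γ * (t : ℂ)))).2, h.2]
    have hz := hasLaplacian_psiZ he hU hxU hl
    have hzb := hasLaplacian_psiZbar he hU hxU hl
    rw [hd]
    fin_cases i
    -- By the dispersion relation the time derivative cancels ηm² times the full velocity. The
    -- Laplacian misses the harmonic part, and that deficit is the pressure gradient.
    · have hv : HasLaplacian (D.velocity 0) _ x := (hz.add (hzb.const_mul (-1))).const_mul Complex.I
      have := hlap 0 _ hv
      simp only [Fin.zero_eta, Fin.isValue] at *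
      rw [this, hv.2, hp.partialWithin_zero (hud x hx)]
      simp only [velocity, Matrix.cons_val_zero]
      linear_combination (-(Complex.exp (-γ * (t : ℂ)) * Complex.I *
        (D.psiZ x + -1 * D.psiZbar x))) * hdisp
    · have hv : HasLaplacian (D.velocity 1) _ x := (hz.add hzb).const_mul (-1)
      have := hlap 1 _ hv
      simp only [Fin.mk_one, Fin.isValue] at *
      rw [this, hv.2, hp.partialWithin_one (hud x hx)]
      simp only [velocity, Matrix.cons_val_one, Matrix.cons_val_zero]
      linear_combination (Complex.exp (-γ * (t : ℂ)) * (D.psiZ x + D.psiZbar x)) * hdisp +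
        Complex.exp (-γ * (t : ℂ)) * η * D.m ^ 2 * D.l * (D.b₁ * dz x ^ (D.l - 1) +
          D.b₂ * dzbar x ^ (D.l - 1)) * Complex.I_sq
  · intro t _ x hx
    have hxU := hΩU' hx
    rw [Fin.sum_univ_two,
      (hf.hasWirtinger_velocity_zero he hU hxU (hl' x hxU) t).partialWithin_zero (hud x hx),
      (hf.hasWirtinger_velocity_one he hU hxU (hl' x hxU) t).partialWithin_one (hud x hx)]
    ring

/-- The symmetric gradient is trace-free and contains only ψ_zz and ψ_z̄z̄; the mixed derivative is
the vorticity part and cancels. -/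
theorem Describes.stress_zero {f : Flow} {γ : ℂ} {η : ℝ} {S : Set Plane}
    (hf : D.Describes f γ η U) (he : IsWaveFamily D.m D.e U) (hU : IsOpen U) (hx : x ∈ U)
    (hl : x ≠ 0 ∨ 2 ≤ D.l) (hS : UniqueDiffWithinAt ℝ S x) (n : Fin 2 → ℝ) (t : ℝ) :
    f.stress η S n t x 0 = Complex.exp (-γ * (t : ℂ)) *
      (-η * (2 * Complex.I * (D.psiZZ x - D.psiZbarZbar x) * n 0 -
        2 * (D.psiZZ x + D.psiZbarZbar x) * n 1) + η * D.m ^ 2 * D.pressure x * n 0) := by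
  have h0 := hf.hasWirtinger_velocity_zero he hU hx hl t
  have h1 := hf.hasWirtinger_velocity_one he hU hx hl t
  rw [Flow.stress, Fin.sum_univ_two, hf.pressure_eq t x hx, h0.partialWithin_zero hS,
    h0.partialWithin_one hS, h1.partialWithin_zero hS]
  linear_combination (-η * Complex.exp (-γ * (t : ℂ)) *
    (D.psiZZ x - 2 * D.psiZZbar x + D.psiZbarZbar x) * n 1) * Complex.I_sq

theorem Describes.stress_one {f : Flow} {γ : ℂ} {η : ℝ} {S : Set Plane}
    (hf : D.Describes f γ η U) (he : IsWaveFamily D.m D.e U) (hU : IsOpen U) (hx : x ∈ U)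
    (hl : x ≠ 0 ∨ 2 ≤ D.l) (hS : UniqueDiffWithinAt ℝ S x) (n : Fin 2 → ℝ) (t : ℝ) :
    f.stress η S n t x 1 = Complex.exp (-γ * (t : ℂ)) *
      (-η * (-2 * (D.psiZZ x + D.psiZbarZbar x) * n 0 -
        2 * Complex.I * (D.psiZZ x - D.psiZbarZbar x) * n 1) +
        η * D.m ^ 2 * D.pressure x * n 1) := by
  have h0 := hf.hasWirtinger_velocity_zero he hU hx hl t
  have h1 := hf.hasWirtinger_velocity_one he hU hx hl t
  rw [Flow.stress, Fin.sum_univ_two, hf.pressure_eq t x hx,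
    h0.partialWithin_one hS, h1.partialWithin_zero hS, h1.partialWithin_one hS]
  linear_combination (-η * Complex.exp (-γ * (t : ℂ)) *
    (D.psiZZ x - 2 * D.psiZZbar x + D.psiZbarZbar x) * n 0) * Complex.I_sq

end StreamData
end Droplet
end

noncomputable section
namespace Droplet
open Filter Topology

/-! ## Polar form of modal flows -/

/-- `x` has the polar coordinates `r > 0` and `q = e^{iθ}`. -/
structure IsPolar (x : Plane) (r : ℝ) (q : ℂ) : Prop where
  pos : 0 < r
  phase_ne_zero : q ≠ 0
  dz_eq : dz x = r * q
  dzbar_eq : dzbar x = r * q⁻¹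
  norm_eq : ‖x‖ = r

theorem IsPolar.ne_zero {x : Plane} {r : ℝ} {q : ℂ} (h : IsPolar x r q) : x ≠ 0 := by
  rintro rfl
  have := h.pos
  rw [← h.norm_eq, norm_zero] at this
  exact this.false

theorem normal_zero_eq (θ : ℝ) : (normal θ 0 : ℂ) =
    (Complex.exp (θ * Complex.I) + (Complex.exp (θ * Complex.I))⁻¹) / 2 := by
  rw [← Complex.exp_neg, ← neg_mul]
  simp [normal, Complex.cos]

theorem normal_one_eq (θ : ℝ) : (normal θ 1 : ℂ) =
    -Complex.I * (Complex.exp (θ * Complex.I) - (Complex.exp (θ * Complex.I))⁻¹) / 2 := by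
  rw [← Complex.exp_neg, ← neg_mul]
  simp [normal, Complex.sin]
  ring

theorem tangent_zero_eq (θ : ℝ) : tangent θ 0 = -normal θ 1 := by simp [tangent, normal]

theorem tangent_one_eq (θ : ℝ) : tangent θ 1 = normal θ 0 := by simp [tangent, normal]

theorem isPolar_interfacePoint {R : ℝ} (hR : 0 < R) (θ : ℝ) :
    IsPolar (interfacePoint R θ) R (Complex.exp (θ * Complex.I)) where
  pos := hR
  phase_ne_zero := Complex.exp_ne_zero _
  dz_eq := by
    rw [dz_apply, Complex.exp_mul_I]
    simp [interfacePoint]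
    ring
  dzbar_eq := by
    rw [dzbar_apply, ← Complex.exp_neg, ← neg_mul, Complex.exp_mul_I]
    simp [interfacePoint]
    ring
  norm_eq := by
    rw [← norm_dz, dz_apply]
    have : ((interfacePoint R θ 0 : ℂ) + Complex.I * (interfacePoint R θ 1 : ℂ)) =
        R * Complex.exp (θ * Complex.I) := by
      rw [Complex.exp_mul_I]
      simp [interfacePoint]
      ring
    rw [this, norm_mul, Complex.norm_exp_ofReal_mul_I, Complex.norm_real, mul_one,
      Real.norm_of_nonneg hR.le]

theorem isPolar_polarAngle {x : Plane} (hx : x ≠ 0) :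
    IsPolar x ‖x‖ (Complex.exp (polarAngle x * Complex.I)) := by
  have hd : dz x = ⟨x 0, x 1⟩ := by
    rw [dz_apply, Complex.mk_eq_add_mul_I]; ring
  have hz : dz x = ‖x‖ * Complex.exp (polarAngle x * Complex.I) := by
    rw [polarAngle, ← hd, ← norm_dz, Complex.norm_mul_exp_arg_mul_I]
  have hr : (‖x‖ : ℂ) ≠ 0 := by exact_mod_cast (norm_pos_iff.2 hx).ne'
  refine ⟨norm_pos_iff.2 hx, Complex.exp_ne_zero _, hz, ?_, rfl⟩
  have := dz_mul_dzbar x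
  rw [hz] at this
  field_simp [Complex.exp_ne_zero]
  exact mul_right_cancel₀ hr (by linear_combination this)

theorem exp_zpow_eq (θ : ℝ) (n : ℕ) : Complex.exp (θ * Complex.I) ^ (n : ℤ) =
    (Real.cos (n * θ) : ℂ) + Complex.I * (Real.sin (n * θ) : ℂ) := by
  rw [zpow_natCast, ← Complex.exp_nat_mul, ← mul_assoc, Complex.exp_mul_I]
  push_cast
  ring

theorem exp_zpow_neg_eq (θ : ℝ) (n : ℕ) : Complex.exp (θ * Complex.I) ^ (-(n : ℤ)) =
    (Real.cos (n * θ) : ℂ) - Complex.I * (Real.sin (n * θ) : ℂ) := by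
  rw [zpow_neg, zpow_natCast, ← Complex.exp_nat_mul, ← Complex.exp_neg, ← mul_assoc, ← neg_mul,
    Complex.exp_mul_I, Complex.cos_neg, Complex.sin_neg]
  push_cast
  ring

/-- The stream function whose cylinder-wave part is `A Z_n(m r) (C cos nθ + D sin nθ)`. -/
def modalStream (m : ℂ) (e : ℤ → Plane → ℂ) (n : ℕ) (l : ℤ) (C D A b₁ b₂ : ℂ) : StreamData where
  m := m
  e := e
  k := n
  l := l
  a₁ := A * ((C - Complex.I * D) / 2)
  a₂ := (-1) ^ n * (A * ((C + Complex.I * D) / 2))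
  b₁ := b₁
  b₂ := b₂

/-- The values of the family `e` at a point with polar coordinates `(r, q)` are those of the
cylinder waves `Z`. -/
def WaveAt (Z : ℤ → ℝ → ℂ) (e : ℤ → Plane → ℂ) (x : Plane) (r : ℝ) (q : ℂ) : Prop :=
  ∀ n, e n x = Z n r * q ^ n

/-- `b₁ z^l + b₂ z̄^l` equals `E r^l (C cos nθ + D sin nθ)`, with harmonic conjugate
`ε E r^l (D cos nθ - C sin nθ)`, where `l = ε n`. -/
structure HarmonicCoeffs (n : ℕ) (l : ℤ) (ε : ℂ) (C D E b₁ b₂ : ℂ) (θ : ℝ) : Prop where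
  sq_eq : ε ^ 2 = 1
  order_eq : (l : ℂ) = ε * n
  sum_eq : b₁ * Complex.exp (θ * Complex.I) ^ l + b₂ * Complex.exp (θ * Complex.I) ^ (-l) =
    E * (C * (Real.cos (n * θ) : ℂ) + D * (Real.sin (n * θ) : ℂ))
  diff_eq : Complex.I * (b₁ * Complex.exp (θ * Complex.I) ^ l -
      b₂ * Complex.exp (θ * Complex.I) ^ (-l)) =
    ε * E * (D * (Real.cos (n * θ) : ℂ) - C * (Real.sin (n * θ) : ℂ))

theorem harmonicCoeffs_inner (n : ℕ) (C D E : ℂ) (θ : ℝ) :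
    HarmonicCoeffs n n 1 C D E (E * ((C - Complex.I * D) / 2)) (E * ((C + Complex.I * D) / 2)) θ where
  sq_eq := by norm_num
  order_eq := by simp
  sum_eq := by
    rw [exp_zpow_eq, exp_zpow_neg_eq]
    linear_combination (-E * D * (Real.sin (n * θ) : ℂ)) * Complex.I_sq
  diff_eq := by
    rw [exp_zpow_eq, exp_zpow_neg_eq]
    linear_combination (E * (C * (Real.sin (n * θ) : ℂ) - D * (Real.cos (n * θ) : ℂ))) *
      Complex.I_sq

theorem harmonicCoeffs_outer (n : ℕ) (C D E : ℂ) (θ : ℝ) :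
    HarmonicCoeffs n (-n) (-1) C D E (E * ((C + Complex.I * D) / 2))
      (E * ((C - Complex.I * D) / 2)) θ where
  sq_eq := by norm_num
  order_eq := by simp
  sum_eq := by
    rw [neg_neg, exp_zpow_eq, exp_zpow_neg_eq]
    linear_combination (-E * D * (Real.sin (n * θ) : ℂ)) * Complex.I_sq
  diff_eq := by
    rw [neg_neg, exp_zpow_eq, exp_zpow_neg_eq]
    linear_combination (-E * (C * (Real.sin (n * θ) : ℂ) - D * (Real.cos (n * θ) : ℂ))) *
      Complex.I_sq

section Polar

variable {m : ℂ} {Z : ℤ → ℝ → ℂ} {e : ℤ → Plane → ℂ} {n : ℕ} {l : ℤ} {C D A E ε b₁ b₂ : ℂ}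
  {x : Plane} {r θ : ℝ}

/-- Explains the factor (-1)^n in the coefficient a₂ of `modalStream`: it turns Z_{-n} into Z_n, and
an order shifted by j leaves the sign (-1)^j. -/
theorem neg_one_pow_mul_reflection (hZ : IsCylinderFamily m Z) (n : ℕ) (j : ℤ) (r : ℝ) :
    (-1 : ℂ) ^ n * Z (-n + j) r = (-1) ^ j * Z (n - j) r := by
  rw [show (-(n : ℤ) + j) = -(n - j) by ring, hZ.reflection, zpow_sub₀ (by norm_num), zpow_natCast,
    ← mul_assoc, ← mul_div_assoc, ← mul_pow]
  norm_num
  left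
  rw [← inv_zpow]; norm_num

/-- The factor e^{iθ} passes to the rotating frame, where the only phases left are e^{±inθ} and
e^{ilθ}. In the three companions the factors e^{-iθ} and e^{±2iθ} do the same. -/
theorem psiZ_polar (hZ : IsCylinderFamily m Z) (hx : IsPolar x r (Complex.exp (θ * Complex.I)))
    (he : WaveAt Z e x r (Complex.exp (θ * Complex.I))) :
    (modalStream m e n l C D A b₁ b₂).psiZ x * Complex.exp (θ * Complex.I) =
      m / 2 * A * ((C - Complex.I * D) / 2 * Z (n - 1) r * Complex.exp (θ * Complex.I) ^ (n : ℤ) -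
        (C + Complex.I * D) / 2 * Z (n + 1) r * Complex.exp (θ * Complex.I) ^ (-(n : ℤ))) +
      l * (r : ℂ) ^ (l - 1) * (b₁ * Complex.exp (θ * Complex.I) ^ l) := by
  have h1 := neg_one_pow_mul_reflection hZ n (-1) r
  have hq := hx.phase_ne_zero
  simp only [StreamData.psiZ, modalStream]
  rw [he, he, hx.dz_eq, mul_zpow]
  set q := Complex.exp (θ * Complex.I)
  have e1 : q ^ ((n : ℤ) - 1) * q = q ^ (n : ℤ) := by rw [← zpow_add_one₀ hq]; congr 1; ring
  have e2 : q ^ (-(n : ℤ) - 1) * q = q ^ (-(n : ℤ)) := by rw [← zpow_add_one₀ hq]; congr 1; ring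
  have e3 : q ^ (l - 1) * q = q ^ l := by rw [← zpow_add_one₀ hq]; congr 1; ring
  rw [show -(n : ℤ) + -1 = -(n : ℤ) - 1 by ring, show (n : ℤ) - -1 = n + 1 by ring] at h1
  norm_num at h1
  rw [← e1, ← e2, ← e3]
  linear_combination (m / 2 * A * ((C + Complex.I * D) / 2) * (q ^ (-(n : ℤ) - 1) * q)) * h1

theorem psiZbar_polar (hZ : IsCylinderFamily m Z)
    (hx : IsPolar x r (Complex.exp (θ * Complex.I)))
    (he : WaveAt Z e x r (Complex.exp (θ * Complex.I))) :
    (modalStream m e n l C D A b₁ b₂).psiZbar x * (Complex.exp (θ * Complex.I))⁻¹ =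
      -(m / 2 * A * ((C - Complex.I * D) / 2 * Z (n + 1) r *
          Complex.exp (θ * Complex.I) ^ (n : ℤ) -
        (C + Complex.I * D) / 2 * Z (n - 1) r * Complex.exp (θ * Complex.I) ^ (-(n : ℤ)))) +
      l * (r : ℂ) ^ (l - 1) * (b₂ * Complex.exp (θ * Complex.I) ^ (-l)) := by
  have h1 := neg_one_pow_mul_reflection hZ n 1 r
  have hq := hx.phase_ne_zero
  simp only [StreamData.psiZbar, modalStream]
  rw [he, he, hx.dzbar_eq, mul_zpow]
  set q := Complex.exp (θ * Complex.I)
  have e1 : q ^ ((n : ℤ) + 1) * q⁻¹ = q ^ (n : ℤ) := by rw [← zpow_sub_one₀ hq]; congr 1; ring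
  have e2 : q ^ (-(n : ℤ) + 1) * q⁻¹ = q ^ (-(n : ℤ)) := by
    rw [← zpow_sub_one₀ hq]; congr 1; ring
  have e3 : q⁻¹ ^ (l - 1) * q⁻¹ = q ^ (-l) := by
    rw [inv_zpow', ← zpow_sub_one₀ hq]; congr 1; ring
  norm_num at h1
  rw [← e1, ← e2, ← e3]
  linear_combination (-m / 2 * A * ((C + Complex.I * D) / 2) * (q ^ (-(n : ℤ) + 1) * q⁻¹)) * h1

theorem psiZZ_polar (hZ : IsCylinderFamily m Z) (hx : IsPolar x r (Complex.exp (θ * Complex.I)))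
    (he : WaveAt Z e x r (Complex.exp (θ * Complex.I))) :
    (modalStream m e n l C D A b₁ b₂).psiZZ x * Complex.exp (θ * Complex.I) ^ 2 =
      (m / 2) ^ 2 * A * ((C - Complex.I * D) / 2 * Z (n - 2) r *
          Complex.exp (θ * Complex.I) ^ (n : ℤ) +
        (C + Complex.I * D) / 2 * Z (n + 2) r * Complex.exp (θ * Complex.I) ^ (-(n : ℤ))) +
      l * (l - 1) * (r : ℂ) ^ (l - 2) * (b₁ * Complex.exp (θ * Complex.I) ^ l) := by
  have h1 := neg_one_pow_mul_reflection hZ n (-2) r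
  have hq := hx.phase_ne_zero
  simp only [StreamData.psiZZ, modalStream]
  rw [he, he, hx.dz_eq, mul_zpow]
  set q := Complex.exp (θ * Complex.I)
  have e0 : ∀ j : ℤ, q ^ (j - 2) * q ^ 2 = q ^ j := fun j => by
    rw [zpow_sub₀ hq]; field_simp
  rw [show -(n : ℤ) + -2 = -(n : ℤ) - 2 by ring, show (n : ℤ) - -2 = n + 2 by ring] at h1
  norm_num at h1
  rw [← e0 n, ← e0 (-n), ← e0 l]
  linear_combination ((m / 2) ^ 2 * A * ((C + Complex.I * D) / 2) * (q ^ (-(n : ℤ) - 2) * q ^ 2)) * h1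

theorem psiZbarZbar_polar (hZ : IsCylinderFamily m Z)
    (hx : IsPolar x r (Complex.exp (θ * Complex.I)))
    (he : WaveAt Z e x r (Complex.exp (θ * Complex.I))) :
    (modalStream m e n l C D A b₁ b₂).psiZbarZbar x * (Complex.exp (θ * Complex.I))⁻¹ ^ 2 =
      (m / 2) ^ 2 * A * ((C - Complex.I * D) / 2 * Z (n + 2) r *
          Complex.exp (θ * Complex.I) ^ (n : ℤ) +
        (C + Complex.I * D) / 2 * Z (n - 2) r * Complex.exp (θ * Complex.I) ^ (-(n : ℤ))) +
      l * (l - 1) * (r : ℂ) ^ (l - 2) * (b₂ * Complex.exp (θ * Complex.I) ^ (-l)) := by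
  have h1 := neg_one_pow_mul_reflection hZ n 2 r
  have hq := hx.phase_ne_zero
  simp only [StreamData.psiZbarZbar, modalStream]
  rw [he, he, hx.dzbar_eq, mul_zpow]
  set q := Complex.exp (θ * Complex.I)
  have e0 : ∀ j : ℤ, q ^ (j + 2) * q⁻¹ ^ 2 = q ^ j := fun j => by
    rw [zpow_add₀ hq]; field_simp
  have e3 : q⁻¹ ^ (l - 2) * q⁻¹ ^ 2 = q ^ (-l) := by
    rw [inv_zpow', ← e0 (-l)]; congr 2; ring
  norm_num at h1
  rw [← e3, ← e0 n, ← e0 (-n)]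
  linear_combination ((m / 2) ^ 2 * A * ((C + Complex.I * D) / 2) *
    (q ^ (-(n : ℤ) + 2) * q⁻¹ ^ 2)) * h1

/-- The radial factor of the radial velocity. -/
def radialFactor (n : ℕ) (l : ℤ) (A E : ℂ) (Z : ℤ → ℝ → ℂ) (r : ℝ) : ℂ :=
  (n : ℂ) / r * (A * Z n r + E * (r : ℂ) ^ l)

/-- The radial factor of the angular velocity. -/
def angularFactor (m : ℂ) (n : ℕ) (l : ℤ) (A E : ℂ) (Z : ℤ → ℝ → ℂ) (r : ℝ) : ℂ :=
  -A * (m * Z (n - 1) r - (n : ℂ) / r * Z n r) - E * l * (r : ℂ) ^ (l - 1)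

theorem IsCylinderFamily.succ_eq (hZ : IsCylinderFamily m Z) (n : ℤ) (hr : 0 < r) :
    m * Z (n + 1) r = 2 * n / r * Z n r - m * Z (n - 1) r := by
  have h := hZ.recurrence n r hr
  have hr' : (r : ℂ) ≠ 0 := by exact_mod_cast hr.ne'
  field_simp
  linear_combination h

theorem radialFactor_eq (n : ℕ) (l : ℤ) (A E : ℂ) (Z : ℤ → ℝ → ℂ) (hr : 0 < r) :
    radialFactor n l A E Z r = A * ((n : ℂ) / r * Z n r) + n * E * (r : ℂ) ^ (l - 1) := by
  have hr' : (r : ℂ) ≠ 0 := by exact_mod_cast hr.ne'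
  rw [radialFactor, zpow_sub_one₀ hr']
  field_simp

/-- With q = e^{iθ} the normal velocity is i(qψ_z - q⁻¹ψ_z̄) = (1/r)∂_θψ, and the recurrence reduces
Z_{n-1} + Z_{n+1} to Z_n. -/
theorem velocity_normal (hZ : IsCylinderFamily m Z) (hx : IsPolar x r (Complex.exp (θ * Complex.I)))
    (he : WaveAt Z e x r (Complex.exp (θ * Complex.I)))
    (hb : HarmonicCoeffs n l ε C D E b₁ b₂ θ) :
    (modalStream m e n l C D A b₁ b₂).velocity 0 x * normal θ 0 +
      (modalStream m e n l C D A b₁ b₂).velocity 1 x * normal θ 1 =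
      (D * (Real.cos (n * θ) : ℂ) - C * (Real.sin (n * θ) : ℂ)) * radialFactor n l A E Z r := by
  have h1 := psiZ_polar (n := n) (l := l) (C := C) (D := D) (A := A) (b₁ := b₁) (b₂ := b₂) hZ hx he
  have h2 := psiZbar_polar (n := n) (l := l) (C := C) (D := D) (A := A) (b₁ := b₁) (b₂ := b₂)
    hZ hx he
  have hs := hZ.succ_eq n hx.pos
  -- With amplitude 1 this is just Euler's formula, trading e^{±inθ} for cosines and sines in the
  -- wave part.
  have hang := (harmonicCoeffs_inner n C D 1 θ).diff_eq
  simp only [StreamData.velocity, Matrix.cons_val_zero, Matrix.cons_val_one]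
  rw [normal_zero_eq, normal_one_eq, radialFactor_eq _ _ _ _ _ hx.pos]
  set q := Complex.exp (θ * Complex.I)
  set F := D * (Real.cos (n * θ) : ℂ) - C * (Real.sin (n * θ) : ℂ)
  linear_combination Complex.I * h1 - Complex.I * h2 +
    (m / 2) * A * (Z (n - 1) r + Z (n + 1) r) * hang + A / 2 * F * hs +
    l * (r : ℂ) ^ (l - 1) * hb.diff_eq + (r : ℂ) ^ (l - 1) * E * F * ε * hb.order_eq +
    (r : ℂ) ^ (l - 1) * E * F * n * hb.sq_eq

/-- The tangential velocity is -(qψ_z + q⁻¹ψ_z̄) = -∂_rψ. -/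
theorem velocity_tangent (hZ : IsCylinderFamily m Z)
    (hx : IsPolar x r (Complex.exp (θ * Complex.I)))
    (he : WaveAt Z e x r (Complex.exp (θ * Complex.I)))
    (hb : HarmonicCoeffs n l ε C D E b₁ b₂ θ) :
    (modalStream m e n l C D A b₁ b₂).velocity 0 x * tangent θ 0 +
      (modalStream m e n l C D A b₁ b₂).velocity 1 x * tangent θ 1 =
      (C * (Real.cos (n * θ) : ℂ) + D * (Real.sin (n * θ) : ℂ)) *
        angularFactor m n l A E Z r := by
  have h1 := psiZ_polar (n := n) (l := l) (C := C) (D := D) (A := A) (b₁ := b₁) (b₂ := b₂) hZ hx he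
  have h2 := psiZbar_polar (n := n) (l := l) (C := C) (D := D) (A := A) (b₁ := b₁) (b₂ := b₂)
    hZ hx he
  have hs := hZ.succ_eq n hx.pos
  have hang := (harmonicCoeffs_inner n C D 1 θ).sum_eq
  simp only [StreamData.velocity, Matrix.cons_val_zero, Matrix.cons_val_one]
  rw [tangent_zero_eq, tangent_one_eq, Complex.ofReal_neg, normal_zero_eq, normal_one_eq,
    angularFactor]
  set q := Complex.exp (θ * Complex.I)
  set G := C * (Real.cos (n * θ) : ℂ) + D * (Real.sin (n * θ) : ℂ)
  set X := (modalStream m e n l C D A b₁ b₂).psiZ x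
  set Y := (modalStream m e n l C D A b₁ b₂).psiZbar x
  linear_combination -h1 - h2 - (m / 2) * A * (Z (n - 1) r - Z (n + 1) r) * hang +
    A / 2 * G * hs - l * (r : ℂ) ^ (l - 1) * hb.sum_eq +
    (X - Y) * (q - q⁻¹) / 2 * Complex.I_sq

theorem velocity_eq_polar (hZ : IsCylinderFamily m Z)
    (hx : IsPolar x r (Complex.exp (θ * Complex.I)))
    (he : WaveAt Z e x r (Complex.exp (θ * Complex.I)))
    (hb : HarmonicCoeffs n l ε C D E b₁ b₂ θ) (i : Fin 2) :
    (modalStream m e n l C D A b₁ b₂).velocity i x =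
      (D * (Real.cos (n * θ) : ℂ) - C * (Real.sin (n * θ) : ℂ)) * radialFactor n l A E Z r *
        normal θ i +
      (C * (Real.cos (n * θ) : ℂ) + D * (Real.sin (n * θ) : ℂ)) *
        angularFactor m n l A E Z r * tangent θ i := by
  rw [← velocity_normal (A := A) hZ hx he hb, ← velocity_tangent (A := A) hZ hx he hb]
  have hone : (normal θ 0 : ℂ) ^ 2 + (normal θ 1 : ℂ) ^ 2 = 1 := by
    rw [normal_zero_eq, normal_one_eq]
    have hq : Complex.exp (θ * Complex.I) * (Complex.exp (θ * Complex.I))⁻¹ = 1 :=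
      mul_inv_cancel₀ (Complex.exp_ne_zero _)
    linear_combination hq + ((Complex.exp (θ * Complex.I) -
      (Complex.exp (θ * Complex.I))⁻¹) ^ 2 / 4) * Complex.I_sq
  rw [tangent_zero_eq, tangent_one_eq, Complex.ofReal_neg]
  fin_cases i
  · simp only [Fin.zero_eta, Fin.isValue, tangent_zero_eq, Complex.ofReal_neg]
    linear_combination -((modalStream m e n l C D A b₁ b₂).velocity 0 x) * hone
  · simp only [Fin.mk_one, Fin.isValue, tangent_one_eq]
    linear_combination -((modalStream m e n l C D A b₁ b₂).velocity 1 x) * hone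

theorem pressure_polar (hx : IsPolar x r (Complex.exp (θ * Complex.I)))
    (hb : HarmonicCoeffs n l ε C D E b₁ b₂ θ) :
    (modalStream m e n l C D A b₁ b₂).pressure x =
      ε * E * (r : ℂ) ^ l * (D * (Real.cos (n * θ) : ℂ) - C * (Real.sin (n * θ) : ℂ)) := by
  have h := hb.diff_eq
  simp only [StreamData.pressure, modalStream]
  rw [hx.dz_eq, hx.dzbar_eq, mul_zpow, mul_zpow, inv_zpow']
  linear_combination (r : ℂ) ^ l * h

/-- The radial factor of the normal stress. -/
def normalStressFactor (η m : ℂ) (n : ℕ) (l : ℤ) (ε A E : ℂ) (Z : ℤ → ℝ → ℂ) (r : ℝ) : ℂ :=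
  -η * (A * (2 * m * n / r * Z (n - 1) r - 2 * (n + 1) * n / (r : ℂ) ^ 2 * Z n r) +
    2 * n * (l - 1) * E * (r : ℂ) ^ (l - 2)) + η * m ^ 2 * ε * E * (r : ℂ) ^ l

/-- The radial factor of the tangential stress. -/
def tangentialStressFactor (η m : ℂ) (n : ℕ) (l : ℤ) (A E : ℂ) (Z : ℤ → ℝ → ℂ) (r : ℝ) : ℂ :=
  -η * (A * (2 * m / r * Z (n - 1) r + (m ^ 2 - 2 * (n + 1) * n / (r : ℂ) ^ 2) * Z n r) -
    2 * l * (l - 1) * E * (r : ℂ) ^ (l - 2))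

/-- Two steps of the recurrence; the stress contains the orders n ± 2, while the system is written
in the orders n and n - 1. -/
theorem IsCylinderFamily.add_two_eq (hZ : IsCylinderFamily m Z) (n : ℤ) (hr : 0 < r) :
    m ^ 2 * Z (n + 2) r = 4 * n * (n + 1) / (r : ℂ) ^ 2 * Z n r - 2 * (n + 1) / r * m * Z (n - 1) r -
      m ^ 2 * Z n r := by
  have h1 := hZ.succ_eq n hr
  have h2 := hZ.succ_eq (n + 1) hr
  rw [show n + 1 + 1 = n + 2 by ring, show n + 1 - 1 = n by ring] at h2
  push_cast at h2
  linear_combination m * h2 + 2 * (n + 1) / r * h1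

theorem IsCylinderFamily.sub_two_eq (hZ : IsCylinderFamily m Z) (n : ℤ) (hr : 0 < r) :
    m ^ 2 * Z (n - 2) r = 2 * (n - 1) / r * m * Z (n - 1) r - m ^ 2 * Z n r := by
  have h2 := hZ.succ_eq (n - 1) hr
  rw [show n - 1 + 1 = n by ring, show n - 1 - 1 = n - 2 by ring] at h2
  push_cast at h2
  linear_combination m * h2

/-- In the rotating frame the second derivatives enter as q²ψ_zz and q⁻²ψ_z̄z̄. Their difference,
with the pressure, is the normal stress (`hN`), and their sum is the tangential stress (`hT`). -/
theorem stress_polar (hZ : IsCylinderFamily m Z)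
    (hx : IsPolar x r (Complex.exp (θ * Complex.I)))
    (he : WaveAt Z e x r (Complex.exp (θ * Complex.I)))
    (hb : HarmonicCoeffs n l ε C D E b₁ b₂ θ) {f : Flow} {γ : ℂ} {η : ℝ} {S U : Set Plane}
    (hf : (modalStream m e n l C D A b₁ b₂).Describes f γ η U)
    (hfam : IsWaveFamily m e U) (hU : IsOpen U) (hxU : x ∈ U)
    (hS : UniqueDiffWithinAt ℝ S x) (t : ℝ) (i : Fin 2) :
    f.stress η S (normal θ) t x i = Complex.exp (-γ * (t : ℂ)) *
      ((D * (Real.cos (n * θ) : ℂ) - C * (Real.sin (n * θ) : ℂ)) *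
        normalStressFactor η m n l ε A E Z r * normal θ i +
      (C * (Real.cos (n * θ) : ℂ) + D * (Real.sin (n * θ) : ℂ)) *
        tangentialStressFactor η m n l A E Z r * tangent θ i) := by
  have h1 := psiZZ_polar (n := n) (l := l) (C := C) (D := D) (A := A) (b₁ := b₁) (b₂ := b₂)
    hZ hx he
  have h2 := psiZbarZbar_polar (n := n) (l := l) (C := C) (D := D) (A := A) (b₁ := b₁) (b₂ := b₂)
    hZ hx he
  have hp := pressure_polar (m := m) (e := e) (A := A) hx hb
  have hs2 := hZ.add_two_eq n hx.pos
  have hs2' := hZ.sub_two_eq n hx.pos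
  have hdiff := (harmonicCoeffs_inner n C D 1 θ).diff_eq
  have hsum := (harmonicCoeffs_inner n C D 1 θ).sum_eq
  have hq : Complex.exp (θ * Complex.I) * (Complex.exp (θ * Complex.I))⁻¹ = 1 :=
    mul_inv_cancel₀ (Complex.exp_ne_zero _)
  have hm : (modalStream m e n l C D A b₁ b₂).m = m := rfl
  set X := (modalStream m e n l C D A b₁ b₂).psiZZ x
  set Y := (modalStream m e n l C D A b₁ b₂).psiZbarZbar x
  set q := Complex.exp (θ * Complex.I) with hq_def
  set F := D * (Real.cos (n * θ) : ℂ) - C * (Real.sin (n * θ) : ℂ)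
  set G := C * (Real.cos (n * θ) : ℂ) + D * (Real.sin (n * θ) : ℂ)
  have hN : -η * (2 * Complex.I * (X * q ^ 2 - Y * q⁻¹ ^ 2)) +
      η * m ^ 2 * (ε * E * (r : ℂ) ^ l * F) = F * normalStressFactor η m n l ε A E Z r := by
    rw [h1, h2, normalStressFactor]
    push_cast at hs2 hs2'
    linear_combination (-η * 2 * ((m / 2) ^ 2 * A * (Z (n - 2) r - Z (n + 2) r))) * hdiff -
      η * 2 * l * (l - 1) * (r : ℂ) ^ (l - 2) * hb.diff_eq - η / 2 * A * F * (hs2' - hs2) -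
      2 * η * (l - 1) * (r : ℂ) ^ (l - 2) * E * F * ε * hb.order_eq -
      2 * η * (l - 1) * (r : ℂ) ^ (l - 2) * E * F * n * hb.sq_eq
  have hT : η * (2 * (X * q ^ 2 + Y * q⁻¹ ^ 2)) =
      G * tangentialStressFactor η m n l A E Z r := by
    rw [h1, h2, tangentialStressFactor]
    push_cast at hs2 hs2'
    linear_combination (η * 2 * ((m / 2) ^ 2 * A * (Z (n - 2) r + Z (n + 2) r))) * hsum +
      η * 2 * l * (l - 1) * (r : ℂ) ^ (l - 2) * hb.sum_eq + η / 2 * A * G * (hs2' + hs2)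
  have hxl : x ≠ 0 ∨ 2 ≤ (modalStream m e n l C D A b₁ b₂).l := Or.inl hx.ne_zero
  rw [← hN, ← hT]
  fin_cases i
  · simp only [Fin.zero_eta, Fin.isValue]
    rw [hf.stress_zero hfam hU hxU hxl hS, hp, hm, tangent_zero_eq, Complex.ofReal_neg,
      normal_zero_eq, normal_one_eq, ← hq_def]
    linear_combination (Complex.exp (-γ * (t : ℂ)) * (2 * η * Complex.I) * (X * q - Y * q⁻¹)) * hq
  · simp only [Fin.mk_one, Fin.isValue]
    rw [hf.stress_one hfam hU hxU hxl hS, hp, hm, tangent_one_eq, normal_zero_eq, normal_one_eq,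
      ← hq_def]
    linear_combination (-(Complex.exp (-γ * (t : ℂ)) * (2 * η) * (X * q + Y * q⁻¹))) * hq -
      Complex.exp (-γ * (t : ℂ)) * η * (q - q⁻¹) * (X - Y + X * q ^ 2 - Y * q⁻¹ ^ 2) * Complex.I_sq

end Polar

end Droplet
end

noncomputable section
namespace Droplet
open Filter Topology

/-! ## First variations -/

/-- No differentiability is required: where g is not differentiable both sides have the default
value 0. -/
theorem deriv_const_add_const_mul (a δ : ℝ) (g : ℝ → ℝ) (s : ℝ) :
    deriv (fun s => a + δ * g s) s = δ * deriv g s := by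
  rw [deriv_const_add, deriv_const_mul_field]

/-- The numerator vanishes at δ = 0, so the denominator contributes only its value R₀ there. -/
theorem velocityVariationReal_eq {R₀ : ℝ} (hR : 0 < R₀) (ζ : ℝ → ℝ → ℝ) (θ t : ℝ) :
    velocityVariationReal R₀ ζ θ t = deriv (fun s => ζ θ s) t := by
  set z := ζ θ t
  set v := deriv (fun s => ζ θ s) t
  set d := deriv (fun φ => ζ φ t) θ
  have hfun : (fun δ : ℝ => normalVelocity (fun φ s => R₀ + δ * ζ φ s) θ t) =
      fun δ => (R₀ + δ * z) * (δ * v) / √((R₀ + δ * z) ^ 2 + (δ * d) ^ 2) := by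
    ext δ
    simp only [normalVelocity, deriv_const_add_const_mul]
    rfl
  have hz : ∀ c : ℝ, HasDerivAt (fun δ : ℝ => δ * c) (1 * c) 0 := fun c =>
    (hasDerivAt_id (0 : ℝ)).mul_const c
  have hnum := ((hz z).const_add R₀).mul (hz v)
  have hden := ((((hz z).const_add R₀).pow 2).add ((hz d).pow 2)).sqrt
    (by simpa using hR.ne')
  have h := hnum.div hden (by simpa [Real.sqrt_sq hR.le] using hR.ne')
  rw [velocityVariationReal, hfun]
  refine (HasDerivAt.deriv h).trans ?_
  simp [Real.sqrt_sq hR.le]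
  field_simp

/-- The slope of ζ enters quadratically, so to first order only ζ and its second angular derivative
survive. -/
theorem curvatureVariationReal_eq {R₀ : ℝ} (hR : 0 < R₀) (ζ : ℝ → ℝ → ℝ) (θ t : ℝ) :
    curvatureVariationReal R₀ ζ θ t =
      (ζ θ t + deriv (deriv fun φ => ζ φ t) θ) / R₀ ^ 2 := by
  set z := ζ θ t
  set d := deriv (fun φ => ζ φ t) θ
  set d2 := deriv (deriv fun φ => ζ φ t) θ
  have hfun : (fun δ : ℝ => curvature (fun φ => R₀ + δ * ζ φ t) θ) =
      fun δ => -(((R₀ + δ * z) ^ 2 + 2 * (δ * d) ^ 2 - (R₀ + δ * z) * (δ * d2)) /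
        ((R₀ + δ * z) ^ 2 + (δ * d) ^ 2) ^ (3 / 2 : ℝ)) := by
    ext δ
    have h1 : deriv (fun φ => R₀ + δ * ζ φ t) = fun φ => δ * deriv (fun φ => ζ φ t) φ := by
      ext φ; rw [deriv_const_add_const_mul]
    simp only [curvature, h1, deriv_const_mul_field]
    rfl
  have hz : ∀ c : ℝ, HasDerivAt (fun δ : ℝ => δ * c) (1 * c) 0 := fun c =>
    (hasDerivAt_id (0 : ℝ)).mul_const c
  have hR1 := (hz z).const_add R₀
  have hnum := ((hR1.pow 2).add (((hz d).pow 2).const_mul 2)).sub (hR1.mul (hz d2))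
  have hden := ((hR1.pow 2).add ((hz d).pow 2)).rpow_const (p := (3 / 2 : ℝ))
    (Or.inl (by simpa using hR.ne'))
  have hpow : (R₀ ^ 2 : ℝ) ^ (3 / 2 : ℝ) = R₀ ^ 3 := by
    rw [← Real.rpow_natCast, ← Real.rpow_mul hR.le, ← Real.rpow_natCast]; norm_num
  have hpow' : (R₀ ^ 2 : ℝ) ^ (3 / 2 - 1 : ℝ) = R₀ := by
    rw [← Real.rpow_natCast, ← Real.rpow_mul hR.le]; norm_num
  have h := (hnum.div hden (by simpa [hpow] using hR.ne')).neg
  rw [curvatureVariationReal, hfun]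
  refine (HasDerivAt.deriv h).trans ?_
  simp [hpow, hpow']
  field_simp
  ring

/-- The angular profile of the interface perturbation. -/
def modeProfile (k : ℕ) (β θ : ℝ) : ℝ :=
  β * Real.cos (k * θ) + √(1 - β ^ 2) * Real.sin (k * θ)

theorem hasDerivAt_cos_nat_mul (k : ℕ) (θ : ℝ) :
    HasDerivAt (fun θ : ℝ => Real.cos (k * θ)) (-(k * Real.sin (k * θ))) θ := by
  convert! ((hasDerivAt_id θ).const_mul (k : ℝ)).cos using 1
  simp; ring

theorem hasDerivAt_sin_nat_mul (k : ℕ) (θ : ℝ) :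
    HasDerivAt (fun θ : ℝ => Real.sin (k * θ)) (k * Real.cos (k * θ)) θ := by
  convert! ((hasDerivAt_id θ).const_mul (k : ℝ)).sin using 1
  simp; ring

theorem deriv_deriv_modeProfile (k : ℕ) (β : ℝ) (θ : ℝ) :
    deriv (deriv (modeProfile k β)) θ = -(k : ℝ) ^ 2 * modeProfile k β θ := by
  have h1 : deriv (modeProfile k β) = fun θ =>
      β * -(k * Real.sin (k * θ)) + √(1 - β ^ 2) * (k * Real.cos (k * θ)) := by
    ext θ
    exact (((hasDerivAt_cos_nat_mul k θ).const_mul β).add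
      ((hasDerivAt_sin_nat_mul k θ).const_mul _)).deriv
  rw [h1]
  refine ((((hasDerivAt_sin_nat_mul k θ).const_mul (k : ℝ)).neg.const_mul β).add
    (((hasDerivAt_cos_nat_mul k θ).const_mul (k : ℝ)).const_mul _)).deriv.trans ?_
  simp only [modeProfile]
  ring

theorem hasDerivAt_exp_neg_mul (γ : ℂ) (t : ℝ) :
    HasDerivAt (fun s : ℝ => Complex.exp (-γ * (s : ℂ))) (-γ * Complex.exp (-γ * (t : ℂ))) t := by
  have h1 : HasDerivAt (fun s : ℝ => -γ * (s : ℂ)) (-γ * 1) t :=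
    ((hasDerivAt_id t).ofReal_comp).const_mul _
  convert! h1.cexp using 1
  ring

theorem modeShape_re (R₀ : ℝ) (k : ℕ) (β : ℝ) (γ : ℂ) (θ t : ℝ) :
    (modeShape R₀ k β γ θ t).re =
      (R₀ * (Complex.exp (-γ * (t : ℂ))).re) * modeProfile k β θ := by
  rw [modeShape, ← Complex.ofReal_mul, Complex.re_ofReal_mul, modeProfile]; ring

theorem modeShape_im (R₀ : ℝ) (k : ℕ) (β : ℝ) (γ : ℂ) (θ t : ℝ) :
    (modeShape R₀ k β γ θ t).im =
      (R₀ * (Complex.exp (-γ * (t : ℂ))).im) * modeProfile k β θ := by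
  rw [modeShape, ← Complex.ofReal_mul, Complex.im_ofReal_mul, modeProfile]; ring

theorem velocityVariation_modeShape {R₀ : ℝ} (hR : 0 < R₀) (k : ℕ) (β : ℝ) (γ : ℂ) (θ t : ℝ) :
    velocityVariation R₀ (modeShape R₀ k β γ) θ t =
      Complex.exp (-γ * (t : ℂ)) * ((modeProfile k β θ : ℂ) * (-γ * R₀)) := by
  have h := hasDerivAt_exp_neg_mul γ t
  have hre := (Complex.reCLM.hasFDerivAt.comp_hasDerivAt t h).const_mul (R₀ * modeProfile k β θ)
  have him := (Complex.imCLM.hasFDerivAt.comp_hasDerivAt t h).const_mul (R₀ * modeProfile k β θ)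
  rw [velocityVariation, velocityVariationReal_eq hR, velocityVariationReal_eq hR]
  have e1 : (fun s => (modeShape R₀ k β γ θ s).re) =
      fun s => R₀ * modeProfile k β θ * (Complex.reCLM ∘ fun s : ℝ => Complex.exp (-γ * (s : ℂ))) s := by
    ext s; rw [modeShape_re]; simp; ring
  have e2 : (fun s => (modeShape R₀ k β γ θ s).im) =
      fun s => R₀ * modeProfile k β θ * (Complex.imCLM ∘ fun s : ℝ => Complex.exp (-γ * (s : ℂ))) s := by
    ext s; rw [modeShape_im]; simp; ring
  rw [e1, e2, hre.deriv, him.deriv]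
  have := Complex.re_add_im (-γ * Complex.exp (-γ * (t : ℂ)))
  simp only [Complex.reCLM_apply, Complex.imCLM_apply, Complex.ofReal_mul]
  linear_combination (R₀ * modeProfile k β θ : ℂ) * this

theorem curvatureVariation_modeShape {R₀ : ℝ} (hR : 0 < R₀) (k : ℕ) (β : ℝ) (γ : ℂ) (θ t : ℝ) :
    curvatureVariation R₀ (modeShape R₀ k β γ) θ t =
      Complex.exp (-γ * (t : ℂ)) * ((modeProfile k β θ : ℂ) * (-((k : ℂ) ^ 2 - 1) * (R₀ : ℂ)⁻¹)) := by
  rw [curvatureVariation, curvatureVariationReal_eq hR, curvatureVariationReal_eq hR]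
  have e : ∀ c θ, deriv (deriv fun φ => c * modeProfile k β φ) θ =
      c * (-(k : ℝ) ^ 2 * modeProfile k β θ) := fun c θ => by
    rw [← deriv_deriv_modeProfile, ← deriv_const_mul_field]
    congr 1
    ext φ
    rw [deriv_const_mul_field]
  simp only [modeShape_re, modeShape_im, e]
  generalize Complex.exp (-γ * (t : ℂ)) = w
  have hR' : (R₀ : ℂ) ≠ 0 := by exact_mod_cast hR.ne'
  conv_rhs => rw [← Complex.re_add_im w]
  push_cast
  field_simp
  ring

end Droplet
end

noncomputable section
namespace Droplet
open Filter Topology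

/-! ## The modal fields as flows with a stream function -/

theorem waveAt_cylinderWave (Z : ℤ → ℝ → ℂ) {x : Plane} {r : ℝ} {q : ℂ} (hx : IsPolar x r q) :
    WaveAt Z (cylinderWave Z) x r q := by
  intro n
  have hr : (r : ℂ) ≠ 0 := by exact_mod_cast hx.pos.ne'
  rw [cylinderWave, hx.norm_eq, hx.dz_eq, mul_div_cancel_left₀ _ hr]

theorem waveAt_besselWave (m : ℂ) {x : Plane} {r : ℝ} {q : ℂ} (hx : IsPolar x r q) :
    WaveAt (fun n r => besselJ n (m * r)) (besselWave m) x r q := by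
  intro n
  rw [besselWave_eq m n hx.ne_zero, waveAt_cylinderWave _ hx]

theorem besselWave_zero (m : ℂ) {n : ℤ} (hn : n ≠ 0) : besselWave m n 0 = 0 := by
  obtain ⟨n, rfl | rfl⟩ := n.eq_nat_or_neg
  · rw [besselWave_natCast, map_zero, zero_pow (by simpa using hn)]; simp
  · rw [besselWave_neg_natCast, map_zero, zero_pow (n := n) (by simpa using hn)]; simp

namespace ModalCoeffs

variable (c : ModalCoeffs) (P : Params)

/-- The stream function of the droplet flow. -/
def dropletStream : StreamData :=
  modalStream c.mD (besselWave c.mD) c.nD c.nD c.CD c.DD c.A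
    (c.E * ((c.CD - Complex.I * c.DD) / 2)) (c.E * ((c.CD + Complex.I * c.DD) / 2))

/-- The stream function of the ambient flow. -/
def ambientStream : StreamData :=
  modalStream c.mA (cylinderWave fun n r => hankel2 n (c.mA * r)) c.nA (-c.nA) c.CA c.DA c.B
    (c.F * ((c.CA + Complex.I * c.DA) / 2)) (c.F * ((c.CA - Complex.I * c.DA) / 2))

/-- The temporal coefficient of the droplet flow. -/
def dropletRate : ℂ := ((P.ηD / P.ρD : ℝ) : ℂ) * c.mD ^ 2

/-- The temporal coefficient of the ambient flow. -/
def ambientRate : ℂ := ((P.ηA / P.ρA : ℝ) : ℂ) * c.mA ^ 2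

theorem describes_droplet :
    c.dropletStream.Describes (c.dropletFlow P) (c.dropletRate P) P.ηD {0}ᶜ where
  velocity_eq t x hx i := by
    have hp := isPolar_polarAngle (show x ≠ 0 from hx)
    rw [dropletStream, velocity_eq_polar (isCylinderFamily_besselJ c.mD) hp
      (waveAt_besselWave c.mD hp) (harmonicCoeffs_inner _ _ _ _ _)]
    simp only [dropletFlow, ofPolar, radialFactor, angularFactor, dropletRate, zpow_natCast,
      Int.cast_natCast]
    ring_nf
  pressure_eq t x hx := by
    have hp := isPolar_polarAngle (show x ≠ 0 from hx)
    rw [dropletStream, pressure_polar hp (harmonicCoeffs_inner _ _ _ _ _)]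
    simp only [dropletFlow, modalStream, dropletRate, zpow_natCast]
    ring_nf

/-- At the centre the polar formula has the value 0: n/0 is 0 by default, and J_{n-1}(0) and 0^{n-1}
vanish because n ≥ 2. The smooth stream-function field also vanishes there, so the modal field is
regular across the centre. -/
theorem describes_droplet_univ (hn : 2 ≤ c.nD) :
    c.dropletStream.Describes (c.dropletFlow P) (c.dropletRate P) P.ηD Set.univ where
  velocity_eq t x _ i := by
    by_cases hx : x = 0
    · subst hx
      have h1 : c.dropletStream.psiZ 0 = 0 := by
        simp only [StreamData.psiZ, dropletStream, modalStream]
        rw [besselWave_zero _ (by omega), besselWave_zero _ (by omega), map_zero,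
          zero_zpow _ (by omega)]
        simp
      have h2 : c.dropletStream.psiZbar 0 = 0 := by
        simp only [StreamData.psiZbar, dropletStream, modalStream]
        rw [besselWave_zero _ (by omega), besselWave_zero _ (by omega), map_zero,
          zero_zpow _ (by omega)]
        simp
      have h3 : c.dropletStream.velocity i 0 = 0 := by
        fin_cases i <;> simp [StreamData.velocity, h1, h2]
      rw [h3]
      simp [dropletFlow, ofPolar, besselJ_zero_arg (n := (c.nD : ℤ) - 1) (by omega),
        zero_zpow ((c.nD : ℤ) - 1) (by omega)]
    · exact (c.describes_droplet P).velocity_eq t x hx i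
  pressure_eq t x _ := by
    by_cases hx : x = 0
    · subst hx
      have h0 : c.nD ≠ 0 := by omega
      simp [dropletFlow, StreamData.pressure, dropletStream, modalStream, h0]
    · exact (c.describes_droplet P).pressure_eq t x hx

theorem describes_ambient (hm : c.mA.im < 0) :
    c.ambientStream.Describes (c.ambientFlow P) (c.ambientRate P) P.ηA {0}ᶜ where
  velocity_eq t x hx i := by
    have hp := isPolar_polarAngle (show x ≠ 0 from hx)
    rw [ambientStream, velocity_eq_polar (isCylinderFamily_hankel2 hm) hp
      (waveAt_cylinderWave _ hp) (harmonicCoeffs_outer _ _ _ _ _)]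
    simp only [ambientFlow, ofPolar, radialFactor, angularFactor, ambientRate, Int.cast_neg,
      Int.cast_natCast]
    ring_nf
  pressure_eq t x hx := by
    have hp := isPolar_polarAngle (show x ≠ 0 from hx)
    rw [ambientStream, pressure_polar hp (harmonicCoeffs_outer _ _ _ _ _)]
    simp only [ambientFlow, modalStream, ambientRate]
    ring_nf

end ModalCoeffs

/-! ## Geometry of the two domains -/

theorem norm_interfacePoint {R : ℝ} (hR : 0 < R) (θ : ℝ) : ‖interfacePoint R θ‖ = R :=
  (isPolar_interfacePoint hR θ).norm_eq

theorem uniqueDiffWithinAt_droplet {R : ℝ} (hR : 0 < R) (θ : ℝ) :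
    UniqueDiffWithinAt ℝ (closure (dropletDomain R)) (interfacePoint R θ) := by
  rw [uniqueDiffWithinAt_closure, dropletDomain]
  refine uniqueDiffWithinAt_convex (convex_ball _ _) ?_ ?_
  · rw [Metric.isOpen_ball.interior_eq]; exact ⟨0, Metric.mem_ball_self hR⟩
  · rw [closure_ball _ hR.ne', mem_closedBall_zero_iff, norm_interfacePoint hR]

/-- The ambient domain is not convex, but the ball of radius R about 2x lies in it and has x on its
boundary. -/
theorem uniqueDiffWithinAt_ambient {R : ℝ} (hR : 0 < R) (θ : ℝ) :
    UniqueDiffWithinAt ℝ (closure (ambientDomain R)) (interfacePoint R θ) := by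
  rw [uniqueDiffWithinAt_closure, ambientDomain]
  set x := interfacePoint R θ
  have hx : ‖x‖ = R := norm_interfacePoint hR θ
  have h : UniqueDiffWithinAt ℝ (Metric.ball ((2 : ℝ) • x) R) x := by
    refine uniqueDiffWithinAt_convex (convex_ball _ _) ?_ ?_
    · rw [Metric.isOpen_ball.interior_eq]; exact ⟨_, Metric.mem_ball_self hR⟩
    · rw [closure_ball _ hR.ne', mem_closedBall_iff_norm', two_smul, add_sub_cancel_right, hx]
  refine h.mono fun y hy => ?_
  have h1 : ‖y - (2 : ℝ) • x‖ < R := by simpa [dist_eq_norm] using hy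
  have h2 : ‖(2 : ℝ) • x‖ = 2 * R := by rw [norm_smul, hx]; norm_num
  have h3 := norm_sub_norm_le ((2 : ℝ) • x) y
  rw [norm_sub_rev] at h3
  simp only [Set.mem_compl_iff, mem_closedBall_zero_iff, not_le]
  linarith

theorem closure_ambientDomain_subset (R : ℝ) :
    closure (ambientDomain R) ⊆ {x | R ≤ ‖x‖} := by
  refine closure_minimal (fun x hx => ?_) (isClosed_le continuous_const continuous_norm)
  simp only [ambientDomain, Set.mem_compl_iff, mem_closedBall_zero_iff, not_le] at hx
  exact hx.le

theorem closure_ambientDomain_subset_compl {R : ℝ} (hR : 0 < R) :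
    closure (ambientDomain R) ⊆ {0}ᶜ := by
  intro x hx h0
  have := closure_ambientDomain_subset R hx
  rw [Set.mem_singleton_iff.1 h0] at this
  simp at this
  linarith

/-! ## Interface values of the modal fields -/

namespace ModalCoeffs

variable (c : ModalCoeffs) (P : Params)

theorem droplet_normal (t θ : ℝ) :
    ∑ i, (c.dropletFlow P).u t (interfacePoint P.R₀ θ) i * (normal θ i : ℂ) =
      Complex.exp (-c.dropletRate P * (t : ℂ)) *
        ((c.DD * (Real.cos (c.nD * θ) : ℂ) - c.CD * (Real.sin (c.nD * θ) : ℂ)) *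
          radialFactor c.nD c.nD c.A c.E (fun n r => besselJ n (c.mD * r)) P.R₀) := by
  have hp := isPolar_interfacePoint P.R₀_pos θ
  rw [← velocity_normal (isCylinderFamily_besselJ c.mD) hp (waveAt_besselWave c.mD hp)
    (harmonicCoeffs_inner _ _ _ _ _), Fin.sum_univ_two,
    (c.describes_droplet P).velocity_eq _ _ hp.ne_zero,
    (c.describes_droplet P).velocity_eq _ _ hp.ne_zero, dropletStream]
  ring

theorem droplet_tangent (t θ : ℝ) :
    ∑ i, (c.dropletFlow P).u t (interfacePoint P.R₀ θ) i * (tangent θ i : ℂ) =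
      Complex.exp (-c.dropletRate P * (t : ℂ)) *
        ((c.CD * (Real.cos (c.nD * θ) : ℂ) + c.DD * (Real.sin (c.nD * θ) : ℂ)) *
          angularFactor c.mD c.nD c.nD c.A c.E (fun n r => besselJ n (c.mD * r)) P.R₀) := by
  have hp := isPolar_interfacePoint P.R₀_pos θ
  rw [← velocity_tangent (isCylinderFamily_besselJ c.mD) hp (waveAt_besselWave c.mD hp)
    (harmonicCoeffs_inner _ _ _ _ _), Fin.sum_univ_two,
    (c.describes_droplet P).velocity_eq _ _ hp.ne_zero,
    (c.describes_droplet P).velocity_eq _ _ hp.ne_zero, dropletStream]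
  ring

theorem droplet_stress (t θ : ℝ) (i : Fin 2) :
    (c.dropletFlow P).stress P.ηD (closure (dropletDomain P.R₀)) (normal θ) t
        (interfacePoint P.R₀ θ) i =
      Complex.exp (-c.dropletRate P * (t : ℂ)) *
        ((c.DD * (Real.cos (c.nD * θ) : ℂ) - c.CD * (Real.sin (c.nD * θ) : ℂ)) *
          normalStressFactor P.ηD c.mD c.nD c.nD 1 c.A c.E (fun n r => besselJ n (c.mD * r)) P.R₀ *
            normal θ i +
        (c.CD * (Real.cos (c.nD * θ) : ℂ) + c.DD * (Real.sin (c.nD * θ) : ℂ)) *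
          tangentialStressFactor P.ηD c.mD c.nD c.nD c.A c.E (fun n r => besselJ n (c.mD * r)) P.R₀ *
            tangent θ i) := by
  have hp := isPolar_interfacePoint P.R₀_pos θ
  exact stress_polar (isCylinderFamily_besselJ c.mD) hp (waveAt_besselWave c.mD hp)
    (harmonicCoeffs_inner _ _ _ _ _) (c.describes_droplet P)
    (fun n x _ => isWaveFamily_besselWave c.mD n x (Set.mem_univ x)) isOpen_compl_singleton
    hp.ne_zero (uniqueDiffWithinAt_droplet P.R₀_pos θ) t i

variable {c}

theorem ambient_normal (hm : c.mA.im < 0) (t θ : ℝ) :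
    ∑ i, (c.ambientFlow P).u t (interfacePoint P.R₀ θ) i * (normal θ i : ℂ) =
      Complex.exp (-c.ambientRate P * (t : ℂ)) *
        ((c.DA * (Real.cos (c.nA * θ) : ℂ) - c.CA * (Real.sin (c.nA * θ) : ℂ)) *
          radialFactor c.nA (-c.nA) c.B c.F (fun n r => hankel2 n (c.mA * r)) P.R₀) := by
  have hp := isPolar_interfacePoint P.R₀_pos θ
  rw [← velocity_normal (isCylinderFamily_hankel2 hm) hp (waveAt_cylinderWave _ hp)
    (harmonicCoeffs_outer _ _ _ _ _), Fin.sum_univ_two,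
    (c.describes_ambient P hm).velocity_eq _ _ hp.ne_zero,
    (c.describes_ambient P hm).velocity_eq _ _ hp.ne_zero, ambientStream]
  ring

theorem ambient_tangent (hm : c.mA.im < 0) (t θ : ℝ) :
    ∑ i, (c.ambientFlow P).u t (interfacePoint P.R₀ θ) i * (tangent θ i : ℂ) =
      Complex.exp (-c.ambientRate P * (t : ℂ)) *
        ((c.CA * (Real.cos (c.nA * θ) : ℂ) + c.DA * (Real.sin (c.nA * θ) : ℂ)) *
          angularFactor c.mA c.nA (-c.nA) c.B c.F (fun n r => hankel2 n (c.mA * r)) P.R₀) := by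
  have hp := isPolar_interfacePoint P.R₀_pos θ
  rw [← velocity_tangent (isCylinderFamily_hankel2 hm) hp (waveAt_cylinderWave _ hp)
    (harmonicCoeffs_outer _ _ _ _ _), Fin.sum_univ_two,
    (c.describes_ambient P hm).velocity_eq _ _ hp.ne_zero,
    (c.describes_ambient P hm).velocity_eq _ _ hp.ne_zero, ambientStream]
  ring

theorem ambient_stress (hm : c.mA.im < 0) (t θ : ℝ) (i : Fin 2) :
    (c.ambientFlow P).stress P.ηA (closure (ambientDomain P.R₀)) (normal θ) t
        (interfacePoint P.R₀ θ) i =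
      Complex.exp (-c.ambientRate P * (t : ℂ)) *
        ((c.DA * (Real.cos (c.nA * θ) : ℂ) - c.CA * (Real.sin (c.nA * θ) : ℂ)) *
          normalStressFactor P.ηA c.mA c.nA (-c.nA) (-1) c.B c.F
            (fun n r => hankel2 n (c.mA * r)) P.R₀ * normal θ i +
        (c.CA * (Real.cos (c.nA * θ) : ℂ) + c.DA * (Real.sin (c.nA * θ) : ℂ)) *
          tangentialStressFactor P.ηA c.mA c.nA (-c.nA) c.B c.F
            (fun n r => hankel2 n (c.mA * r)) P.R₀ * tangent θ i) := by
  have hp := isPolar_interfacePoint P.R₀_pos θ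
  exact stress_polar (isCylinderFamily_hankel2 hm) hp (waveAt_cylinderWave _ hp)
    (harmonicCoeffs_outer _ _ _ _ _) (c.describes_ambient P hm)
    (isCylinderFamily_hankel2 hm).isWaveFamily isOpen_compl_singleton
    hp.ne_zero (uniqueDiffWithinAt_ambient P.R₀_pos θ) t i

/-! ## The bulk equations -/

theorem dropletFlow_solvesBulk (hn : 2 ≤ c.nD) (hre : 0 ≤ (c.mD ^ 2).re) :
    (c.dropletFlow P).SolvesBulk P.ρD P.ηD (dropletDomain P.R₀) := by
  have hl : (0 : Plane) ∉ (Set.univ : Set Plane) ∨ 2 ≤ c.dropletStream.l := Or.inr (by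
    change 2 ≤ (c.nD : ℤ); omega)
  have he : IsWaveFamily c.dropletStream.m c.dropletStream.e Set.univ :=
    isWaveFamily_besselWave c.mD
  have hcpt := isCompact_closedBall (0 : Plane) P.R₀
  have hb := fun i => hcpt.exists_bound_of_continuousOn
    ((StreamData.contDiffOn_velocity he isOpen_univ hl i).continuousOn.mono (Set.subset_univ _))
  obtain ⟨K, hK⟩ := hcpt.exists_bound_of_continuousOn
    ((StreamData.contDiffOn_pressure (D := c.dropletStream) hl).continuousOn.mono
      (Set.subset_univ _))
  obtain ⟨K0, hK0⟩ := hb 0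
  obtain ⟨K1, hK1⟩ := hb 1
  have hρ := P.ρD_pos
  have hη := P.ηD_pos
  refine (c.describes_droplet_univ P hn).solvesBulk he isOpen_univ Metric.isOpen_ball
    (Set.subset_univ _) hl ?_ ?_ (K := max K0 K1) (fun x hx i => ?_)
    (fun x hx => hK x (Metric.ball_subset_closedBall hx))
  · rw [dropletRate, Complex.re_ofReal_mul]; positivity
  · have : (P.ρD : ℂ) ≠ 0 := by exact_mod_cast hρ.ne'
    rw [dropletRate]; push_cast; field_simp; rfl
  · have hx' := Metric.ball_subset_closedBall hx
    fin_cases i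
    · exact (hK0 x hx').trans (le_max_left _ _)
    · exact (hK1 x hx').trans (le_max_right _ _)

end ModalCoeffs

/-! ### Decay at infinity and the ambient bulk equations -/

theorem tendsto_dz_zpow_cocompact {l : ℤ} (hl : l < 0) :
    Tendsto (fun x : Plane => dz x ^ l) (cocompact Plane) (𝓝 0) := by
  rw [tendsto_zero_iff_norm_tendsto_zero]
  simp only [norm_zpow, norm_dz]
  obtain ⟨n, hn⟩ : ∃ n : ℕ, l = -(n : ℤ) := ⟨l.natAbs, by omega⟩
  subst hn
  exact (tendsto_pow_neg_atTop (𝕜 := ℝ) (n := n) (by omega)).comp (tendsto_norm_cocompact_atTop (E := Plane)) |>.congr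
    fun x => by simp

theorem tendsto_dzbar_zpow_cocompact {l : ℤ} (hl : l < 0) :
    Tendsto (fun x : Plane => dzbar x ^ l) (cocompact Plane) (𝓝 0) := by
  have h := tendsto_dz_zpow_cocompact hl
  rw [tendsto_zero_iff_norm_tendsto_zero] at h ⊢
  simpa only [norm_zpow, norm_dz, norm_dzbar] using h

theorem tendsto_exp_mul_atTop_zero {b : ℝ} (hb : b < 0) :
    Tendsto (fun r : ℝ => Real.exp (b * r)) atTop (𝓝 0) :=
  Real.tendsto_exp_atBot.comp (tendsto_id.const_mul_atTop_of_neg hb)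

theorem tendsto_hankel2_atTop (n : ℤ) {m : ℂ} (hm : m.im < 0) :
    Tendsto (fun r : ℝ => hankel2 n (m * r)) atTop (𝓝 0) := by
  obtain ⟨C, _, hC⟩ := exists_norm_hankel2_le n hm one_pos
  refine squeeze_zero_norm' ?_ (by simpa using (tendsto_exp_mul_atTop_zero hm).const_mul C)
  filter_upwards [eventually_ge_atTop 1] with r hr using hC r hr

theorem tendsto_hankelWave_cocompact (n : ℤ) {m : ℂ} (hm : m.im < 0) :
    Tendsto (cylinderWave (fun n r => hankel2 n (m * r)) n) (cocompact Plane) (𝓝 0) := by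
  have h := ((tendsto_hankel2_atTop n hm).norm.comp (tendsto_norm_cocompact_atTop (E := Plane)))
  rw [norm_zero] at h
  refine squeeze_zero_norm' ?_ h
  filter_upwards [(isCompact_singleton (x := (0 : Plane))).compl_mem_cocompact] with x hx
  rw [cylinderWave, norm_mul, norm_zpow, norm_div, norm_dz, Complex.norm_real, norm_norm,
    div_self (norm_ne_zero_iff.2 hx), one_zpow, mul_one]
  rfl

/-- The ambient domain is unbounded: compactness bounds f on the near part and decay on the rest. -/
theorem exists_bound_of_tendsto_cocompact {f : Plane → ℂ} {S : Set Plane} (hS : IsClosed S)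
    (hf : ContinuousOn f S) (hlim : Tendsto f (cocompact Plane) (𝓝 0)) :
    ∃ K, ∀ x ∈ S, ‖f x‖ ≤ K := by
  have h1 : ∀ᶠ x in cocompact Plane, ‖f x‖ ≤ 1 := by
    have := hlim.norm
    rw [norm_zero] at this
    exact this.eventually (ge_mem_nhds one_pos)
  obtain ⟨T, hT, hT'⟩ := mem_cocompact.1 h1
  obtain ⟨K, hK⟩ := (hT.inter_right hS).exists_bound_of_continuousOn (hf.mono Set.inter_subset_right)
  refine ⟨max K 1, fun x hx => ?_⟩
  by_cases hxT : x ∈ T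
  · exact (hK x ⟨hxT, hx⟩).trans (le_max_left _ _)
  · exact (hT' hxT : ‖f x‖ ≤ 1).trans (le_max_right _ _)

namespace ModalCoeffs

variable {c : ModalCoeffs} (P : Params)

theorem tendsto_ambientStream_velocity (hm : c.mA.im < 0) (i : Fin 2) :
    Tendsto (c.ambientStream.velocity i) (cocompact Plane) (𝓝 0) := by
  have hw := fun n => tendsto_hankelWave_cocompact n hm
  have hl : -(c.nA : ℤ) - 1 < 0 := by omega
  have h1 : Tendsto c.ambientStream.psiZ (cocompact Plane) (𝓝 0) := by
    have := ((((hw (c.nA - 1)).const_mul c.ambientStream.a₁).add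
      ((hw (-c.nA - 1)).const_mul c.ambientStream.a₂)).const_mul (c.mA / 2)).add
      ((tendsto_dz_zpow_cocompact hl).const_mul (c.ambientStream.l * c.ambientStream.b₁))
    simp only [mul_zero, add_zero] at this
    exact this
  have h2 : Tendsto c.ambientStream.psiZbar (cocompact Plane) (𝓝 0) := by
    have := ((((hw (c.nA + 1)).const_mul c.ambientStream.a₁).add
      ((hw (-c.nA + 1)).const_mul c.ambientStream.a₂)).const_mul (-(c.mA / 2))).add
      ((tendsto_dzbar_zpow_cocompact hl).const_mul (c.ambientStream.l * c.ambientStream.b₂))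
    simp only [mul_zero, add_zero] at this
    exact this
  fin_cases i
  · have := (h1.add (h2.const_mul (-1))).const_mul Complex.I
    simp only [mul_zero, add_zero] at this
    exact this
  · have := (h1.add h2).const_mul (-1)
    simp only [mul_zero, add_zero] at this
    exact this

/-- Unlike the velocity, whose harmonic part has order -n - 1, the pressure has order -n and decays
only if n ≥ 1. -/
theorem tendsto_ambientStream_pressure (hn : 1 ≤ c.nA) :
    Tendsto c.ambientStream.pressure (cocompact Plane) (𝓝 0) := by
  have hl : -(c.nA : ℤ) < 0 := by omega
  have := (((tendsto_dz_zpow_cocompact hl).const_mul c.ambientStream.b₁).add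
    ((tendsto_dzbar_zpow_cocompact hl).const_mul (-c.ambientStream.b₂))).const_mul Complex.I
  simp only [mul_zero, add_zero] at this
  exact this

theorem ambientFlow_solvesBulk (hm : c.mA.im < 0) (hn : 1 ≤ c.nA) (hre : 0 ≤ (c.mA ^ 2).re) :
    (c.ambientFlow P).SolvesBulk P.ρA P.ηA (ambientDomain P.R₀) := by
  have hl : (0 : Plane) ∉ ({0}ᶜ : Set Plane) ∨ 2 ≤ c.ambientStream.l := Or.inl (by simp)
  have hU : IsOpen ({0}ᶜ : Set Plane) := isOpen_compl_singleton
  have he : IsWaveFamily c.ambientStream.m c.ambientStream.e {0}ᶜ :=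
    (isCylinderFamily_hankel2 hm).isWaveFamily
  have hsub := closure_ambientDomain_subset_compl P.R₀_pos
  have hb := fun i => exists_bound_of_tendsto_cocompact isClosed_closure
    ((StreamData.contDiffOn_velocity he hU hl i).continuousOn.mono hsub)
    (tendsto_ambientStream_velocity hm i)
  obtain ⟨K, hK⟩ := exists_bound_of_tendsto_cocompact isClosed_closure
    ((StreamData.contDiffOn_pressure (D := c.ambientStream) hl).continuousOn.mono hsub)
    (tendsto_ambientStream_pressure hn)
  obtain ⟨K0, hK0⟩ := hb 0
  obtain ⟨K1, hK1⟩ := hb 1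
  have hρ := P.ρA_pos
  have hη := P.ηA_pos
  refine (c.describes_ambient P hm).solvesBulk he hU Metric.isClosed_closedBall.isOpen_compl
    hsub hl ?_ ?_ (K := max K0 K1) (fun x hx i => ?_) (fun x hx => hK x (subset_closure hx))
  · rw [ambientRate, Complex.re_ofReal_mul]; positivity
  · have : (P.ρA : ℂ) ≠ 0 := by exact_mod_cast hρ.ne'
    rw [ambientRate]; push_cast; field_simp; rfl
  · have hx' := subset_closure hx
    fin_cases i
    · exact (hK0 x hx').trans (le_max_left _ _)
    · exact (hK1 x hx').trans (le_max_right _ _)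

theorem eventually_ne_zero_cocompact : ∀ᶠ x in cocompact Plane, x ∈ ({0}ᶜ : Set Plane) :=
  (isCompact_singleton (x := (0 : Plane))).compl_mem_cocompact

theorem tendsto_ambientFlow_velocity (hm : c.mA.im < 0) (t : ℝ) (i : Fin 2) :
    Tendsto (fun x => (c.ambientFlow P).u t x i) (cocompact Plane) (𝓝 0) := by
  have h := (tendsto_ambientStream_velocity hm i).const_mul
    (Complex.exp (-c.ambientRate P * (t : ℂ)))
  rw [mul_zero] at h
  refine h.congr' ?_
  filter_upwards [eventually_ne_zero_cocompact] with x hx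
  exact ((c.describes_ambient P hm).velocity_eq t x hx i).symm

theorem tendsto_ambientFlow_pressure (hm : c.mA.im < 0) (hn : 1 ≤ c.nA) (t : ℝ) :
    Tendsto ((c.ambientFlow P).p t) (cocompact Plane) (𝓝 0) := by
  have h := ((tendsto_ambientStream_pressure hn).const_mul
    ((P.ηA : ℂ) * c.ambientStream.m ^ 2)).const_mul (Complex.exp (-c.ambientRate P * (t : ℂ)))
  rw [mul_zero, mul_zero] at h
  refine h.congr' ?_
  filter_upwards [eventually_ne_zero_cocompact] with x hx
  exact ((c.describes_ambient P hm).pressure_eq t x hx).symm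

end ModalCoeffs

end Droplet
end

noncomputable section
namespace Droplet
open Filter Topology

theorem forall_fin_five {p : Fin 5 → Prop} : (∀ i, p i) ↔ p 0 ∧ p 1 ∧ p 2 ∧ p 3 ∧ p 4 :=
  ⟨fun h => ⟨h 0, h 1, h 2, h 3, h 4⟩, fun ⟨h0, h1, h2, h3, h4⟩ i => by
    fin_cases i <;> assumption⟩

/-! ## The interface conditions as a linear system -/

/-- The rows are two normal velocities, then the differences of tangential velocity, normal stress
and tangential stress, taken as droplet minus ambient. This is the opposite of the jump, hence the
positive capillary term in the right-hand side. -/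
theorem dispersionMatrix_mulVec (P : Params) (k : ℕ) (mD mA : ℂ) (v : Fin 4 → ℂ) :
    (dispersionMatrix P k mD mA).mulVec v =
      ![radialFactor k k (v 0) (v 2) (fun n r => besselJ n (mD * r)) P.R₀,
        radialFactor k (-k) (v 1) (v 3) (fun n r => hankel2 n (mA * r)) P.R₀,
        angularFactor mD k k (v 0) (v 2) (fun n r => besselJ n (mD * r)) P.R₀ -
          angularFactor mA k (-k) (v 1) (v 3) (fun n r => hankel2 n (mA * r)) P.R₀,
        normalStressFactor P.ηD mD k k 1 (v 0) (v 2) (fun n r => besselJ n (mD * r)) P.R₀ -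
          normalStressFactor P.ηA mA k (-k) (-1) (v 1) (v 3) (fun n r => hankel2 n (mA * r)) P.R₀,
        tangentialStressFactor P.ηD mD k k (v 0) (v 2) (fun n r => besselJ n (mD * r)) P.R₀ -
          tangentialStressFactor P.ηA mA k (-k) (v 1) (v 3) (fun n r => hankel2 n (mA * r))
            P.R₀] := by
  have h2 : (P.R₀ : ℂ) ^ (-2 : ℤ) = ((P.R₀ : ℂ) ^ 2)⁻¹ := by rw [zpow_neg]; norm_cast
  rw [funext_iff, forall_fin_five, radialFactor_eq _ _ _ _ _ P.R₀_pos,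
    radialFactor_eq _ _ _ _ _ P.R₀_pos]
  simp only [dispersionMatrix, Matrix.mulVec, dotProduct, Fin.sum_univ_four,
    angularFactor, normalStressFactor, tangentialStressFactor, h2, Matrix.of_apply,
    Matrix.cons_val, Int.cast_neg, Int.cast_natCast, zpow_natCast, div_eq_mul_inv]
  exact ⟨by ring, by ring, by ring, by ring, by ring⟩

theorem dispersion_system_iff (P : Params) (k : ℕ) (γ mD mA : ℂ) (v : Fin 4 → ℂ) :
    (dispersionMatrix P k mD mA).mulVec v = dispersionRhs P k γ ↔
      radialFactor k k (v 0) (v 2) (fun n r => besselJ n (mD * r)) P.R₀ = -γ * P.R₀ ∧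
      radialFactor k (-k) (v 1) (v 3) (fun n r => hankel2 n (mA * r)) P.R₀ = -γ * P.R₀ ∧
      angularFactor mA k (-k) (v 1) (v 3) (fun n r => hankel2 n (mA * r)) P.R₀ =
        angularFactor mD k k (v 0) (v 2) (fun n r => besselJ n (mD * r)) P.R₀ ∧
      normalStressFactor P.ηA mA k (-k) (-1) (v 1) (v 3) (fun n r => hankel2 n (mA * r)) P.R₀ -
          normalStressFactor P.ηD mD k k 1 (v 0) (v 2) (fun n r => besselJ n (mD * r)) P.R₀ =
        P.σ * (-((k : ℂ) ^ 2 - 1) * (P.R₀ : ℂ)⁻¹) ∧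
      tangentialStressFactor P.ηA mA k (-k) (v 1) (v 3) (fun n r => hankel2 n (mA * r)) P.R₀ =
        tangentialStressFactor P.ηD mD k k (v 0) (v 2) (fun n r => besselJ n (mD * r)) P.R₀ := by
  rw [dispersionMatrix_mulVec, funext_iff, forall_fin_five]
  simp only [dispersionRhs, Matrix.cons_val]
  refine and_congr Iff.rfl (and_congr Iff.rfl (and_congr ?_ (and_congr ?_ ?_)))
  · constructor <;> intro h <;> linear_combination -h
  · constructor <;> intro h <;> linear_combination -h
  · constructor <;> intro h <;> linear_combination -h

/-- The values at angle 0 and after a quarter period are β and √(1 - β²), which are not both 0. The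
conjugate profile takes the same two numbers up to sign. -/
theorem exists_modeProfile_ne_zero {k : ℕ} (hk : k ≠ 0) {β : ℝ} :
    ∃ θ, modeProfile k β θ ≠ 0 := by
  have hk' : (k : ℝ) ≠ 0 := by exact_mod_cast hk
  by_cases h : β = 0
  · refine ⟨Real.pi / 2 / k, ?_⟩
    rw [modeProfile, mul_div_cancel₀ _ hk', h]; simp
  · exact ⟨0, by simpa [modeProfile] using h⟩

/-- The angular profile conjugate to `modeProfile`. -/
def modeConjugate (k : ℕ) (β θ : ℝ) : ℝ :=
  -√(1 - β ^ 2) * Real.cos (k * θ) + β * Real.sin (k * θ)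

theorem exists_modeConjugate_ne_zero {k : ℕ} (hk : k ≠ 0) {β : ℝ} :
    ∃ θ, modeConjugate k β θ ≠ 0 := by
  have hk' : (k : ℝ) ≠ 0 := by exact_mod_cast hk
  by_cases h : β = 0
  · exact ⟨0, by simp [modeConjugate, h]⟩
  · refine ⟨Real.pi / 2 / k, ?_⟩
    rw [modeConjugate, mul_div_cancel₀ _ hk']; simpa using h

theorem normal_tangent_combination {a b : ℂ} {θ : ℝ}
    (h : ∀ i, a * (normal θ i : ℂ) + b * (tangent θ i : ℂ) = 0) : a = 0 ∧ b = 0 := by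
  have h0 := h 0
  have h1 := h 1
  rw [tangent_zero_eq, Complex.ofReal_neg] at h0
  rw [tangent_one_eq] at h1
  have hone : (normal θ 0 : ℂ) ^ 2 + (normal θ 1 : ℂ) ^ 2 = 1 := by
    have : normal θ 0 ^ 2 + normal θ 1 ^ 2 = 1 := by simp [normal]
    exact_mod_cast this
  constructor
  · linear_combination (normal θ 0 : ℂ) * h0 + (normal θ 1 : ℂ) * h1 - a * hone
  · linear_combination -(normal θ 1 : ℂ) * h0 + (normal θ 0 : ℂ) * h1 - b * hone

/-- The normalized modal fields solve the linearized problem precisely if their coefficients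
solve the linear system. -/
theorem normalizedCoeffs_isResponse_iff (P : Params) {k : ℕ} (hk : 2 ≤ k) {β : ℝ}
    {γ : ℂ} (hγ : 0 ≤ γ.re) {mD mA : ℂ} (hD : ((P.ηD / P.ρD : ℝ) : ℂ) * mD ^ 2 = γ)
    (hA : ((P.ηA / P.ρA : ℝ) : ℂ) * mA ^ 2 = γ) (hm : mA.im < 0) (v : Fin 4 → ℂ) :
    (normalizedCoeffs k β mD mA v).IsResponse P k β γ ↔
      (dispersionMatrix P k mD mA).mulVec v = dispersionRhs P k γ := by
  have hreD : 0 ≤ (mD ^ 2).re := by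
    rw [← hD, Complex.re_ofReal_mul] at hγ
    exact nonneg_of_mul_nonneg_right hγ (div_pos P.ηD_pos P.ρD_pos)
  have hreA : 0 ≤ (mA ^ 2).re := by
    rw [← hA, Complex.re_ofReal_mul] at hγ
    exact nonneg_of_mul_nonneg_right hγ (div_pos P.ηA_pos P.ρA_pos)
  set c := normalizedCoeffs k β mD mA v with hc
  have hrD : c.dropletRate P = γ := hD
  have hrA : c.ambientRate P = γ := hA
  have hmA : c.mA.im < 0 := hm
  have hF : ∀ θ : ℝ, (β : ℂ) * (Real.cos (k * θ) : ℂ) -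
      -(√(1 - β ^ 2) : ℂ) * (Real.sin (k * θ) : ℂ) = modeProfile k β θ := fun θ => by
    simp only [modeProfile]; push_cast; ring
  have hG : ∀ θ : ℝ, -(√(1 - β ^ 2) : ℂ) * (Real.cos (k * θ) : ℂ) +
      (β : ℂ) * (Real.sin (k * θ) : ℂ) = modeConjugate k β θ := fun θ => by
    simp only [modeConjugate]; push_cast; ring
  rw [dispersion_system_iff, ModalCoeffs.IsResponse]
  set rD := radialFactor k k (v 0) (v 2) (fun n r => besselJ n (mD * r)) P.R₀
  set rA := radialFactor k (-k) (v 1) (v 3) (fun n r => hankel2 n (mA * r)) P.R₀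
  set aD := angularFactor mD k k (v 0) (v 2) (fun n r => besselJ n (mD * r)) P.R₀
  set aA := angularFactor mA k (-k) (v 1) (v 3) (fun n r => hankel2 n (mA * r)) P.R₀
  set ND := normalStressFactor P.ηD mD k k 1 (v 0) (v 2) (fun n r => besselJ n (mD * r)) P.R₀
  set NA := normalStressFactor P.ηA mA k (-k) (-1) (v 1) (v 3) (fun n r => hankel2 n (mA * r)) P.R₀
  set TD := tangentialStressFactor P.ηD mD k k (v 0) (v 2) (fun n r => besselJ n (mD * r)) P.R₀
  set TA := tangentialStressFactor P.ηA mA k (-k) (v 1) (v 3) (fun n r => hankel2 n (mA * r)) P.R₀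
  have hDn : ∀ t θ : ℝ, ∑ i, (c.dropletFlow P).u t (interfacePoint P.R₀ θ) i * (normal θ i : ℂ) =
      Complex.exp (-γ * (t : ℂ)) * (modeProfile k β θ * rD) := fun t θ => by
    rw [← hF, ← hrD]; exact c.droplet_normal P t θ
  have hDt : ∀ t θ : ℝ, ∑ i, (c.dropletFlow P).u t (interfacePoint P.R₀ θ) i * (tangent θ i : ℂ) =
      Complex.exp (-γ * (t : ℂ)) * (modeConjugate k β θ * aD) := fun t θ => by
    rw [← hG, ← hrD]; exact c.droplet_tangent P t θ
  have hDs : ∀ (t θ : ℝ) i, (c.dropletFlow P).stress P.ηD (closure (dropletDomain P.R₀)) (normal θ) t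
        (interfacePoint P.R₀ θ) i = Complex.exp (-γ * (t : ℂ)) *
      (modeProfile k β θ * ND * normal θ i + modeConjugate k β θ * TD * tangent θ i) :=
    fun t θ i => by rw [← hF, ← hG, ← hrD]; exact c.droplet_stress P t θ i
  have hAn : ∀ t θ : ℝ, ∑ i, (c.ambientFlow P).u t (interfacePoint P.R₀ θ) i * (normal θ i : ℂ) =
      Complex.exp (-γ * (t : ℂ)) * (modeProfile k β θ * rA) := fun t θ => by
    rw [← hF, ← hrA]; exact ModalCoeffs.ambient_normal P hmA t θ
  have hAt : ∀ t θ : ℝ, ∑ i, (c.ambientFlow P).u t (interfacePoint P.R₀ θ) i * (tangent θ i : ℂ) =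
      Complex.exp (-γ * (t : ℂ)) * (modeConjugate k β θ * aA) := fun t θ => by
    rw [← hG, ← hrA]; exact ModalCoeffs.ambient_tangent P hmA t θ
  have hAs : ∀ (t θ : ℝ) i, (c.ambientFlow P).stress P.ηA (closure (ambientDomain P.R₀)) (normal θ) t
        (interfacePoint P.R₀ θ) i = Complex.exp (-γ * (t : ℂ)) *
      (modeProfile k β θ * NA * normal θ i + modeConjugate k β θ * TA * tangent θ i) :=
    fun t θ i => by rw [← hF, ← hG, ← hrA]; exact ModalCoeffs.ambient_stress P hmA t θ i
  have hV := velocityVariation_modeShape P.R₀_pos k β γ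
  have hκ := curvatureVariation_modeShape P.R₀_pos k β γ
  constructor
  · intro h
    -- All terms share the factor e^{-γt} and one of two angular profiles, so a single time and one
    -- angle where the profile is nonzero give back the scalar equations.
    obtain ⟨θf, hθf⟩ := exists_modeProfile_ne_zero (k := k) (by omega) (β := β)
    obtain ⟨θg, hθg⟩ := exists_modeConjugate_ne_zero (k := k) (by omega) (β := β)
    have hθf' : (modeProfile k β θf : ℂ) ≠ 0 := by exact_mod_cast hθf
    have hθg' : (modeConjugate k β θg : ℂ) ≠ 0 := by exact_mod_cast hθg
    have he : Complex.exp (-γ * ((1 : ℝ) : ℂ)) ≠ 0 := Complex.exp_ne_zero _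
    have h1 := h.kinematic_droplet 1 one_pos θf
    have h2 := h.kinematic_ambient 1 one_pos θf
    have h3 := h.tangential 1 one_pos θg
    rw [hDn, hV] at h1
    rw [hAn, hV] at h2
    rw [hDt, hAt] at h3
    have hdyn : ∀ θ, (modeProfile k β θ : ℂ) * (NA - ND -
        P.σ * (-((k : ℂ) ^ 2 - 1) * (P.R₀ : ℂ)⁻¹)) = 0 ∧
        (modeConjugate k β θ : ℂ) * (TA - TD) = 0 := fun θ => by
      refine normal_tangent_combination (θ := θ) fun i => ?_
      have h4 := h.dynamic 1 one_pos θ i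
      rw [hDs, hAs, hκ] at h4
      refine mul_left_cancel₀ he ?_
      linear_combination h4
    refine ⟨mul_left_cancel₀ hθf' (mul_left_cancel₀ he h1),
      mul_left_cancel₀ hθf' (mul_left_cancel₀ he h2), ?_, ?_, ?_⟩
    · refine mul_left_cancel₀ hθg' (mul_left_cancel₀ he ?_)
      linear_combination h3
    · exact sub_eq_zero.1 ((mul_eq_zero.1 (hdyn θf).1).resolve_left hθf')
    · exact sub_eq_zero.1 ((mul_eq_zero.1 (hdyn θg).2).resolve_left hθg')
  · rintro ⟨h1, h2, h3, h4, h5⟩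
    refine ⟨ModalCoeffs.dropletFlow_solvesBulk P hk hreD,
      ModalCoeffs.ambientFlow_solvesBulk P hmA (show 1 ≤ k by omega) hreA,
      fun t _ i => ModalCoeffs.tendsto_ambientFlow_velocity P hmA t i,
      fun t _ => ModalCoeffs.tendsto_ambientFlow_pressure P hmA (show 1 ≤ k by omega) t,
      fun t _ θ => ?_, fun t _ θ => ?_, fun t _ θ => ?_, fun t _ θ i => ?_⟩
    · rw [hDn, hV, h1]
    · rw [hAn, hV, h2]
    · rw [hDt, hAt, h3, sub_self]
    · rw [hDs, hAs, hκ]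
      linear_combination Complex.exp (-γ * (t : ℂ)) * (modeProfile k β θ * normal θ i * h4 +
        modeConjugate k β θ * tangent θ i * h5)

end Droplet
end

noncomputable section
namespace Droplet
open Filter Topology ComplexConjugate

/-! ## Uniqueness: an energy argument for the radial profiles -/

/-- The radial profile of the stream function. -/
def radialProfile (n : ℕ) (l : ℤ) (A E : ℂ) (Z : ℤ → ℝ → ℂ) (r : ℝ) : ℂ :=
  A * Z n r + E * (r : ℂ) ^ l

/-- The logarithmic derivative `r Υ'(r)` of the radial profile `Υ`. -/
def radialSlope (m : ℂ) (n : ℕ) (l : ℤ) (A E : ℂ) (Z : ℤ → ℝ → ℂ) (r : ℝ) : ℂ :=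
  A * (m * r * Z (n - 1) r - n * Z n r) + l * E * (r : ℂ) ^ l

/-- The energy flux through the circle of radius `r`, up to real constants. -/
def energyFlux (κ m : ℂ) (n : ℕ) (l : ℤ) (A E : ℂ) (Z : ℤ → ℝ → ℂ) (r : ℝ) : ℂ :=
  κ * (l * E * (r : ℂ) ^ l * conj (radialProfile n l A E Z r) +
    A * Z n r * conj (radialSlope m n l A E Z r))

section

variable {m : ℂ} {Z : ℤ → ℝ → ℂ} {n : ℕ} {l : ℤ} {A E : ℂ} {r : ℝ}

theorem hasDerivAt_ofReal_zpow (l : ℤ) (hr : 0 < r) :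
    HasDerivAt (fun r : ℝ => (r : ℂ) ^ l) (l / r * (r : ℂ) ^ l) r := by
  have hr' : (r : ℂ) ≠ 0 := by exact_mod_cast hr.ne'
  have h := (hasDerivAt_zpow l (r : ℂ) (Or.inl hr')).comp_ofReal
  convert! h using 1
  rw [zpow_sub_one₀ hr']; ring

theorem IsCylinderFamily.hasDerivAt_pred (hZ : IsCylinderFamily m Z) (n : ℤ) (hr : 0 < r) :
    HasDerivAt (Z n) (m * Z (n - 1) r - n / r * Z n r) r := by
  convert! hZ.hasDerivAt n r hr using 1
  linear_combination (1 / 2 : ℂ) * hZ.succ_eq n hr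

theorem IsCylinderFamily.hasDerivAt_succ (hZ : IsCylinderFamily m Z) (n : ℤ) (hr : 0 < r) :
    HasDerivAt (Z (n - 1)) ((n - 1) / r * Z (n - 1) r - m * Z n r) r := by
  convert! hZ.hasDerivAt (n - 1) r hr using 1
  have h := hZ.succ_eq (n - 1) hr
  rw [show n - 1 + 1 = n by ring] at h ⊢
  push_cast at h
  linear_combination (-1 / 2 : ℂ) * h

theorem hasDerivAt_radialProfile (hZ : IsCylinderFamily m Z) (hr : 0 < r) :
    HasDerivAt (radialProfile n l A E Z) (radialSlope m n l A E Z r / r) r := by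
  have hr' : (r : ℂ) ≠ 0 := by exact_mod_cast hr.ne'
  convert! ((hZ.hasDerivAt_pred n hr).const_mul A).add
    ((hasDerivAt_ofReal_zpow l hr).const_mul E) using 1
  rw [radialSlope]
  push_cast
  field_simp

/-- Bessel's equation for the cylinder part and Euler's equation for the power part, whose exponent
satisfies l² = n². -/
theorem hasDerivAt_radialSlope (hZ : IsCylinderFamily m Z) (hl : l ^ 2 = (n : ℤ) ^ 2) (hr : 0 < r) :
    HasDerivAt (radialSlope m n l A E Z)
      ((n : ℂ) ^ 2 / r * radialProfile n l A E Z r - m ^ 2 * r * (A * Z n r)) r := by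
  have hr' : (r : ℂ) ≠ 0 := by exact_mod_cast hr.ne'
  have hl' : (l : ℂ) ^ 2 = (n : ℂ) ^ 2 := by exact_mod_cast hl
  have h1 : HasDerivAt (fun r : ℝ => m * (r : ℂ)) (m * 1) r :=
    ((hasDerivAt_id r).ofReal_comp).const_mul m
  convert! (((h1.mul (hZ.hasDerivAt_succ n hr)).sub
    ((hZ.hasDerivAt_pred n hr).const_mul (n : ℂ))).const_mul A).add
    ((hasDerivAt_ofReal_zpow l hr).const_mul (l * E)) using 1
  rw [radialProfile]
  push_cast
  field_simp
  linear_combination (-(E * (r : ℂ) ^ l)) * hl'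

theorem hasDerivAt_conj {f : ℝ → ℂ} {f' : ℂ} (h : HasDerivAt f f' r) :
    HasDerivAt (fun r => conj (f r)) (conj f') r := by
  exact Complex.conjCLE.toContinuousLinearMap.hasFDerivAt.comp_hasDerivAt r h

/-- Write P, Q for the power and cylinder parts, Y = P + Q and S = rY'. The derivative of rP'Ȳ is
(n²PȲ + rP'S̄)/r, that of QS̄ is (rQ'S̄ + n²QȲ)/r - conj(m²)r|Q|². The mixed terms add up to n²|Y|²
and |S|²; this is why P is paired with Y and Q with S. -/
theorem hasDerivAt_energyFlux (hZ : IsCylinderFamily m Z) (hl : l ^ 2 = (n : ℤ) ^ 2) (hr : 0 < r)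
    (κ : ℂ) :
    HasDerivAt (energyFlux κ m n l A E Z)
      (κ * (((n : ℝ) ^ 2 * ‖radialProfile n l A E Z r‖ ^ 2 + ‖radialSlope m n l A E Z r‖ ^ 2) / r : ℝ)
        - κ * conj (m ^ 2) * (r * ‖A * Z n r‖ ^ 2 : ℝ)) r := by
  have hr' : (r : ℂ) ≠ 0 := by exact_mod_cast hr.ne'
  have hl' : (l : ℂ) ^ 2 = (n : ℂ) ^ 2 := by exact_mod_cast hl
  have hY := hasDerivAt_conj (hasDerivAt_radialProfile (n := n) (l := l) (A := A) (E := E) hZ hr)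
  have hS := hasDerivAt_conj (hasDerivAt_radialSlope (n := n) (l := l) (A := A) (E := E) hZ hl hr)
  have hQ := (hZ.hasDerivAt_pred n hr).const_mul A
  have hP := (hasDerivAt_ofReal_zpow l hr).const_mul (l * E)
  convert! ((hP.mul hY).add (hQ.mul hS)).const_mul κ using 1
  have e1 : A * (m * Z (n - 1) r - ((n : ℤ) : ℂ) / r * Z n r) =
      (radialSlope m n l A E Z r - l * E * (r : ℂ) ^ l) / r := by
    rw [radialSlope]; push_cast; field_simp; ring
  have e2 : A * Z n r = radialProfile n l A E Z r - E * (r : ℂ) ^ l := by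
    rw [radialProfile]; ring
  have e3 : ((‖A * Z n r‖ ^ 2 : ℝ) : ℂ) = A * Z n r * conj (A * Z n r) := by
    rw [Complex.mul_conj, Complex.normSq_eq_norm_sq]
  have e4 : ((‖radialProfile n l A E Z r‖ ^ 2 : ℝ) : ℂ) =
      radialProfile n l A E Z r * conj (radialProfile n l A E Z r) := by
    rw [Complex.mul_conj, Complex.normSq_eq_norm_sq]
  have e5 : ((‖radialSlope m n l A E Z r‖ ^ 2 : ℝ) : ℂ) =
      radialSlope m n l A E Z r * conj (radialSlope m n l A E Z r) := by
    rw [Complex.mul_conj, Complex.normSq_eq_norm_sq]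
  rw [e1, Complex.ofReal_div, Complex.ofReal_add, Complex.ofReal_mul, Complex.ofReal_mul, e3, e4, e5]
  generalize radialSlope m n l A E Z r = S
  generalize radialProfile n l A E Z r = Y at *
  generalize A * Z n r = Q at *
  simp only [map_sub, map_mul, map_div₀, map_pow, Complex.conj_ofReal, map_natCast]
  field_simp
  push_cast
  linear_combination (-κ * n ^ 2 * conj Y) * e2 - κ * E * (r : ℂ) ^ l * conj Y * hl'

/-- Since ργ = ηm², the coefficient ργ · conj(m²) = η|m²|² is real and its term drops out; the rest
is Im γ times a nonnegative quantity. -/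
theorem hasDerivAt_energyFlux_im (hZ : IsCylinderFamily m Z) (hl : l ^ 2 = (n : ℤ) ^ 2)
    {ρ η : ℝ} {γ : ℂ} (hγ : (ρ : ℂ) * γ = η * m ^ 2) (hr : 0 < r) :
    HasDerivAt (fun r => (energyFlux (ρ * γ) m n l A E Z r).im)
      (γ.im * (ρ * (((n : ℝ) ^ 2 * ‖radialProfile n l A E Z r‖ ^ 2 +
        ‖radialSlope m n l A E Z r‖ ^ 2) / r))) r := by
  have h := Complex.imCLM.hasFDerivAt.comp_hasDerivAt r
    (hasDerivAt_energyFlux (A := A) (E := E) hZ hl hr (ρ * γ))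
  have hreal : (ρ : ℂ) * γ * conj (m ^ 2) = ((η * ‖m ^ 2‖ ^ 2 : ℝ) : ℂ) := by
    rw [hγ, mul_assoc, Complex.mul_conj, Complex.normSq_eq_norm_sq, ← Complex.ofReal_mul]
  rw [hreal, ← Complex.ofReal_mul] at h
  convert! h using 1
  rw [Complex.imCLM_apply, Complex.sub_im, Complex.im_mul_ofReal, Complex.im_ofReal_mul,
    Complex.ofReal_im]
  ring

/-- If the energy flux is constant on an interval, the radial profile vanishes there, and so do
its two parts. -/
theorem radialProfile_eq_zero_of_flux_const (hZ : IsCylinderFamily m Z)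
    (hl : l ^ 2 = (n : ℤ) ^ 2) (hn : n ≠ 0) {ρ η : ℝ} (hρ : 0 < ρ) {γ : ℂ}
    (hγ : (ρ : ℂ) * γ = η * m ^ 2) (hγi : γ.im ≠ 0) (hm : m ≠ 0) {I : Set ℝ} (hI : IsOpen I)
    (hpos : ∀ r ∈ I, 0 < r) {C : ℝ}
    (hC : ∀ r ∈ I, (energyFlux (ρ * γ) m n l A E Z r).im = C) :
    ∀ r ∈ I, A * Z n r = 0 ∧ E = 0 := by
  have key : ∀ r ∈ I, radialProfile n l A E Z r = 0 ∧ radialSlope m n l A E Z r = 0 := by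
    intro r hr
    have h1 := hasDerivAt_energyFlux_im (A := A) (E := E) hZ hl hγ (hpos r hr)
    have h2 : HasDerivAt (fun r => (energyFlux (ρ * γ) m n l A E Z r).im) 0 r := by
      refine (hasDerivAt_const r C).congr_of_eventuallyEq ?_
      filter_upwards [hI.mem_nhds hr] with s hs using hC s hs
    have h3 := h1.unique h2
    have hn' : (0 : ℝ) < (n : ℝ) ^ 2 := by positivity
    have h4 : (n : ℝ) ^ 2 * ‖radialProfile n l A E Z r‖ ^ 2 +
        ‖radialSlope m n l A E Z r‖ ^ 2 = 0 := by
      have := (mul_eq_zero.1 ((mul_eq_zero.1 h3).resolve_left hγi)).resolve_left hρ.ne'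
      exact (div_eq_zero_iff.1 this).resolve_right (hpos r hr).ne'
    have h5 : ‖radialProfile n l A E Z r‖ ^ 2 = 0 := by
      nlinarith [sq_nonneg ‖radialProfile n l A E Z r‖, sq_nonneg ‖radialSlope m n l A E Z r‖]
    have h6 : ‖radialSlope m n l A E Z r‖ ^ 2 = 0 := by rw [h5] at h4; linarith
    exact ⟨by simpa using h5, by simpa using h6⟩
  intro r hr
  have hr0 : (r : ℂ) ≠ 0 := by exact_mod_cast (hpos r hr).ne'
  have h1 := hasDerivAt_radialSlope (A := A) (E := E) hZ hl (hpos r hr)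
  -- On the open set the slope vanishes identically, so its derivative does too; with Y = 0 that
  -- derivative is -m²r times the cylinder part.
  have h2 : HasDerivAt (radialSlope m n l A E Z) 0 r := by
    refine (hasDerivAt_const r (0 : ℂ)).congr_of_eventuallyEq ?_
    filter_upwards [hI.mem_nhds hr] with s hs using (key s hs).2
  have h3 := h1.unique h2
  rw [(key r hr).1] at h3
  have h4 : A * Z n r = 0 := by
    have : m ^ 2 * r * (A * Z n r) = 0 := by linear_combination -h3
    exact (mul_eq_zero.1 this).resolve_left (mul_ne_zero (pow_ne_zero _ hm) hr0)
  refine ⟨h4, ?_⟩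
  have h5 := (key r hr).1
  rw [radialProfile, h4, zero_add] at h5
  exact (mul_eq_zero.1 h5).resolve_right (zpow_ne_zero _ hr0)

/-- The energy flux at the interface, in terms of interface velocity and tangential stress. -/
theorem energyFlux_eq_of_radialProfile_eq_zero (hl : l ^ 2 = (n : ℤ) ^ 2) {η : ℂ} (hr : 0 < r)
    (h0 : radialProfile n l A E Z r = 0) :
    energyFlux (η * m ^ 2) m n l A E Z r =
      tangentialStressFactor η m n l A E Z r * (r * conj (angularFactor m n l A E Z r)) -
        2 * η * (angularFactor m n l A E Z r * conj (angularFactor m n l A E Z r)) := by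
  have hr' : (r : ℂ) ≠ 0 := by exact_mod_cast hr.ne'
  have hl' : (l : ℂ) ^ 2 = (n : ℂ) ^ 2 := by exact_mod_cast hl
  have hS : radialSlope m n l A E Z r = -r * angularFactor m n l A E Z r := by
    rw [radialSlope, angularFactor, zpow_sub_one₀ hr']
    field_simp
    ring
  have hE : E * (r : ℂ) ^ l = -(A * Z n r) := by
    rw [radialProfile] at h0; linear_combination h0
  have hT : tangentialStressFactor η m n l A E Z r * r = 2 * η * angularFactor m n l A E Z r -
      η * m ^ 2 * r * (A * Z n r) := by
    have h2 : (r : ℂ) ^ (l - 2) = (r : ℂ) ^ l / (r : ℂ) ^ 2 := by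
      rw [zpow_sub₀ hr']; norm_cast
    rw [tangentialStressFactor, angularFactor, zpow_sub_one₀ hr', h2]
    field_simp
    linear_combination 2 * η * (l : ℂ) ^ 2 * hE - 2 * η * A * Z n r * hl'
  rw [energyFlux, h0, map_zero, hS, map_mul, map_neg, Complex.conj_ofReal]
  linear_combination (-conj (angularFactor m n l A E Z r)) * hT

end

end Droplet
end

/-! ### Signs of the energy flux, and injectivity of the system matrix -/

noncomputable section
namespace Droplet
open Filter Topology ComplexConjugate

theorem monotoneOn_energyFlux_im {m : ℂ} {Z : ℤ → ℝ → ℂ} {n : ℕ} {l : ℤ} {A E : ℂ}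
    (hZ : IsCylinderFamily m Z) (hl : l ^ 2 = (n : ℤ) ^ 2)
    {ρ η : ℝ} (hρ : 0 < ρ) {γ : ℂ} (hγ : (ρ : ℂ) * γ = η * m ^ 2) :
    MonotoneOn (fun r => γ.im * (energyFlux (ρ * γ) m n l A E Z r).im) (Set.Ioi 0) := by
  have hd : ∀ r ∈ Set.Ioi (0 : ℝ), HasDerivAt
      (fun r => γ.im * (energyFlux (ρ * γ) m n l A E Z r).im)
      (γ.im * (γ.im * (ρ * (((n : ℝ) ^ 2 * ‖radialProfile n l A E Z r‖ ^ 2 +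
        ‖radialSlope m n l A E Z r‖ ^ 2) / r)))) r := fun r hr =>
    (hasDerivAt_energyFlux_im hZ hl hγ hr).const_mul _
  refine monotoneOn_of_deriv_nonneg (convex_Ioi 0)
    (fun r hr => (hd r hr).continuousAt.continuousWithinAt) ?_ ?_
  · rw [interior_Ioi]
    exact fun r hr => (hd r hr).differentiableAt.differentiableWithinAt
  · rw [interior_Ioi]
    intro r hr
    rw [(hd r hr).deriv, ← mul_assoc]
    have hr' : (0 : ℝ) < r := hr
    exact mul_nonneg (mul_self_nonneg _) (by positivity)

theorem tendsto_energyFlux_droplet (κ m : ℂ) {n : ℕ} (hn : n ≠ 0) (A E : ℂ) :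
    Tendsto (energyFlux κ m n n A E fun n r => besselJ n (m * r)) (𝓝[>] 0) (𝓝 0) := by
  have hJ : ∀ j : ℤ, Continuous fun r : ℝ => besselJ j (m * r) := fun j => by
    have h : Continuous (besselJ j) :=
      continuous_iff_continuousAt.2 fun z => (hasDerivAt_besselJ j z).continuousAt
    exact h.comp (by fun_prop)
  have h1 := hJ n
  have h2 := hJ (n - 1)
  have hc : Continuous (energyFlux κ m n n A E fun n r => besselJ n (m * r)) := by
    unfold energyFlux radialProfile radialSlope
    simp only [zpow_natCast]
    have := Complex.continuous_conj
    fun_prop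
  have h0 : energyFlux κ m n n A E (fun n r => besselJ n (m * r)) 0 = 0 := by
    have hn' : (n : ℤ) ≠ 0 := by exact_mod_cast hn
    simp [energyFlux, hn, besselJ_zero_arg hn']
  have := hc.tendsto 0
  rw [h0] at this
  exact this.mono_left nhdsWithin_le_nhds

theorem tendsto_mul_hankel2_atTop (n : ℤ) {m : ℂ} (hm : m.im < 0) :
    Tendsto (fun r : ℝ => (r : ℂ) * hankel2 n (m * r)) atTop (𝓝 0) := by
  obtain ⟨C, hC, h⟩ := exists_norm_hankel2_le n hm one_pos
  have h1 := (tendsto_rpow_mul_exp_neg_mul_atTop_nhds_zero 1 (-m.im) (by linarith)).const_mul C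
  rw [mul_zero] at h1
  refine squeeze_zero_norm' ?_ h1
  filter_upwards [eventually_ge_atTop 1] with r hr
  have hr0 : (0 : ℝ) ≤ r := by linarith
  rw [norm_mul, Complex.norm_real, Real.norm_of_nonneg hr0, Real.rpow_one, neg_neg]
  calc r * ‖hankel2 n (m * r)‖ ≤ r * (C * Real.exp (m.im * r)) :=
        mul_le_mul_of_nonneg_left (h r hr) hr0
    _ = _ := by ring

theorem tendsto_energyFlux_ambient (κ : ℂ) {m : ℂ} (hm : m.im < 0) {n : ℕ} (hn : n ≠ 0) (B F : ℂ) :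
    Tendsto (energyFlux κ m n (-n) B F fun n r => hankel2 n (m * r)) atTop (𝓝 0) := by
  have h1 := tendsto_hankel2_atTop n hm
  have h2 := tendsto_mul_hankel2_atTop (n - 1) hm
  have h3 : Tendsto (fun r : ℝ => (r : ℂ) ^ (-(n : ℤ))) atTop (𝓝 0) := by
    refine (Complex.continuous_ofReal.tendsto' 0 0 Complex.ofReal_zero).comp
      (tendsto_zpow_atTop_zero (𝕜 := ℝ) (n := -(n : ℤ)) (by omega)) |>.congr fun r => ?_
    simp
  have hY : Tendsto (radialProfile n (-n) B F fun n r => hankel2 n (m * r)) atTop (𝓝 0) := by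
    have := (h1.const_mul B).add (h3.const_mul F)
    simp only [mul_zero, add_zero] at this
    exact this
  have hS : Tendsto (radialSlope m n (-n) B F fun n r => hankel2 n (m * r)) atTop (𝓝 0) := by
    have := (((h2.const_mul m).sub (h1.const_mul (n : ℂ))).const_mul B).add
      (h3.const_mul (((-n : ℤ) : ℂ) * F))
    simp only [mul_zero, sub_zero, add_zero] at this
    refine this.congr fun r => ?_
    simp only [radialSlope, mul_assoc]
  have hc := Complex.continuous_conj.tendsto' 0 0 (map_zero _)
  have := (((h3.const_mul (((-n : ℤ) : ℂ) * F)).mul (hc.comp hY)).add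
    ((h1.const_mul B).mul (hc.comp hS))).const_mul κ
  simp only [mul_zero, add_zero] at this
  exact this

/-- The flux increases from its limit 0 at the centre; in the ambient fluid it increases towards its
limit 0 at infinity. -/
theorem energyFlux_droplet_nonneg (m : ℂ) {n : ℕ} (hn : n ≠ 0) (A E : ℂ) {ρ η : ℝ} (hρ : 0 < ρ)
    {γ : ℂ} (hγ : (ρ : ℂ) * γ = η * m ^ 2) {r : ℝ} (hr : 0 < r) :
    0 ≤ γ.im * (energyFlux (ρ * γ) m n n A E (fun n r => besselJ n (m * r)) r).im := by
  have h := ((Complex.continuous_im.tendsto _).comp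
    (tendsto_energyFlux_droplet (ρ * γ) m hn A E)).const_mul γ.im
  rw [Complex.zero_im, mul_zero] at h
  refine le_of_tendsto h ?_
  filter_upwards [Ioc_mem_nhdsGT hr] with s hs
  exact monotoneOn_energyFlux_im (isCylinderFamily_besselJ m) rfl hρ hγ hs.1 hr hs.2

theorem energyFlux_ambient_nonpos {m : ℂ} (hm : m.im < 0) {n : ℕ} (hn : n ≠ 0) (B F : ℂ) {ρ η : ℝ}
    (hρ : 0 < ρ) {γ : ℂ} (hγ : (ρ : ℂ) * γ = η * m ^ 2) {r : ℝ} (hr : 0 < r) :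
    γ.im * (energyFlux (ρ * γ) m n (-n) B F (fun n r => hankel2 n (m * r)) r).im ≤ 0 := by
  have h := ((Complex.continuous_im.tendsto _).comp
    (tendsto_energyFlux_ambient (ρ * γ) hm hn B F)).const_mul γ.im
  rw [Complex.zero_im, mul_zero] at h
  refine ge_of_tendsto h ?_
  filter_upwards [eventually_ge_atTop r] with s hs
  exact monotoneOn_energyFlux_im (isCylinderFamily_hankel2 hm) (neg_sq _) hρ hγ hr
    (hr.trans_le hs) hs

theorem exists_besselJ_ne_zero (n : ℕ) {m : ℂ} (hm : m ≠ 0) {r₀ : ℝ} (hr₀ : 0 < r₀) :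
    ∃ r ∈ Set.Ioo 0 r₀, besselJ n (m * r) ≠ 0 := by
  have hc : Continuous fun r : ℝ => besselG n ((m * r / 2) ^ 2) :=
    (continuous_besselG n).comp (by fun_prop)
  have h0 : ∀ᶠ r : ℝ in 𝓝[>] 0, besselG n ((m * r / 2) ^ 2) ≠ 0 := by
    refine (hc.tendsto 0).eventually_ne ?_ |>.filter_mono nhdsWithin_le_nhds
    simpa using besselG_zero_ne_zero n
  obtain ⟨r, h, hr⟩ := (h0.and (Ioo_mem_nhdsGT hr₀)).exists
  refine ⟨r, hr, ?_⟩
  have hr' : (r : ℂ) ≠ 0 := by exact_mod_cast hr.1.ne'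
  rw [besselJ_natCast]
  exact mul_ne_zero (pow_ne_zero _ (div_ne_zero (mul_ne_zero hm hr') two_ne_zero)) h

/-- A real γ ≥ 0 would make m² real and nonnegative, hence m real. -/
theorem im_ne_zero_of_sq {m : ℂ} (hm : m.im < 0) {a : ℝ} (ha : 0 < a) {γ : ℂ} (hγ : 0 ≤ γ.re)
    (h : (a : ℂ) * m ^ 2 = γ) : γ.im ≠ 0 := by
  intro h0
  rw [← h, Complex.im_ofReal_mul] at h0
  rw [← h, Complex.re_ofReal_mul] at hγ
  have h1 := nonneg_of_mul_nonneg_right hγ ha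
  have h2 := (mul_eq_zero.1 h0).resolve_left ha.ne'
  simp only [sq, Complex.mul_re, Complex.mul_im] at h1 h2
  have h3 : m.re = 0 := by
    have : m.re * (2 * m.im) = 0 := by linarith
    exact (mul_eq_zero.1 this).resolve_right (by linarith)
  rw [h3] at h1
  nlinarith

/-- A kernel vector is a pair of fields with no normal velocity at the interface and continuous
tangential velocity and stress. The fluxes from the two sides then have equal imaginary parts there
but opposite signs, so both fields vanish. -/
theorem dispersionMatrix_injective (P : Params) {k : ℕ} (hk : k ≠ 0) {γ : ℂ} (hγ : 0 ≤ γ.re)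
    {mD mA : ℂ} (hD : ((P.ηD / P.ρD : ℝ) : ℂ) * mD ^ 2 = γ)
    (hA : ((P.ηA / P.ρA : ℝ) : ℂ) * mA ^ 2 = γ) (hm : mA.im < 0) :
    Function.Injective (dispersionMatrix P k mD mA).mulVec := by
  have hγi := im_ne_zero_of_sq hm (div_pos P.ηA_pos P.ρA_pos) hγ hA
  have hmA : mA ≠ 0 := by rintro rfl; simp at hm
  have hmD : mD ≠ 0 := by rintro rfl; rw [← hD] at hγi; simp at hγi
  have hρD : (P.ρD : ℂ) ≠ 0 := by exact_mod_cast P.ρD_pos.ne'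
  have hρA : (P.ρA : ℂ) ≠ 0 := by exact_mod_cast P.ρA_pos.ne'
  have hDγ : (P.ρD : ℂ) * γ = P.ηD * mD ^ 2 := by rw [← hD]; push_cast; field_simp
  have hAγ : (P.ρA : ℂ) * γ = P.ηA * mA ^ 2 := by rw [← hA]; push_cast; field_simp
  have hR := P.R₀_pos
  have hR' : (P.R₀ : ℂ) ≠ 0 := by exact_mod_cast hR.ne'
  have hk' : (k : ℂ) ≠ 0 := by exact_mod_cast hk
  suffices h : ∀ v, (dispersionMatrix P k mD mA).mulVec v = 0 → v = 0 by
    intro v w hvw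
    have := h (v - w) (by rw [Matrix.mulVec_sub, sub_eq_zero]; exact hvw)
    exact sub_eq_zero.1 this
  intro v hv
  rw [dispersionMatrix_mulVec, funext_iff, forall_fin_five] at hv
  simp only [Matrix.cons_val, Pi.zero_apply] at hv
  -- The normal stress row is dropped: without normal velocity the normal stress does no work.
  obtain ⟨h1, h2, h3, -, h5⟩ := hv
  have hZD := isCylinderFamily_besselJ mD
  have hZA := isCylinderFamily_hankel2 hm
  have h1' : radialProfile k k (v 0) (v 2) (fun n r => besselJ n (mD * r)) P.R₀ = 0 :=
    (mul_eq_zero.1 h1).resolve_left (div_ne_zero hk' hR')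
  have h2' : radialProfile k (-k) (v 1) (v 3) (fun n r => hankel2 n (mA * r)) P.R₀ = 0 :=
    (mul_eq_zero.1 h2).resolve_left (div_ne_zero hk' hR')
  have eD := energyFlux_eq_of_radialProfile_eq_zero (m := mD) rfl (η := P.ηD) hR h1'
  have eA := energyFlux_eq_of_radialProfile_eq_zero (m := mA) (neg_sq _) (η := P.ηA) hR h2'
  rw [← hDγ, sub_eq_zero.1 h3, sub_eq_zero.1 h5, Complex.mul_conj] at eD
  rw [← hAγ, Complex.mul_conj] at eA
  -- The two flux formulas differ only by terms η|a|² with a the common tangential velocity factor,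
  -- and these are real.
  have hEq : (energyFlux (P.ρD * γ) mD k k (v 0) (v 2) (fun n r => besselJ n (mD * r)) P.R₀).im =
      (energyFlux (P.ρA * γ) mA k (-k) (v 1) (v 3) (fun n r => hankel2 n (mA * r)) P.R₀).im := by
    rw [eD, eA]
    simp
  have dR := energyFlux_droplet_nonneg mD hk (v 0) (v 2) P.ρD_pos hDγ hR
  have aR := energyFlux_ambient_nonpos hm hk (v 1) (v 3) P.ρA_pos hAγ hR
  -- The flux argument will give A·J = 0 and B·H = 0 on the two intervals; at these radii J and H
  -- can be divided out.
  obtain ⟨r₁, hr₁, hJ⟩ := exists_besselJ_ne_zero k hmD hR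
  obtain ⟨r₂, hr₂, hH⟩ := exists_hankel2_ne_zero k hm hR
  obtain ⟨hA0, hE0⟩ := radialProfile_eq_zero_of_flux_const (A := v 0) (E := v 2) (C := 0) hZD rfl
    hk P.ρD_pos hDγ hγi hmD (isOpen_Ioo (a := 0) (b := P.R₀)) (fun r hr => hr.1) (fun r hr => by
      have := energyFlux_droplet_nonneg mD hk (v 0) (v 2) P.ρD_pos hDγ hr.1
      have := monotoneOn_energyFlux_im (n := k) (l := k) (A := v 0) (E := v 2) hZD rfl P.ρD_pos hDγ hr.1 hR hr.2.le
      rw [hEq] at dR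
      have h0 := (mul_eq_zero.1 (le_antisymm aR dR)).resolve_left hγi
      simp only [hEq, h0, mul_zero] at this
      exact (mul_eq_zero.1 (le_antisymm this ‹_›)).resolve_left hγi) r₁ hr₁
  obtain ⟨hB0, hF0⟩ := radialProfile_eq_zero_of_flux_const (A := v 1) (E := v 3) (C := 0) hZA
    (neg_sq _) hk P.ρA_pos hAγ hγi hmA (isOpen_Ioi (a := P.R₀)) (fun r hr => hR.trans hr)
    (fun r hr => by
      have := energyFlux_ambient_nonpos hm hk (v 1) (v 3) P.ρA_pos hAγ (hR.trans hr)
      have := monotoneOn_energyFlux_im (n := k) (l := -k) (A := v 1) (E := v 3) hZA (neg_sq _) P.ρA_pos hAγ hR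
        (hR.trans hr) (le_of_lt hr)
      rw [hEq] at dR
      have h0 := (mul_eq_zero.1 (le_antisymm aR dR)).resolve_left hγi
      simp only [h0, mul_zero] at this
      exact (mul_eq_zero.1 (le_antisymm ‹_› this)).resolve_left hγi) r₂ hr₂
  funext i
  fin_cases i
  · exact (mul_eq_zero.1 hA0).resolve_right hJ
  · exact (mul_eq_zero.1 hB0).resolve_right hH
  · exact hE0
  · exact hF0

end Droplet
end

noncomputable section
namespace Droplet

/-! ## Solvability of the overdetermined system -/

theorem augmentedMatrix_mulVec (P : Params) (k : ℕ) (γ mD mA : ℂ) (v : Fin 4 → ℂ) (c : ℂ) :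
    (augmentedMatrix P k γ mD mA).mulVec (Fin.snoc (α := fun _ => ℂ) v c) =
      (dispersionMatrix P k mD mA).mulVec v + c • dispersionRhs P k γ := by
  funext i
  simp only [Matrix.mulVec, dotProduct, Fin.sum_univ_castSucc (n := 4), augmentedMatrix,
    Matrix.of_apply, Fin.snoc_castSucc, Fin.snoc_last, Pi.add_apply, Pi.smul_apply, smul_eq_mul]
  ring

/-- If the last entry of a nonzero kernel vector were 0, the first four entries would contradict
injectivity. Dividing by minus the last entry therefore gives a solution. -/
theorem augmentedMatrix_det_eq_zero_iff {P : Params} {k : ℕ} {γ mD mA : ℂ}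
    (hinj : Function.Injective (dispersionMatrix P k mD mA).mulVec) :
    (augmentedMatrix P k γ mD mA).det = 0 ↔
      ∃ v, (dispersionMatrix P k mD mA).mulVec v = dispersionRhs P k γ := by
  rw [← Matrix.exists_mulVec_eq_zero_iff]
  constructor
  · rintro ⟨w, hw, h⟩
    rw [← Fin.snoc_init_self w, augmentedMatrix_mulVec] at h
    have hc : w (Fin.last 4) ≠ 0 := by
      intro hc
      rw [hc, zero_smul, add_zero] at h
      refine hw ?_
      have h0 : Fin.init w = 0 := hinj (h.trans (Matrix.mulVec_zero _).symm)
      rw [← Fin.snoc_init_self w, h0, hc]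
      funext i
      refine Fin.lastCases ?_ (fun j => ?_) i
      · exact Fin.snoc_last ..
      · exact Fin.snoc_castSucc ..
    refine ⟨-(w (Fin.last 4))⁻¹ • Fin.init w, ?_⟩
    rw [Matrix.mulVec_smul, eq_neg_of_add_eq_zero_left h, smul_neg, neg_smul, neg_neg, smul_smul,
      inv_mul_cancel₀ hc, one_smul]
  · rintro ⟨v, hv⟩
    refine ⟨Fin.snoc (α := fun _ => ℂ) v (-1), fun h => ?_, ?_⟩
    · have := congrFun h (Fin.last 4)
      rw [Fin.snoc_last] at this
      simp at this
    · rw [augmentedMatrix_mulVec, hv]; simp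

/-- The factors turning the coefficients `(A, B, E, F, -1)` into dimensionless ones. -/
def columnScale (P : Params) (k : ℕ) : Fin 5 → ℂ :=
  let s : ℂ := ((P.ρD / P.ηD : ℝ) : ℂ)
  ![s, s, s * (P.R₀ : ℂ) ^ k, s * (P.R₀ : ℂ) ^ (-(k : ℤ)), 1]

/-- The factors turning the equations into dimensionless ones. -/
def rowScale (P : Params) : Fin 5 → ℂ :=
  let s : ℂ := ((P.ρD / P.ηD : ℝ) : ℂ)
  let R : ℂ := P.R₀
  ![R * s, R * s, R * s, R ^ 2 * s / P.ηD, R ^ 2 * s / P.ηD]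

theorem columnScale_ne_zero (P : Params) (k : ℕ) (i : Fin 5) : columnScale P k i ≠ 0 := by
  have h1 : (P.ρD : ℂ) ≠ 0 := by exact_mod_cast P.ρD_pos.ne'
  have h2 : (P.ηD : ℂ) ≠ 0 := by exact_mod_cast P.ηD_pos.ne'
  have h3 : (P.R₀ : ℂ) ≠ 0 := by exact_mod_cast P.R₀_pos.ne'
  fin_cases i <;> simp [columnScale, h1, h2, h3]

theorem rowScale_ne_zero (P : Params) (i : Fin 5) : rowScale P i ≠ 0 := by
  have h1 : (P.ρD : ℂ) ≠ 0 := by exact_mod_cast P.ρD_pos.ne'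
  have h2 : (P.ηD : ℂ) ≠ 0 := by exact_mod_cast P.ηD_pos.ne'
  have h3 : (P.R₀ : ℂ) ≠ 0 := by exact_mod_cast P.R₀_pos.ne'
  fin_cases i <;> simp [rowScale, h1, h2, h3]

/-- Nondimensionalization is diagonal scaling. Stated entrywise it yields both the comparison of
determinants and that of kernels. -/
theorem dimensionlessMatrix_apply (P : Params) (k : ℕ) (γ mD mA : ℂ) (i j : Fin 5) :
    dimensionlessMatrix P k γ mD mA i j * columnScale P k j =
      rowScale P i * augmentedMatrix P k γ mD mA i j := by
  have h2 : (P.ηD : ℂ) ≠ 0 := by exact_mod_cast P.ηD_pos.ne'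
  have h3 : (P.R₀ : ℂ) ≠ 0 := by exact_mod_cast P.R₀_pos.ne'
  have e2 : (P.R₀ : ℂ) ^ (-2 : ℤ) = ((P.R₀ : ℂ) ^ 2)⁻¹ := by rw [zpow_neg]; norm_cast
  have e3 : ∀ l : ℤ, (P.R₀ : ℂ) ^ (l - 2) = (P.R₀ : ℂ) ^ l / (P.R₀ : ℂ) ^ 2 := fun l => by
    rw [zpow_sub₀ h3]; norm_cast
  have aug : ∀ i, augmentedMatrix P k γ mD mA i = ![dispersionMatrix P k mD mA i 0,
      dispersionMatrix P k mD mA i 1, dispersionMatrix P k mD mA i 2,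
      dispersionMatrix P k mD mA i 3, dispersionRhs P k γ i] := fun i => by
    funext j; fin_cases j <;> rfl
  rw [aug]
  have hk := pow_ne_zero k h3
  revert i j
  simp only [forall_fin_five]
  simp only [dimensionlessMatrix, scaledAugmentedMatrix, columnScale, rowScale, dispersionMatrix,
    dispersionRhs, Matrix.of_apply, Matrix.cons_val, e2, e3, zpow_sub_one₀ h3, zpow_neg,
    zpow_natCast, Complex.ofReal_div, Complex.ofReal_mul, Complex.ofReal_pow]
  refine ⟨⟨?_, ?_, ?_, ?_, ?_⟩, ⟨?_, ?_, ?_, ?_, ?_⟩, ⟨?_, ?_, ?_, ?_, ?_⟩, ⟨?_, ?_, ?_, ?_, ?_⟩,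
    ⟨?_, ?_, ?_, ?_, ?_⟩⟩ <;> field_simp <;> ring

theorem dimensionlessMatrix_mulVec (P : Params) (k : ℕ) (γ mD mA : ℂ) (w : Fin 5 → ℂ) :
    (dimensionlessMatrix P k γ mD mA).mulVec (columnScale P k * w) =
      rowScale P * (augmentedMatrix P k γ mD mA).mulVec w := by
  funext i
  simp only [Matrix.mulVec, dotProduct, Pi.mul_apply, Finset.mul_sum, ← mul_assoc,
    dimensionlessMatrix_apply]

theorem dimensionlessMatrix_det_eq_zero_iff (P : Params) (k : ℕ) (γ mD mA : ℂ) :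
    (augmentedMatrix P k γ mD mA).det = 0 ↔ (dimensionlessMatrix P k γ mD mA).det = 0 := by
  have h : dimensionlessMatrix P k γ mD mA * Matrix.diagonal (columnScale P k) =
      Matrix.diagonal (rowScale P) * augmentedMatrix P k γ mD mA := by
    ext i j
    rw [Matrix.mul_diagonal, Matrix.diagonal_mul, dimensionlessMatrix_apply]
  have h := congrArg Matrix.det h
  rw [Matrix.det_mul, Matrix.det_mul, Matrix.det_diagonal, Matrix.det_diagonal] at h
  have hc := Finset.prod_ne_zero_iff.2 fun i (_ : i ∈ Finset.univ) => columnScale_ne_zero P k i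
  have hr := Finset.prod_ne_zero_iff.2 fun i (_ : i ∈ Finset.univ) => rowScale_ne_zero P i
  constructor <;> intro h0
  · rw [h0, mul_zero] at h; exact (mul_eq_zero.1 h).resolve_right hc
  · rw [h0, zero_mul] at h; exact (mul_eq_zero.1 h.symm).resolve_left hr

theorem dimensionlessVector_eq (P : Params) (k : ℕ) (v : Fin 4 → ℂ) :
    dimensionlessVector P k v = columnScale P k * Fin.snoc (α := fun _ => ℂ) v (-1) := by
  funext i
  fin_cases i
  · rfl
  · rfl
  · rfl
  · rfl
  · exact (one_mul (-1 : ℂ)).symm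

theorem mulVec_dimensionlessVector_eq_zero_iff (P : Params) (k : ℕ) (γ mD mA : ℂ)
    (v : Fin 4 → ℂ) :
    (dispersionMatrix P k mD mA).mulVec v = dispersionRhs P k γ ↔
      (dimensionlessMatrix P k γ mD mA).mulVec (dimensionlessVector P k v) = 0 := by
  rw [dimensionlessVector_eq, dimensionlessMatrix_mulVec, augmentedMatrix_mulVec, neg_one_smul,
    ← sub_eq_add_neg, ← sub_eq_zero, funext_iff, funext_iff]
  simp [rowScale_ne_zero]

theorem exists_dimensionlessVector_eq (P : Params) (k : ℕ) {w : Fin 5 → ℂ} (hw : w 4 = -1) :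
    ∃ v, dimensionlessVector P k v = w := by
  refine ⟨fun i => w i.castSucc / columnScale P k i.castSucc, ?_⟩
  rw [dimensionlessVector_eq]
  funext i
  refine Fin.lastCases ?_ (fun j => ?_) i
  · rw [Pi.mul_apply, Fin.snoc_last]
    exact (one_mul (-1 : ℂ)).trans hw.symm
  · rw [Pi.mul_apply, Fin.snoc_castSucc, mul_div_cancel₀ _ (columnScale_ne_zero P k _)]

/-- Every vector with last entry -1 is the scaled form of some coefficient vector, so uniqueness is
inherited from injectivity. -/
theorem existsUnique_dimensionless {P : Params} {k : ℕ} {γ mD mA : ℂ}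
    (hinj : Function.Injective (dispersionMatrix P k mD mA).mulVec)
    (h : (dimensionlessMatrix P k γ mD mA).det = 0) :
    ∃! w : Fin 5 → ℂ, (dimensionlessMatrix P k γ mD mA).mulVec w = 0 ∧ w 4 = -1 := by
  rw [← dimensionlessMatrix_det_eq_zero_iff, augmentedMatrix_det_eq_zero_iff hinj] at h
  obtain ⟨v, hv⟩ := h
  refine ⟨dimensionlessVector P k v,
    ⟨(mulVec_dimensionlessVector_eq_zero_iff P k γ mD mA v).1 hv, rfl⟩, ?_⟩
  rintro w ⟨hw, hw4⟩
  obtain ⟨v', rfl⟩ := exists_dimensionlessVector_eq P k hw4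
  rw [← mulVec_dimensionlessVector_eq_zero_iff] at hw
  rw [hinj (hw.trans hv.symm)]

theorem mem_span_col_iff {P : Params} {k : ℕ} {γ mD mA : ℂ}
    (hinj : Function.Injective (dispersionMatrix P k mD mA).mulVec) :
    dispersionRhs P k γ ∈ Submodule.span ℂ (Set.range (dispersionMatrix P k mD mA).col) ↔
      (augmentedMatrix P k γ mD mA).det = 0 := by
  rw [augmentedMatrix_det_eq_zero_iff hinj, ← Matrix.range_mulVecLin]
  exact LinearMap.mem_range

end Droplet
end

noncomputable section
namespace Droplet
open Filter Topology

/-! ## Matching time and angular dependence -/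

/-- Comparison of value and derivative at t = 1; only one of the two amplitudes needs to be known
nonzero. -/
theorem exp_rate_unique {a b X Y : ℂ} (hY : Y ≠ 0)
    (h : ∀ t : ℝ, 0 < t → Complex.exp (-a * (t : ℂ)) * X = Complex.exp (-b * (t : ℂ)) * Y) :
    a = b := by
  have h1 := (hasDerivAt_exp_neg_mul a 1).mul_const X
  have h2 := (hasDerivAt_exp_neg_mul b 1).mul_const Y
  have h3 := h1.unique (h2.congr_of_eventuallyEq (by
    filter_upwards [lt_mem_nhds one_pos] with t ht using h t ht))
  have h4 := h 1 one_pos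
  have h5 : (a - b) * (Complex.exp (-b * ((1 : ℝ) : ℂ)) * Y) = 0 := by
    linear_combination -h3 - a * h4
  exact sub_eq_zero.1 ((mul_eq_zero.1 h5).resolve_right (mul_ne_zero (Complex.exp_ne_zero _) hY))

/-- Differentiation gives e^{-at}aX = e^{-bt}bY. If bY ≠ 0, the rates agree and X = Y, which makes
the constant Z zero. If bY = 0, then X = 0, so Y carries the whole constant and b = 0. -/
theorem rate_eq_zero_of_sub_const {a b X Y Z : ℂ} (ha : a ≠ 0) (hZ : Z ≠ 0)
    (h : ∀ t : ℝ, 0 < t → Complex.exp (-a * (t : ℂ)) * X - Complex.exp (-b * (t : ℂ)) * Y = Z) :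
    b = 0 ∧ Y ≠ 0 := by
  have hd : ∀ t : ℝ, 0 < t → Complex.exp (-a * (t : ℂ)) * (a * X) =
      Complex.exp (-b * (t : ℂ)) * (b * Y) := fun t ht => by
    have h1 := ((hasDerivAt_exp_neg_mul a t).mul_const X).sub
      ((hasDerivAt_exp_neg_mul b t).mul_const Y)
    have h2 := h1.unique ((hasDerivAt_const t Z).congr_of_eventuallyEq (by
      filter_upwards [lt_mem_nhds ht] with s hs using h s hs))
    linear_combination -h2
  have h1 := h 1 one_pos
  have h2 := hd 1 one_pos
  by_cases hbY : b * Y = 0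
  · rw [hbY, mul_zero] at h2
    have hX : X = 0 := (mul_eq_zero.1 ((mul_eq_zero.1 h2).resolve_left
      (Complex.exp_ne_zero _))).resolve_left ha
    have hY : Y ≠ 0 := by
      rintro rfl
      rw [hX] at h1
      simp only [mul_zero, sub_zero] at h1
      exact hZ h1.symm
    exact ⟨(mul_eq_zero.1 hbY).resolve_right hY, hY⟩
  · have hab := exp_rate_unique hbY hd
    subst hab
    refine absurd ?_ (mul_ne_zero ha hZ)
    linear_combination h2 - a * h1

/-- At x = π/max(n, k) both nx and kx lie in [0, π], where the cosine is injective. -/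
theorem eq_of_cos_mul_eq {n k : ℕ} (hk : k ≠ 0)
    (h : ∀ x : ℝ, Real.cos (n * x) = Real.cos (k * x)) : n = k := by
  have hN : (0 : ℝ) < (max n k : ℕ) := by
    have : 0 < max n k := lt_of_lt_of_le (Nat.pos_of_ne_zero hk) (le_max_right _ _)
    exact_mod_cast this
  have hx : (0 : ℝ) < Real.pi / (max n k : ℕ) := div_pos Real.pi_pos hN
  have hmem : ∀ j : ℕ, j ≤ max n k → (j : ℝ) * (Real.pi / (max n k : ℕ)) ∈ Set.Icc 0 Real.pi :=
    fun j hj => by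
      refine ⟨by positivity, ?_⟩
      have hj' : (j : ℝ) ≤ (max n k : ℕ) := by exact_mod_cast hj
      calc (j : ℝ) * (Real.pi / (max n k : ℕ)) ≤ (max n k : ℕ) * (Real.pi / (max n k : ℕ)) :=
            mul_le_mul_of_nonneg_right hj' hx.le
        _ = Real.pi := mul_div_cancel₀ _ hN.ne'
  have := Real.injOn_cos (hmem n (le_max_left _ _)) (hmem k (le_max_right _ _)) (h _)
  exact_mod_cast mul_right_cancel₀ hx.ne' this

theorem modeProfile_add_add_sub (k : ℕ) (β θ x : ℝ) :
    modeProfile k β (θ + x) + modeProfile k β (θ - x) =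
      2 * Real.cos (k * x) * modeProfile k β θ := by
  simp only [modeProfile, mul_add, mul_sub, Real.cos_add, Real.cos_sub, Real.sin_add, Real.sin_sub]
  ring

/-- A multiple of the angular profile of the interface perturbation has the same mode number and
proportional coefficients. -/
theorem angular_match {n k : ℕ} (hk : k ≠ 0) {β : ℝ} {C D r q : ℂ} (hq : q ≠ 0)
    (h : ∀ θ : ℝ, (D * (Real.cos (n * θ) : ℂ) - C * (Real.sin (n * θ) : ℂ)) * r =
      modeProfile k β θ * q) :
    n = k ∧ ∃ s : ℂ, D = s * β ∧ C = -s * (√(1 - β ^ 2) : ℂ) := by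
  obtain ⟨θ₀, hθ₀⟩ := exists_modeProfile_ne_zero hk (β := β)
  have hθ₀' : (modeProfile k β θ₀ : ℂ) ≠ 0 := by exact_mod_cast hθ₀
  have hr : r ≠ 0 := by
    rintro rfl
    have := h θ₀
    rw [mul_zero] at this
    exact mul_ne_zero hθ₀' hq this.symm
  have hn : n = k := by
    -- Averaging over θ₀ ± x multiplies the value at θ₀ by cos nx on one side and by cos kx on the
    -- other; that value is nonzero.
    refine eq_of_cos_mul_eq hk fun x => ?_
    have h1 := h (θ₀ + x)
    have h2 := h (θ₀ - x)
    have h3 := h θ₀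
    have h4 : (modeProfile k β (θ₀ + x) : ℂ) + modeProfile k β (θ₀ - x) =
        2 * Real.cos (k * x) * modeProfile k β θ₀ := by
      exact_mod_cast modeProfile_add_add_sub k β θ₀ x
    have h5 : ((Real.cos (n * x) : ℝ) : ℂ) - ((Real.cos (k * x) : ℝ) : ℂ) = 0 := by
      refine (mul_eq_zero.1 (?_ : _ * (modeProfile k β θ₀ * q) = 0)).resolve_right
        (mul_ne_zero hθ₀' hq)
      simp only [mul_add, mul_sub, Real.cos_add, Real.cos_sub, Real.sin_add, Real.sin_sub] at h1 h2
      push_cast at h1 h2 h3 h4 ⊢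
      linear_combination (1 / 2 : ℂ) * (h1 + h2) + (1 / 2 : ℂ) * q * h4 - Complex.cos (n * x) * h3
    exact_mod_cast sub_eq_zero.1 h5
  subst hn
  have hn' : (n : ℝ) ≠ 0 := by exact_mod_cast hk
  -- The angles 0 and π/(2n) read off D and C respectively.
  refine ⟨rfl, q / r, ?_, ?_⟩
  · have h0 := h 0
    simp only [modeProfile, mul_zero, Real.cos_zero, Real.sin_zero, Complex.ofReal_one,
      Complex.ofReal_zero, mul_one, sub_zero, add_zero] at h0
    rw [div_mul_eq_mul_div, eq_div_iff hr, h0, mul_comm]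
  · have h0 := h (Real.pi / 2 / n)
    simp only [modeProfile, mul_div_cancel₀ _ hn', Real.cos_pi_div_two, Real.sin_pi_div_two,
      Complex.ofReal_one, Complex.ofReal_zero, mul_zero, mul_one, zero_add, zero_sub] at h0
    rw [← neg_div, div_mul_eq_mul_div, eq_div_iff hr]
    linear_combination -h0

/-! ## Necessary conditions on the modal coefficients -/

namespace ModalCoeffs

variable {c : ModalCoeffs} {P : Params} {k : ℕ} {β : ℝ} {γ : ℂ}

/-- The fields are bilinear in the angular and radial coefficients, so the scalars s can be moved
from the former to the latter without changing the flow. -/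
theorem isResponse_normalizedCoeffs_iff {sD sA : ℂ} (hnD : c.nD = k) (hnA : c.nA = k)
    (hDD : c.DD = sD * (β : ℂ)) (hCD : c.CD = -sD * (√(1 - β ^ 2) : ℂ))
    (hDA : c.DA = sA * (β : ℂ)) (hCA : c.CA = -sA * (√(1 - β ^ 2) : ℂ)) :
    (normalizedCoeffs k β c.mD c.mA ![sD * c.A, sA * c.B, sD * c.E, sA * c.F]).IsResponse P k β γ ↔
      c.IsResponse P k β γ := by
  have hD : (normalizedCoeffs k β c.mD c.mA ![sD * c.A, sA * c.B, sD * c.E, sA * c.F]).dropletFlow P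
      = c.dropletFlow P := by
    rw [dropletFlow, dropletFlow, Flow.mk.injEq, hnD, hDD, hCD]
    refine ⟨?_, ?_⟩
    · funext t x i
      simp only [ofPolar, normalizedCoeffs, Matrix.cons_val]
      ring
    · funext t x
      simp only [normalizedCoeffs, Matrix.cons_val]
      ring
  have hA : (normalizedCoeffs k β c.mD c.mA ![sD * c.A, sA * c.B, sD * c.E, sA * c.F]).ambientFlow P
      = c.ambientFlow P := by
    rw [ambientFlow, ambientFlow, Flow.mk.injEq, hnA, hDA, hCA]
    refine ⟨?_, ?_⟩
    · funext t x i
      simp only [ofPolar, normalizedCoeffs, Matrix.cons_val]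
      ring
    · funext t x
      simp only [normalizedCoeffs, Matrix.cons_val]
      ring
  rw [IsResponse, IsResponse, hD, hA]

/-- The kinematic condition suffices, as its right-hand side is a nonzero multiple of the profile
when γ ≠ 0. -/
theorem IsResponse.droplet_mode (h : c.IsResponse P k β γ) (hk : k ≠ 0) (hγ : γ ≠ 0) :
    c.dropletRate P = γ ∧ c.nD = k ∧
      ∃ s : ℂ, c.DD = s * β ∧ c.CD = -s * (√(1 - β ^ 2) : ℂ) := by
  have hq : -γ * (P.R₀ : ℂ) ≠ 0 :=
    mul_ne_zero (neg_ne_zero.2 hγ) (by exact_mod_cast P.R₀_pos.ne')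
  have hkin := h.kinematic_droplet
  simp only [c.droplet_normal, velocityVariation_modeShape P.R₀_pos] at hkin
  obtain ⟨θ₀, hθ₀⟩ := exists_modeProfile_ne_zero hk (β := β)
  have hrate : c.dropletRate P = γ :=
    exp_rate_unique (mul_ne_zero (by exact_mod_cast hθ₀) hq) fun t ht => hkin t ht θ₀
  rw [hrate] at hkin
  exact ⟨hrate, angular_match hk hq fun θ =>
    mul_left_cancel₀ (Complex.exp_ne_zero _) (hkin 1 one_pos θ)⟩

theorem IsResponse.ambient_mode (h : c.IsResponse P k β γ) (hm : c.mA.im < 0) (hk : k ≠ 0)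
    (hγ : γ ≠ 0) :
    c.ambientRate P = γ ∧ c.nA = k ∧
      ∃ s : ℂ, c.DA = s * β ∧ c.CA = -s * (√(1 - β ^ 2) : ℂ) := by
  have hq : -γ * (P.R₀ : ℂ) ≠ 0 :=
    mul_ne_zero (neg_ne_zero.2 hγ) (by exact_mod_cast P.R₀_pos.ne')
  have hkin := h.kinematic_ambient
  simp only [ambient_normal P hm, velocityVariation_modeShape P.R₀_pos] at hkin
  obtain ⟨θ₀, hθ₀⟩ := exists_modeProfile_ne_zero hk (β := β)
  have hrate : c.ambientRate P = γ :=
    exp_rate_unique (mul_ne_zero (by exact_mod_cast hθ₀) hq) fun t ht => hkin t ht θ₀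
  rw [hrate] at hkin
  exact ⟨hrate, angular_match hk hq fun θ =>
    mul_left_cancel₀ (Complex.exp_ne_zero _) (hkin 1 one_pos θ)⟩

theorem ambientRate_ne_zero (hm : c.mA.im < 0) : c.ambientRate P ≠ 0 := by
  have hmA : c.mA ≠ 0 := fun h => by simp [h] at hm
  have : ((P.ηA / P.ρA : ℝ) : ℂ) ≠ 0 := by exact_mod_cast (div_pos P.ηA_pos P.ρA_pos).ne'
  exact mul_ne_zero this (pow_ne_zero _ hmA)

/-- A steady interface perturbation has no modal response: the ambient stress decays, and the
droplet can balance the capillary pressure only by a flow through the interface. -/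
theorem IsResponse.rate_ne_zero (h : c.IsResponse P k β γ) (hm : c.mA.im < 0) (hk : 2 ≤ k) :
    γ ≠ 0 := by
  rintro rfl
  have hR : (P.R₀ : ℂ) ≠ 0 := by exact_mod_cast P.R₀_pos.ne'
  obtain ⟨θ, hθ⟩ := exists_modeProfile_ne_zero (k := k) (by omega) (β := β)
  have hθ' : (modeProfile k β θ : ℂ) ≠ 0 := by exact_mod_cast hθ
  have hone : (normal θ 0 : ℂ) ^ 2 + (normal θ 1 : ℂ) ^ 2 = 1 := by
    have : normal θ 0 ^ 2 + normal θ 1 ^ 2 = 1 := by simp [normal]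
    exact_mod_cast this
  have hk1 : (k : ℂ) ^ 2 - 1 ≠ 0 := by
    have : (k : ℝ) ^ 2 - 1 ≠ 0 := by
      have : (2 : ℝ) ≤ k := by exact_mod_cast hk
      nlinarith
    exact_mod_cast this
  have hσ : (P.σ : ℂ) ≠ 0 := by exact_mod_cast P.σ_pos.ne'
  set SD := normalStressFactor P.ηD c.mD c.nD c.nD 1 c.A c.E (fun n r => besselJ n (c.mD * r)) P.R₀
    with hSD
  -- The normal component of the stress balance; with γ = 0 its right-hand side does not depend on
  -- time and is nonzero at the chosen angle.
  have hdyn : ∀ t : ℝ, 0 < t →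
      Complex.exp (-c.ambientRate P * (t : ℂ)) *
        ((c.DA * (Real.cos (c.nA * θ) : ℂ) - c.CA * (Real.sin (c.nA * θ) : ℂ)) *
          normalStressFactor P.ηA c.mA c.nA (-c.nA) (-1) c.B c.F
            (fun n r => hankel2 n (c.mA * r)) P.R₀) -
      Complex.exp (-c.dropletRate P * (t : ℂ)) *
        ((c.DD * (Real.cos (c.nD * θ) : ℂ) - c.CD * (Real.sin (c.nD * θ) : ℂ)) * SD) =
      P.σ * (modeProfile k β θ * (-((k : ℂ) ^ 2 - 1) * (P.R₀ : ℂ)⁻¹)) := fun t ht => by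
    have h0 := h.dynamic t ht θ 0
    have h1 := h.dynamic t ht θ 1
    rw [c.droplet_stress, ambient_stress P hm, curvatureVariation_modeShape P.R₀_pos,
      tangent_zero_eq, neg_zero, zero_mul, Complex.exp_zero, ← hSD] at h0
    rw [c.droplet_stress, ambient_stress P hm, curvatureVariation_modeShape P.R₀_pos,
      tangent_one_eq, neg_zero, zero_mul, Complex.exp_zero, ← hSD] at h1
    rw [Complex.ofReal_neg] at h0
    generalize normalStressFactor (P.ηA : ℂ) _ _ _ _ _ _ _ _ = SA at *
    linear_combination (normal θ 0 : ℂ) * h0 + (normal θ 1 : ℂ) * h1 -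
      (Complex.exp (-c.ambientRate P * (t : ℂ)) *
        ((c.DA * (Real.cos (c.nA * θ) : ℂ) - c.CA * (Real.sin (c.nA * θ) : ℂ)) * SA) -
      Complex.exp (-c.dropletRate P * (t : ℂ)) *
        ((c.DD * (Real.cos (c.nD * θ) : ℂ) - c.CD * (Real.sin (c.nD * θ) : ℂ)) * SD) -
      P.σ * (modeProfile k β θ * (-((k : ℂ) ^ 2 - 1) * (P.R₀ : ℂ)⁻¹))) * hone
  obtain ⟨hrate, hY⟩ := rate_eq_zero_of_sub_const (ambientRate_ne_zero hm)
    (mul_ne_zero hσ (mul_ne_zero hθ' (mul_ne_zero (neg_ne_zero.2 hk1) (inv_ne_zero hR)))) hdyn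
  have hmD : c.mD = 0 := by
    have : ((P.ηD / P.ρD : ℝ) : ℂ) ≠ 0 := by exact_mod_cast (div_pos P.ηD_pos P.ρD_pos).ne'
    exact pow_eq_zero_iff two_ne_zero |>.1 ((mul_eq_zero.1 hrate).resolve_left this)
  have hn : c.nD ≠ 0 := by
    intro hn
    exact hY (by rw [hSD, normalStressFactor, hmD, hn]; simp)
  have hJ : besselJ c.nD 0 = 0 := besselJ_zero_arg (by exact_mod_cast hn)
  have hkin := h.kinematic_droplet 1 one_pos θ
  rw [c.droplet_normal, velocityVariation_modeShape P.R₀_pos, hrate, radialFactor, hmD] at hkin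
  simp only [zero_mul, hJ, neg_zero, Complex.exp_zero, mul_zero, one_mul, zero_add] at hkin
  refine hY ?_
  have hn' : (c.nD : ℂ) ≠ 0 := by exact_mod_cast hn
  -- For m_D = 0 the wave part J_n(0) and the pressure vanish; impermeability at θ then kills the
  -- remaining power part, the only source of normal stress.
  have h1 : (c.DD * (Real.cos (c.nD * θ) : ℂ) - c.CD * (Real.sin (c.nD * θ) : ℂ)) * c.E = 0 := by
    have h2 : (c.nD : ℂ) / P.R₀ * (P.R₀ : ℂ) ^ (c.nD : ℤ) ≠ 0 :=
      mul_ne_zero (div_ne_zero hn' hR) (zpow_ne_zero _ hR)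
    refine (mul_eq_zero.1 (?_ : _ * ((c.nD : ℂ) / P.R₀ * (P.R₀ : ℂ) ^ (c.nD : ℤ)) = 0)).resolve_right h2
    linear_combination hkin
  rw [hSD, normalStressFactor, hmD]
  simp only [zero_mul, mul_zero, hJ, zero_div, sub_zero]
  linear_combination (-P.ηD * (2 * c.nD * (((c.nD : ℤ) : ℂ) - 1) * (P.R₀ : ℂ) ^ ((c.nD : ℤ) - 2))) * h1

end ModalCoeffs

/-! ### Characterization and existence of modal responses -/

/-- The modal fields that solve the linearized problem. -/
theorem isResponse_iff (P : Params) {k : ℕ} (hk : 2 ≤ k) (β : ℝ) {γ : ℂ} (hγ : 0 ≤ γ.re)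
    {c : ModalCoeffs} (hm : c.mA.im < 0) :
    c.IsResponse P k β γ ↔
      ((P.ηD / P.ρD : ℝ) : ℂ) * c.mD ^ 2 = γ ∧ ((P.ηA / P.ρA : ℝ) : ℂ) * c.mA ^ 2 = γ ∧
      c.nD = k ∧ c.nA = k ∧
      ∃ sD sA : ℂ,
        c.DD = sD * (β : ℂ) ∧ c.CD = -sD * (Real.sqrt (1 - β ^ 2) : ℂ) ∧
        c.DA = sA * (β : ℂ) ∧ c.CA = -sA * (Real.sqrt (1 - β ^ 2) : ℂ) ∧
        (dispersionMatrix P k c.mD c.mA).mulVec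
          ![sD * c.A, sA * c.B, sD * c.E, sA * c.F] = dispersionRhs P k γ := by
  constructor
  · intro h
    have hγ0 := h.rate_ne_zero hm hk
    obtain ⟨hD, hnD, sD, hDD, hCD⟩ := h.droplet_mode (by omega) hγ0
    obtain ⟨hA, hnA, sA, hDA, hCA⟩ := h.ambient_mode hm (by omega) hγ0
    refine ⟨hD, hA, hnD, hnA, sD, sA, hDD, hCD, hDA, hCA, ?_⟩
    rwa [← normalizedCoeffs_isResponse_iff P hk hγ hD hA hm,
      ModalCoeffs.isResponse_normalizedCoeffs_iff hnD hnA hDD hCD hDA hCA]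
  · rintro ⟨hD, hA, hnD, hnA, sD, sA, hDD, hCD, hDA, hCA, h⟩
    rwa [← normalizedCoeffs_isResponse_iff P hk hγ hD hA hm,
      ModalCoeffs.isResponse_normalizedCoeffs_iff hnD hnA hDD hCD hDA hCA] at h

/-- Only the first column depends on the sign of m_D: J and m_D J_{k-1} both acquire (-1)^k, while
everything else contains m_D². -/
theorem dispersionMatrix_neg_mulVec (P : Params) (k : ℕ) (mD mA a b e f : ℂ) :
    (dispersionMatrix P k (-mD) mA).mulVec ![a, b, e, f] =
      (dispersionMatrix P k mD mA).mulVec ![(-1) ^ k * a, b, e, f] := by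
  have h1 := besselJ_neg_arg k (mD * P.R₀)
  have h2 := besselJ_neg_arg (k - 1) (mD * P.R₀)
  rw [zpow_natCast] at h1
  rw [zpow_sub_one₀ (by norm_num), zpow_natCast, inv_neg_one] at h2
  rw [funext_iff, forall_fin_five]
  simp only [dispersionMatrix, Matrix.mulVec, dotProduct, Fin.sum_univ_four, Matrix.of_apply,
    Matrix.cons_val, neg_mul mD, h1, h2]
  exact ⟨by ring, by ring, by ring, by ring, by ring⟩

/-- A response may come with other wave numbers than the given ones. Its m_A is the same, since its
square and Im m_A < 0 determine it; its m_D agrees up to sign, which is absorbed into the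
coefficient A. -/
theorem exists_isResponse_iff (P : Params) {k : ℕ} (hk : 2 ≤ k) (β : ℝ) {γ : ℂ} (hγ : 0 ≤ γ.re)
    {mD mA : ℂ} (hD : ((P.ηD / P.ρD : ℝ) : ℂ) * mD ^ 2 = γ)
    (hA : ((P.ηA / P.ρA : ℝ) : ℂ) * mA ^ 2 = γ) (hm : mA.im < 0) :
    (∃ c : ModalCoeffs, c.Admissible ∧ c.IsResponse P k β γ) ↔
      (augmentedMatrix P k γ mD mA).det = 0 := by
  have hcD : ((P.ηD / P.ρD : ℝ) : ℂ) ≠ 0 := by exact_mod_cast (div_pos P.ηD_pos P.ρD_pos).ne'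
  have hcA : ((P.ηA / P.ρA : ℝ) : ℂ) ≠ 0 := by exact_mod_cast (div_pos P.ηA_pos P.ρA_pos).ne'
  rw [augmentedMatrix_det_eq_zero_iff
    (dispersionMatrix_injective P (by omega : k ≠ 0) hγ hD hA hm)]
  constructor
  · rintro ⟨c, hc, h⟩
    obtain ⟨hD', hA', -, -, sD, sA, -, -, -, -, h⟩ := (isResponse_iff P hk β hγ hc.2.2).1 h
    have eA : c.mA = mA := by
      rcases sq_eq_sq_iff_eq_or_eq_neg.1 (mul_left_cancel₀ hcA (hA'.trans hA.symm)) with e | e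
      · exact e
      · have := hc.2.2
        rw [e, Complex.neg_im] at this
        linarith
    rw [eA] at h
    rcases sq_eq_sq_iff_eq_or_eq_neg.1 (mul_left_cancel₀ hcD (hD'.trans hD.symm)) with e | e
    · rw [e] at h
      exact ⟨_, h⟩
    · rw [e, dispersionMatrix_neg_mulVec] at h
      exact ⟨_, h⟩
  · rintro ⟨v, hv⟩
    refine ⟨normalizedCoeffs k β mD mA v, ⟨?_, ?_, hm⟩,
      (normalizedCoeffs_isResponse_iff P hk hγ hD hA hm v).2 hv⟩
    · rw [← hD, Complex.re_ofReal_mul] at hγ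
      exact nonneg_of_mul_nonneg_right hγ (div_pos P.ηD_pos P.ρD_pos)
    · rw [← hA, Complex.re_ofReal_mul] at hγ
      exact nonneg_of_mul_nonneg_right hγ (div_pos P.ηA_pos P.ρA_pos)

end Droplet
end

/-! ### The main theorem -/

theorem mainTheorem1 (P : Droplet.Params) (k : ℕ) (hk : 2 ≤ k) (β : ℝ) (hβ0 : 0 ≤ β) (hβ1 : β ≤ 1)
    (γ : ℂ) (hγ : 0 ≤ γ.re) :
    -- which modal fields satisfy the linearized problem
    (∀ c : Droplet.ModalCoeffs, c.Admissible →
      (c.IsResponse P k β γ ↔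
        ((P.ηD / P.ρD : ℝ) : ℂ) * c.mD ^ 2 = γ ∧ ((P.ηA / P.ρA : ℝ) : ℂ) * c.mA ^ 2 = γ ∧
        c.nD = k ∧ c.nA = k ∧
        ∃ sD sA : ℂ,
          c.DD = sD * (β : ℂ) ∧ c.CD = -sD * (Real.sqrt (1 - β ^ 2) : ℂ) ∧
          c.DA = sA * (β : ℂ) ∧ c.CA = -sA * (Real.sqrt (1 - β ^ 2) : ℂ) ∧
          (Droplet.dispersionMatrix P k c.mD c.mA).mulVec
            ![sD * c.A, sA * c.B, sD * c.E, sA * c.F] = Droplet.dispersionRhs P k γ)) ∧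
    -- the algebraic system and the determinant condition
    ∀ mD mA : ℂ, ((P.ηD / P.ρD : ℝ) : ℂ) * mD ^ 2 = γ → ((P.ηA / P.ρA : ℝ) : ℂ) * mA ^ 2 = γ →
      mA.im < 0 →
      (∀ v : Fin 4 → ℂ,
        (Droplet.normalizedCoeffs k β mD mA v).IsResponse P k β γ ↔
          (Droplet.dispersionMatrix P k mD mA).mulVec v = Droplet.dispersionRhs P k γ) ∧
      ((∃ c : Droplet.ModalCoeffs, c.Admissible ∧ c.IsResponse P k β γ) ↔
        (Droplet.augmentedMatrix P k γ mD mA).det = 0) ∧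
      LinearIndependent ℂ (Droplet.dispersionMatrix P k mD mA).col ∧
      (Droplet.dispersionRhs P k γ ∈
          Submodule.span ℂ (Set.range (Droplet.dispersionMatrix P k mD mA).col) ↔
        (Droplet.augmentedMatrix P k γ mD mA).det = 0) ∧
      ((Droplet.augmentedMatrix P k γ mD mA).det = 0 →
        ∃! v : Fin 4 → ℂ,
          (Droplet.dispersionMatrix P k mD mA).mulVec v = Droplet.dispersionRhs P k γ) ∧
      -- the dimensionless form
      ((Droplet.augmentedMatrix P k γ mD mA).det = 0 ↔
        (Droplet.dimensionlessMatrix P k γ mD mA).det = 0) ∧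
      (∀ v : Fin 4 → ℂ,
        (Droplet.dispersionMatrix P k mD mA).mulVec v = Droplet.dispersionRhs P k γ ↔
          (Droplet.dimensionlessMatrix P k γ mD mA).mulVec (Droplet.dimensionlessVector P k v) = 0) ∧
      ((Droplet.dimensionlessMatrix P k γ mD mA).det = 0 →
        ∃! w : Fin 5 → ℂ,
          (Droplet.dimensionlessMatrix P k γ mD mA).mulVec w = 0 ∧ w 4 = -1) := by
  refine ⟨fun c hc => Droplet.isResponse_iff P hk β hγ hc.2.2, fun mD mA hD hA hm => ?_⟩
  have hinj := Droplet.dispersionMatrix_injective P (by omega : k ≠ 0) hγ hD hA hm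
  refine ⟨Droplet.normalizedCoeffs_isResponse_iff P hk hγ hD hA hm,
    Droplet.exists_isResponse_iff P hk β hγ hD hA hm, Matrix.mulVec_injective_iff.1 hinj,
    Droplet.mem_span_col_iff hinj, fun h => ?_,
    Droplet.dimensionlessMatrix_det_eq_zero_iff P k γ mD mA,
    Droplet.mulVec_dimensionlessVector_eq_zero_iff P k γ mD mA,
    Droplet.existsUnique_dimensionless hinj⟩
  obtain ⟨v, hv⟩ := (Droplet.augmentedMatrix_det_eq_zero_iff hinj).1 h
  exact ⟨v, hv, fun w hw => hinj (hw.trans hv.symm)⟩
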